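/- Let $(M,\omega)$ be a symplectic manifold of dimension $2(m+k)$ with a Hamiltonian action of the torus $T=U(1)^k$, with $T$-invariant moment map $\mu_T:M\to\mathfrak t^*\cong\mathbb R^k$. Assume that $M/T$ is a smooth manifold $B$ such that the quotient map $\pi:M\to B$ is a submersion, and that $\mu_T$ is a submersion with connected fibres; let $\phi:B\to\mathfrak t^*$ be the map with $\phi\circ\pi=\mu_T$. Let $\mathcal P\subset T_{\mathbb C}M$ be a polarization (a smooth involutive Lagrangian complex distribution) that is fibering with respect to this diagram, i.e. $\mathcal P\cap\overline{\mathcal P}\cap TM=\ker d\pi$ and $(\mathcal P+\overline{\mathcal P})\cap TM=\ker d\mu_T$. Let $(L,\nabla)$ be a prequantum line bundle (a complex line bundle with connection of curvature $-i\omega$). Let $\kappa_{\mathcal P}$ be a half-canonical bundle, i.e. a complex line bundle with an isomorphism $\kappa_{\mathcal P}^{\otimes2}\cong\mathcal K_{\mathcal P}$, where $\mathcal K_{\mathcal P}\subset\bigwedge^{m+k}T^*_{\mathbb C}M$ is the line bundle of forms annihilated by contraction with $\overline{\mathcal P}$. The Lie algebra $\mathfrak t$ acts on $L\otimes\kappa_{\mathcal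 P}$, lifting the $T$-action: on $L$ by parallel transport along the orbits, and on $\kappa_{\mathcal P}$ by the continuous lift of the natural $T$-action on the forms in $\mathcal K_{\mathcal P}$. A point $\xi\in\mu_T(M)$ (and the leaf $\mu_T^{-1}(\xi)$) is *Bohr–Sommerfeld* if over $\mu_T^{-1}(\xi)$ this action of $\mathfrak t$ descends to $T$, i.e. every element of $\ker(\exp:\mathfrak t\to T)$ acts trivially. A smooth section of $\mathcal K_{\mathcal P}$ is polarized if locally it has the form $\pi^*\Omega_\phi\otimes\mu_T^*\Omega'$, where $\Omega_\phi$ is a smooth section of the relative canonical bundle of $\phi$ (for the complex structure induced by $\mathcal P$ on the fibres of $\phi$) that is holomorphic along the fibres of $\phi$, and $\Omega'$ is a real top-degree form on $\mathfrak t^*$. A smooth section of $\kappa_{\mathcal P}$ is polarized if its square is. A distributional section $\sigma$ of $L$ is polarized if $\nabla_Z\sigma=0$ in the sense of distributions for all smooth sections $Z$ of $\overline{\mathcal P}$. A $\mathcal P$-polarized (distributional) section of $L\otimes\kappa_{\mathcal P}$ is a distributional section which locally is a finite sum of products $\sigma\otimes\tau$ of polarized distributional sections $\sigma$ of $L$ and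 polarized smooth sections $\tau$ of $\kappa_{\mathcal P}$. **Theorem.** (1) If $U\subset\mathfrak t^*$ is an open set containing no Bohr–Sommerfeld point, then every $\mathcal P$-polarized section of $L\otimes\kappa_{\mathcal P}$ over $\mu_T^{-1}(U)$ vanishes identically. (2) Consequently, for every open $U\subset\mathfrak t^*$, every $\mathcal P$-polarized section of $L\otimes\kappa_{\mathcal P}$ over $\mu_T^{-1}(U)$ is supported on the union of the Bohr–Sommerfeld leaves: every point of $\mu_T^{-1}(U)$ that is on no Bohr–Sommerfeld leaf has a neighbourhood on which the section vanishes. -/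

import Mathlib

open Bundle Set Filter Topology Manifold ContDiff TensorProduct

noncomputable section

namespace GeomQuant

/-! ### Vector fields, sections and differential forms on a manifold modelled on `E` -/

section Basic

variable {E : Type*} [NormedAddCommGroup E] [NormedSpace ℝ E]
  {M : Type*} [TopologicalSpace M] [ChartedSpace E M] [IsManifold 𝓘(ℝ, E) 1 M]

/-- The real vector field `X` is smooth on the set `W`. -/
def SmoothFieldOn (X : ∀ x : M, TangentSpace 𝓘(ℝ, E) x) (W : Set M) : Prop :=
  ContMDiffOn 𝓘(ℝ, E) (𝓘(ℝ, E).prod 𝓘(ℝ, E)) ∞ (fun x => TotalSpace.mk' E x (X x)) W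

/-- The section `σ` of the complex line bundle `L` is smooth on the set `W`. -/
def SmoothSectionOn {L : M → Type*} [TopologicalSpace (TotalSpace ℂ L)]
    [∀ x, TopologicalSpace (L x)] [FiberBundle ℂ L] (σ : ∀ x, L x) (W : Set M) : Prop :=
  ContMDiffOn 𝓘(ℝ, E) (𝓘(ℝ, E).prod 𝓘(ℝ, ℂ)) ∞ (fun x => TotalSpace.mk' ℂ x (σ x)) W

/-- Alternating forms on `T_x M`, indexed by a finite type `ι` and with values in `F`;
for `F = ℂ` this is the fibre at `x` of `⋀^ι T^*_ℂ M`. -/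
abbrev FormAt (ι F : Type*) [AddCommGroup F] [Module ℝ F] (x : M) : Type _ :=
  TangentSpace 𝓘(ℝ, E) x [⋀^ι]→ₗ[ℝ] F

/-- The differential form `α` is smooth on `W`: evaluating it on smooth vector fields gives smooth
functions. -/
def SmoothFormOn {ι F : Type*} [NormedAddCommGroup F] [NormedSpace ℝ F]
    (α : ∀ x : M, FormAt (E := E) ι F x) (W : Set M) : Prop :=
  ∀ W' : Set M, IsOpen W' → W' ⊆ W →
    ∀ Y : ι → ∀ x : M, TangentSpace 𝓘(ℝ, E) x, (∀ i, SmoothFieldOn (Y i) W') →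
      ContMDiffOn 𝓘(ℝ, E) 𝓘(ℝ, F) ∞ (fun x => α x (fun i => Y i x)) W'

/-- The Lie derivative of the form `α` along `X`, evaluated on the vector fields `Y`:
`(ℒ_X α)(Y_1, …, Y_r) = X (α(Y_1, …, Y_r)) - ∑ i, α(Y_1, …, [X, Y_i], …, Y_r)`. -/
def lieDerivForm {ι : Type*} [Fintype ι] [DecidableEq ι]
    (X : ∀ x : M, TangentSpace 𝓘(ℝ, E) x) (α : ∀ x : M, FormAt (E := E) ι ℂ x)
    (Y : ι → ∀ x : M, TangentSpace 𝓘(ℝ, E) x) (x : M) : ℂ :=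
  mvfderiv 𝓘(ℝ, E) (fun y => α y (fun i => Y i y)) x (X x)
    - ∑ i, α x (Function.update (fun j => Y j x) i
        (VectorField.mlieBracket 𝓘(ℝ, E) X (Y i) x))

/-- The iterated derivative `Z_1 (Z_2 (⋯ (Z_r f)))` of `f` along a list of vector fields. -/
def iterDeriv (Z : List (∀ x : M, TangentSpace 𝓘(ℝ, E) x)) (f : M → ℂ) : M → ℂ :=
  Z.foldr (fun V g x => mvfderiv 𝓘(ℝ, E) g x (V x)) f

/-! ### Symplectic forms -/

/-- `ω` is a symplectic form: a smooth nondegenerate closed 2-form. -/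
structure IsSymplecticForm (omega : ∀ x : M, FormAt (E := E) (Fin 2) ℝ x) : Prop where
  smooth : SmoothFormOn omega univ
  nondegenerate : ∀ x (u : TangentSpace 𝓘(ℝ, E) x),
    (∀ v : TangentSpace 𝓘(ℝ, E) x, omega x ![u, v] = 0) → u = 0
  closed : ∀ W : Set M, IsOpen W → ∀ X Y Z : ∀ x : M, TangentSpace 𝓘(ℝ, E) x,
    SmoothFieldOn X W → SmoothFieldOn Y W → SmoothFieldOn Z W → ∀ x ∈ W,
      mvfderiv 𝓘(ℝ, E) (fun y => omega y ![Y y, Z y]) x (X x)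
      - mvfderiv 𝓘(ℝ, E) (fun y => omega y ![X y, Z y]) x (Y x)
      + mvfderiv 𝓘(ℝ, E) (fun y => omega y ![X y, Y y]) x (Z x)
      - omega x ![VectorField.mlieBracket 𝓘(ℝ, E) X Y x, Z x]
      + omega x ![VectorField.mlieBracket 𝓘(ℝ, E) X Z x, Y x]
      - omega x ![VectorField.mlieBracket 𝓘(ℝ, E) Y Z x, X x] = 0

/-! ### Hamiltonian torus actions

The torus is `T = U(1)^k`, its Lie algebra is `𝔱 = ℝ^k`, and `𝔱^*` is identified with `ℝ^k` by the
standard pairing. -/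

/-- The exponential map `𝔱 = ℝ^k → T = U(1)^k`. Its kernel is the lattice `(2πℤ)^k`. -/
def expT {k : ℕ} (η : Fin k → ℝ) : Fin k → Circle := fun i => Circle.exp (η i)

/-- The orbit curve `t ↦ exp(tη) • p`. -/
def orbitCurve {k : ℕ} [MulAction (Fin k → Circle) M] (η : Fin k → ℝ) (p : M) : ℝ → M :=
  fun t => expT (t • η) • p

/-- The fundamental vector field of `η ∈ 𝔱`. -/
def fundField {k : ℕ} [MulAction (Fin k → Circle) M] (η : Fin k → ℝ) :
    ∀ x : M, TangentSpace 𝓘(ℝ, E) x :=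
  fun x => (mfderiv 𝓘(ℝ, ℝ) 𝓘(ℝ, E) (orbitCurve η x) 0 (1 : ℝ) : E)

/-- `μ : M → 𝔱^*` is a moment map for the smooth symplectic action of `T` on `(M, ω)`. -/
structure IsHamiltonianTorusAction {k : ℕ} [MulAction (Fin k → Circle) M]
    (omega : ∀ x : M, FormAt (E := E) (Fin 2) ℝ x) (μ : M → Fin k → ℝ) : Prop where
  smooth_action : ContMDiff (𝓘(ℝ, Fin k → ℝ).prod 𝓘(ℝ, E)) 𝓘(ℝ, E) ∞
    (fun q : (Fin k → ℝ) × M => expT q.1 • q.2)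
  symplectic : ∀ (g : Fin k → Circle) (x : M) (u v : TangentSpace 𝓘(ℝ, E) x),
    omega (g • x) ![mfderiv 𝓘(ℝ, E) 𝓘(ℝ, E) (fun y : M => g • y) x u,
      mfderiv 𝓘(ℝ, E) 𝓘(ℝ, E) (fun y : M => g • y) x v] = omega x ![u, v]
  smooth_moment : ContMDiff 𝓘(ℝ, E) 𝓘(ℝ, Fin k → ℝ) ∞ μ
  invariant : ∀ (g : Fin k → Circle) (x : M), μ (g • x) = μ x
  moment : ∀ (η : Fin k → ℝ) (x : M) (v : TangentSpace 𝓘(ℝ, E) x),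
    omega x ![fundField η x, v] = mvfderiv 𝓘(ℝ, E) (fun y => ∑ i, μ y i * η i) x v

/-! ### Polarizations -/

/-- The complexified tangent space `T_x M ⊗ ℂ`. -/
abbrev CTangent (x : M) : Type _ := ℂ ⊗[ℝ] TangentSpace 𝓘(ℝ, E) x

/-- The complex tangent vector `u + i v`. -/
def cvec {x : M} (u v : TangentSpace 𝓘(ℝ, E) x) : CTangent (E := E) x :=
  (1 : ℂ) ⊗ₜ[ℝ] u + Complex.I ⊗ₜ[ℝ] v

/-- Complex conjugation on `T_x M ⊗ ℂ`. -/
def conjMap (x : M) : CTangent (E := E) x →ₗ[ℝ] CTangent (E := E) x :=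
  LinearMap.rTensor _ Complex.conjAe.toLinearMap

theorem conjMap_smul (x : M) (c : ℂ) (z : CTangent (E := E) x) :
    conjMap x (c • z) = (starRingEnd ℂ c) • conjMap x z := by
  induction z using TensorProduct.induction_on with
  | zero => simp
  | tmul a v => simp [conjMap, TensorProduct.smul_tmul']
  | add a b ha hb => rw [smul_add, map_add, map_add, ha, hb, smul_add]

/-- The complex conjugate of a complex subspace of `T_x M ⊗ ℂ`. -/
def conjSpace {x : M} (S : Submodule ℂ (CTangent (E := E) x)) :
    Submodule ℂ (CTangent (E := E) x) where
  carrier := {z | conjMap x z ∈ S}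
  add_mem' := by
    intro a b ha hb
    simpa using S.add_mem ha hb
  zero_mem' := by simp
  smul_mem' := by
    intro c z hz
    simpa [conjMap_smul] using S.smul_mem _ hz

/-- A polarization of the `2n`-dimensional symplectic manifold `(M, ω)`: a smooth, Lagrangian,
involutive complex distribution `P ⊆ TM ⊗ ℂ`. -/
structure Polarization (omega : ∀ x : M, FormAt (E := E) (Fin 2) ℝ x) (n : ℕ) where
  /-- the fibre of the distribution at a point -/
  space : ∀ x : M, Submodule ℂ (CTangent (E := E) x)
  finrank_space : ∀ x, Module.finrank ℂ (space x) = n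
  /-- `ω`, extended complex bilinearly, vanishes on `P`. -/
  isotropic : ∀ x (u v u' v' : TangentSpace 𝓘(ℝ, E) x),
    cvec u v ∈ space x → cvec u' v' ∈ space x →
      omega x ![u, u'] - omega x ![v, v'] = 0 ∧ omega x ![u, v'] + omega x ![v, u'] = 0
  /-- Locally `P` is spanned by smooth complex vector fields `X_j + i Y_j`. -/
  smooth : ∀ x₀ : M, ∃ W : Set M, IsOpen W ∧ x₀ ∈ W ∧
    ∃ X Y : Fin n → ∀ x : M, TangentSpace 𝓘(ℝ, E) x,
      (∀ j, SmoothFieldOn (X j) W ∧ SmoothFieldOn (Y j) W) ∧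
      ∀ x ∈ W, space x = Submodule.span ℂ (range fun j => cvec (X j x) (Y j x))
  /-- `[X + i Y, X' + i Y']` is a section of `P` whenever `X + i Y` and `X' + i Y'` are. -/
  involutive : ∀ W : Set M, IsOpen W → ∀ X Y X' Y' : ∀ x : M, TangentSpace 𝓘(ℝ, E) x,
    SmoothFieldOn X W → SmoothFieldOn Y W → SmoothFieldOn X' W → SmoothFieldOn Y' W →
    (∀ x ∈ W, cvec (X x) (Y x) ∈ space x) → (∀ x ∈ W, cvec (X' x) (Y' x) ∈ space x) →
    ∀ x ∈ W,
      cvec (VectorField.mlieBracket 𝓘(ℝ, E) X X' x - VectorField.mlieBracket 𝓘(ℝ, E) Y Y' x)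
        (VectorField.mlieBracket 𝓘(ℝ, E) X Y' x + VectorField.mlieBracket 𝓘(ℝ, E) Y X' x)
        ∈ space x

/-- The fibre `𝒦_{P,x}` of the canonical bundle of a polarization: the complex forms of degree
`card ι = n` that are annihilated by contraction with `conj P`. -/
def canonicalSpace {omega : ∀ x : M, FormAt (E := E) (Fin 2) ℝ x} {n : ℕ} (P : Polarization omega n)
    (ι : Type*) [DecidableEq ι] (x : M) : Submodule ℂ (FormAt (E := E) ι ℂ x) where
  carrier := {α | ∀ u v : TangentSpace 𝓘(ℝ, E) x, cvec u v ∈ conjSpace (P.space x) →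
    ∀ (w : ι → TangentSpace 𝓘(ℝ, E) x) (i : ι),
      α (Function.update w i u) + Complex.I * α (Function.update w i v) = 0}
  add_mem' := by
    intro a b ha hb u v huv w i
    have h1 := ha u v huv w i
    have h2 := hb u v huv w i
    simp only [AlternatingMap.add_apply]
    linear_combination h1 + h2
  zero_mem' := by
    intro u v _ w i
    simp
  smul_mem' := by
    intro c a ha u v huv w i
    have h1 := ha u v huv w i
    simp only [AlternatingMap.smul_apply, smul_eq_mul]
    linear_combination c * h1

/-! ### Fibering polarizations -/

/-- `P` is a fibering polarization with respect to the commutative diagram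
`B ←[π] M →[μ] 𝔱^*`, `φ ∘ π = μ`, generated by the Hamiltonian action of `T` with moment map `μ`:
`π` is the quotient by `T` and a submersion onto the manifold `B = M/T`, `μ` is a submersion (onto
its open image) with connected fibres, and
`P ∩ conj P ∩ TM = ker dπ`, `(P + conj P) ∩ TM = ker dμ`. -/
structure IsFibering {k n : ℕ} [MulAction (Fin k → Circle) M]
    {omega : ∀ x : M, FormAt (E := E) (Fin 2) ℝ x} (P : Polarization omega n) (μ : M → Fin k → ℝ)
    {EB : Type*} [NormedAddCommGroup EB] [NormedSpace ℝ EB]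
    {B : Type*} [TopologicalSpace B] [ChartedSpace EB B] [IsManifold 𝓘(ℝ, EB) 1 B]
    (pr : M → B) (φ : B → Fin k → ℝ) : Prop where
  submersion_quotient : IsSubmersion 𝓘(ℝ, E) 𝓘(ℝ, EB) ∞ pr
  surjective_quotient : Function.Surjective pr
  quotient_eq_iff : ∀ x y, pr x = pr y ↔ ∃ g : Fin k → Circle, g • x = y
  smooth_base : ContMDiff 𝓘(ℝ, EB) 𝓘(ℝ, Fin k → ℝ) ∞ φ
  commutes : ∀ x, φ (pr x) = μ x
  submersion_moment : IsSubmersion 𝓘(ℝ, E) 𝓘(ℝ, Fin k → ℝ) ∞ μ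
  connected_fibers : ∀ ξ, IsPreconnected (μ ⁻¹' {ξ})
  real_part : ∀ x (v : TangentSpace 𝓘(ℝ, E) x),
    cvec v 0 ∈ P.space x ⊓ conjSpace (P.space x) ↔ mfderiv 𝓘(ℝ, E) 𝓘(ℝ, EB) pr x v = 0
  coisotropic_part : ∀ x (v : TangentSpace 𝓘(ℝ, E) x),
    cvec v 0 ∈ P.space x ⊔ conjSpace (P.space x) ↔
      mfderiv 𝓘(ℝ, E) 𝓘(ℝ, Fin k → ℝ) μ x v = 0

/-! ### Polarized sections of the canonical bundle and half-forms -/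

section PolarizedForms

variable {EB : Type*} [NormedAddCommGroup EB] [NormedSpace ℝ EB]
  {B : Type*} [TopologicalSpace B] [ChartedSpace EB B] [IsManifold 𝓘(ℝ, EB) 1 B]

/-- The wedge product `π^* Ωφ ∧ μ^* ΩE` at `x`, for a complex `m`-form `Ωφ` on `B` and a real
`k`-form `ΩE` on `𝔱^*`. -/
def wedgePullback {m k : ℕ} (pr : M → B) (μ : M → Fin k → ℝ) (x : M)
    (Ωφ : FormAt (E := EB) (Fin m) ℂ (pr x))
    (ΩE : FormAt (E := Fin k → ℝ) (Fin k) ℝ (μ x)) :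
    FormAt (E := E) (Fin m ⊕ Fin k) ℂ x :=
  (TensorProduct.rid ℝ ℂ).toLinearMap.compAlternatingMap
    ((Ωφ.compLinearMap (mfderiv 𝓘(ℝ, E) 𝓘(ℝ, EB) pr x).toLinearMap).domCoprod
      (ΩE.compLinearMap (mfderiv 𝓘(ℝ, E) 𝓘(ℝ, Fin k → ℝ) μ x).toLinearMap))

variable {k n : ℕ} {omega : ∀ x : M, FormAt (E := E) (Fin 2) ℝ x}

/-- `Ωφ`, restricted to the fibres of `φ`, is over `π(W)` a smooth section of the relative canonical
bundle `𝒦_φ`. The forms on the fibres of `φ` are represented by forms on `B`, and only their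
values on `ker dφ` matter; the `(0,1)`-vectors on the fibres of `φ` are the images of the vectors
in `conj P`. -/
def IsRelativeCanonical {m : ℕ} (P : Polarization omega n) (pr : M → B) (φ : B → Fin k → ℝ)
    (Ωφ : ∀ b : B, FormAt (E := EB) (Fin m) ℂ b) (W : Set M) : Prop :=
  SmoothFormOn Ωφ (pr '' W) ∧
  ∀ x ∈ W, ∀ u v : TangentSpace 𝓘(ℝ, E) x, cvec u v ∈ conjSpace (P.space x) →
    ∀ w : Fin m → TangentSpace 𝓘(ℝ, EB) (pr x),
      (∀ i, mfderiv 𝓘(ℝ, EB) 𝓘(ℝ, Fin k → ℝ) φ (pr x) (w i) = 0) → ∀ i,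
        Ωφ (pr x) (Function.update w i (mfderiv 𝓘(ℝ, E) 𝓘(ℝ, EB) pr x u))
        + Complex.I * Ωφ (pr x) (Function.update w i (mfderiv 𝓘(ℝ, E) 𝓘(ℝ, EB) pr x v)) = 0

/-- The section `Ωφ` of the relative canonical bundle is holomorphic along the fibres of `φ`:
its Lie derivatives along vertical vector fields `A + i C` of type `(0,1)` vanish (on forms of
top holomorphic degree this is the operator `∂̄`). -/
def IsFiberwiseHolomorphic {m : ℕ} (P : Polarization omega n) (pr : M → B) (φ : B → Fin k → ℝ)
    (Ωφ : ∀ b : B, FormAt (E := EB) (Fin m) ℂ b) (W : Set M) : Prop :=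
  ∀ O : Set B, IsOpen O → O ⊆ pr '' W → ∀ A C : ∀ b : B, TangentSpace 𝓘(ℝ, EB) b,
    SmoothFieldOn A O → SmoothFieldOn C O →
    (∀ x, pr x ∈ O → ∃ u v : TangentSpace 𝓘(ℝ, E) x, cvec u v ∈ conjSpace (P.space x) ∧
      mfderiv 𝓘(ℝ, E) 𝓘(ℝ, EB) pr x u = A (pr x) ∧ mfderiv 𝓘(ℝ, E) 𝓘(ℝ, EB) pr x v = C (pr x)) →
    ∀ Y : Fin m → ∀ b : B, TangentSpace 𝓘(ℝ, EB) b, (∀ i, SmoothFieldOn (Y i) O) →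
      (∀ i, ∀ b ∈ O, mfderiv 𝓘(ℝ, EB) 𝓘(ℝ, Fin k → ℝ) φ b (Y i b) = 0) →
      ∀ b ∈ O, lieDerivForm A Ωφ Y b + Complex.I * lieDerivForm C Ωφ Y b = 0

/-- `Ω` is a polarized section over `W` of the canonical bundle of `P`: locally it is of the form
`π^* Ωφ ⊗ μ^* ΩE` for a smooth fibrewise holomorphic section `Ωφ` of `𝒦_φ` and a real top-degree
form `ΩE` on the base of `μ`. -/
def IsPolarizedForm {m : ℕ} (P : Polarization omega n) (μ : M → Fin k → ℝ)
    (pr : M → B) (φ : B → Fin k → ℝ)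
    (Ω : ∀ x : M, FormAt (E := E) (Fin m ⊕ Fin k) ℂ x) (W : Set M) : Prop :=
  ∀ x₀ ∈ W, ∃ W' : Set M, IsOpen W' ∧ x₀ ∈ W' ∧ W' ⊆ W ∧
    ∃ (Ωφ : ∀ b : B, FormAt (E := EB) (Fin m) ℂ b)
      (ΩE : ∀ ξ : Fin k → ℝ, FormAt (E := Fin k → ℝ) (Fin k) ℝ ξ),
      IsRelativeCanonical P pr φ Ωφ W' ∧ IsFiberwiseHolomorphic P pr φ Ωφ W' ∧
      SmoothFormOn ΩE (μ '' W') ∧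
      ∀ x ∈ W', Ω x = wedgePullback pr μ x (Ωφ (pr x)) (ΩE (μ x))

end PolarizedForms

section HalfForms

variable {omega : ∀ x : M, FormAt (E := E) (Fin 2) ℝ x} {n : ℕ}
  (κ : M → Type*) [TopologicalSpace (TotalSpace ℂ κ)]
  [∀ x, AddCommGroup (κ x)] [∀ x, Module ℂ (κ x)] [∀ x, TopologicalSpace (κ x)]
  [FiberBundle ℂ κ]

/-- A half-form structure on the complex line bundle `κ`: a smooth isomorphism
`κ ⊗ κ ≅ 𝒦_P`. -/
structure HalfForm (P : Polarization omega n) (ι : Type*) [DecidableEq ι] where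
  /-- the isomorphism `κ_x ⊗ κ_x ≅ 𝒦_{P,x}` -/
  iso : ∀ x, κ x ⊗[ℂ] κ x ≃ₗ[ℂ] canonicalSpace P ι x
  smooth : ∀ W : Set M, IsOpen W → ∀ τ : ∀ x, κ x, SmoothSectionOn (E := E) τ W →
    SmoothFormOn (fun x => (iso x (τ x ⊗ₜ τ x) : FormAt (E := E) ι ℂ x)) W

variable {κ}

/-- The square `a ⊗ a ∈ 𝒦_P` of a half-form, as a differential form. -/
def HalfForm.sq {P : Polarization omega n} {ι : Type*} [DecidableEq ι] (h : HalfForm κ P ι) {x : M}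
    (a : κ x) : FormAt (E := E) ι ℂ x := h.iso x (a ⊗ₜ a)

/-- A smooth section of `κ` is polarized when its square is a polarized section of `𝒦_P`. -/
def IsPolarizedHalfForm {EB : Type*} [NormedAddCommGroup EB] [NormedSpace ℝ EB]
    {B : Type*} [TopologicalSpace B] [ChartedSpace EB B] [IsManifold 𝓘(ℝ, EB) 1 B] {m k : ℕ}
    {P : Polarization omega n} (h : HalfForm κ P (Fin m ⊕ Fin k)) (μ : M → Fin k → ℝ)
    (pr : M → B) (φ : B → Fin k → ℝ) (τ : ∀ x, κ x) (W : Set M) : Prop :=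
  SmoothSectionOn (E := E) τ W ∧ IsPolarizedForm (EB := EB) P μ pr φ (fun x => h.sq (τ x)) W

end HalfForms

/-! ### Prequantum line bundles -/

section Prequantum

variable {L : M → Type*} [TopologicalSpace (TotalSpace ℂ L)]
  [∀ x, AddCommGroup (L x)] [∀ x, Module ℂ (L x)] [∀ x, TopologicalSpace (L x)]
  [∀ x, IsTopologicalAddGroup (L x)] [∀ x, ContinuousSMul ℝ (L x)]
  [FiberBundle ℂ L] [VectorBundle ℝ ℂ L]

/-- `∇` is a prequantum connection on the complex line bundle `L`: a smooth complex linear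
connection with curvature `-i ω`. -/
structure IsPrequantum (omega : ∀ x : M, FormAt (E := E) (Fin 2) ℝ x)
    (nabla : CovariantDerivative 𝓘(ℝ, E) ℂ L) : Prop where
  smooth : CovariantDerivative.ContMDiffCovariantDerivative nabla ∞
  complex_linear : ∀ W : Set M, IsOpen W → ∀ σ : ∀ x, L x, SmoothSectionOn (E := E) σ W →
    ∀ c : ℂ, ∀ x ∈ W, ∀ v : TangentSpace 𝓘(ℝ, E) x,
      nabla (fun y => c • σ y) x v = c • nabla σ x v
  curvature : ∀ W : Set M, IsOpen W → ∀ σ : ∀ x, L x, SmoothSectionOn (E := E) σ W →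
    ∀ X Y : ∀ x : M, TangentSpace 𝓘(ℝ, E) x, SmoothFieldOn X W → SmoothFieldOn Y W →
    ∀ x ∈ W,
      nabla (fun y => nabla σ y (Y y)) x (X x) - nabla (fun y => nabla σ y (X y)) x (Y x)
        - nabla σ x (VectorField.mlieBracket 𝓘(ℝ, E) X Y x)
      = (-(Complex.I * (omega x ![X x, Y x] : ℂ))) • σ x

end Prequantum

/-! ### The Bohr–Sommerfeld condition -/

section BohrSommerfeld

variable {k : ℕ} [MulAction (Fin k → Circle) M]

/-- `l` is a lift to `L` of the orbit curve `t ↦ exp(tη) • p` that is parallel for `∇`, that is, the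
orbit of `l 0` under the canonical lift of the `𝔱`-action to `L`. In terms of a local section `e`
with `l t = f t • e`, the condition reads `f' • e + f • ∇_{γ'} e = 0`. -/
def IsParallelLift {L : M → Type*} [TopologicalSpace (TotalSpace ℂ L)]
    [∀ x, AddCommGroup (L x)] [∀ x, Module ℂ (L x)] [∀ x, TopologicalSpace (L x)]
    [∀ x, IsTopologicalAddGroup (L x)] [∀ x, ContinuousSMul ℝ (L x)]
    [FiberBundle ℂ L] [VectorBundle ℝ ℂ L]
    (nabla : CovariantDerivative 𝓘(ℝ, E) ℂ L) (η : Fin k → ℝ) (p : M)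
    (l : ∀ t : ℝ, L (orbitCurve η p t)) : Prop :=
  ∀ W : Set M, IsOpen W → ∀ e : ∀ x, L x, SmoothSectionOn (E := E) e W → (∀ x ∈ W, e x ≠ 0) →
    ∀ (t₀ : ℝ) (f : ℝ → ℂ), orbitCurve η p t₀ ∈ W →
      (∀ᶠ t in 𝓝 t₀, l t = f t • e (orbitCurve η p t)) →
      ∃ f' : ℂ, HasDerivAt f f' t₀ ∧
        f' • e (orbitCurve η p t₀)
          + f t₀ • nabla e (orbitCurve η p t₀) (fundField η (orbitCurve η p t₀)) = 0

/-- `c` is a lift to `κ` of the orbit curve `t ↦ exp(tη) • p` that follows the canonical lift of the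
`𝔱`-action: `c` is continuous and the square `c t ⊗ c t` in `𝒦_P ⊆ ⋀^n T^*_ℂ M` is obtained from
`c 0 ⊗ c 0` by the natural action of `exp(tη)` on differential forms, i.e. the pullback of
`c t ⊗ c t` under `exp(tη)` is `c 0 ⊗ c 0`. -/
def IsHalfFormLift {omega : ∀ x : M, FormAt (E := E) (Fin 2) ℝ x} {n : ℕ}
    {κ : M → Type*} [TopologicalSpace (TotalSpace ℂ κ)]
    [∀ x, AddCommGroup (κ x)] [∀ x, Module ℂ (κ x)] [∀ x, TopologicalSpace (κ x)]
    [FiberBundle ℂ κ] {P : Polarization omega n} {ι : Type*} [DecidableEq ι]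
    (h : HalfForm κ P ι) (η : Fin k → ℝ) (p : M)
    (c : ∀ t : ℝ, κ (orbitCurve η p t)) : Prop :=
  Continuous (fun t => TotalSpace.mk' ℂ (orbitCurve η p t) (c t)) ∧
  ∀ (t : ℝ) (w : ι → TangentSpace 𝓘(ℝ, E) (orbitCurve η p 0)),
    h.sq (c t) (fun i => mfderiv 𝓘(ℝ, E) 𝓘(ℝ, E) (fun y : M => expT (t • η) • y)
      (orbitCurve η p 0) (w i)) = h.sq (c 0) w

/-- `ξ` is a Bohr–Sommerfeld point: it is a value of the moment map, and the canonical action of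
`𝔱` on `L ⊗ κ` over the leaf `μ⁻¹(ξ)`, which `η ∈ 𝔱` integrates to
`l 0 ⊗ c 0 ↦ l 1 ⊗ c 1` over `p ↦ exp(η) • p`, descends to `T = 𝔱 / ker exp`, i.e. the elements of
`ker exp` act trivially. -/
def IsBohrSommerfeld {omega : ∀ x : M, FormAt (E := E) (Fin 2) ℝ x} {n : ℕ}
    {L : M → Type*} [TopologicalSpace (TotalSpace ℂ L)]
    [∀ x, AddCommGroup (L x)] [∀ x, Module ℂ (L x)] [∀ x, TopologicalSpace (L x)]
    [∀ x, IsTopologicalAddGroup (L x)] [∀ x, ContinuousSMul ℝ (L x)]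
    [FiberBundle ℂ L] [VectorBundle ℝ ℂ L]
    {κ : M → Type*} [TopologicalSpace (TotalSpace ℂ κ)]
    [∀ x, AddCommGroup (κ x)] [∀ x, Module ℂ (κ x)] [∀ x, TopologicalSpace (κ x)]
    [FiberBundle ℂ κ] {P : Polarization omega n} {ι : Type*} [DecidableEq ι]
    (μ : M → Fin k → ℝ) (nabla : CovariantDerivative 𝓘(ℝ, E) ℂ L) (h : HalfForm κ P ι)
    (ξ : Fin k → ℝ) : Prop :=
  ξ ∈ range μ ∧
  ∀ p : M, μ p = ξ → ∀ η : Fin k → ℝ, expT η = 1 →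
    ∀ (l : ∀ t : ℝ, L (orbitCurve η p t)) (c : ∀ t : ℝ, κ (orbitCurve η p t)),
      IsParallelLift nabla η p l → IsHalfFormLift h η p c →
      (⟨orbitCurve η p 1, l 1 ⊗ₜ c 1⟩ : Σ y : M, L y ⊗[ℂ] κ y)
        = ⟨orbitCurve η p 0, l 0 ⊗ₜ c 0⟩

end BohrSommerfeld

/-! ### Distributional sections

A distributional section over `V` of a complex vector bundle `F` on the `N`-dimensional manifold
`M`, oriented by its symplectic form, is a continuous linear functional on the compactly supported
smooth sections of `F^* ⊗ ⋀^N T^*_ℂ M` over `V`. A smooth section `s` acts by `Φ ↦ ∫ Φ(s)`.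
The smooth structure of `F` enters through its smooth local sections, `S e W` meaning that `e` is
one on the open set `W`. -/

section Distributions

variable {F : M → Type*} [∀ x, AddCommGroup (F x)] [∀ x, Module ℂ (F x)]

/-- The test sections on `V`: smooth sections of `F^* ⊗ ⋀^N T^*_ℂ M` with compact support in `V`. -/
def testSpace (S : (∀ x, F x) → Set M → Prop) (N : ℕ) (V : Set M) :
    Submodule ℂ (∀ x, F x →ₗ[ℂ] FormAt (E := E) (Fin N) ℂ x) where
  carrier := {Φ | (∀ W : Set M, IsOpen W → ∀ e, S e W → SmoothFormOn (fun x => Φ x (e x)) W) ∧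
    ∃ K : Set M, IsCompact K ∧ K ⊆ V ∧ ∀ x ∉ K, Φ x = 0}
  add_mem' := by
    rintro a b ⟨ha, K, hK, hKV, hK0⟩ ⟨hb, K', hK', hKV', hK0'⟩
    refine ⟨fun W hW e he W' hW' hWW Y hY => ?_, K ∪ K', hK.union hK', union_subset hKV hKV', ?_⟩
    · exact (ha W hW e he W' hW' hWW Y hY).add (hb W hW e he W' hW' hWW Y hY)
    · intro x hx
      rw [mem_union, not_or] at hx
      simp [hK0 x hx.1, hK0' x hx.2]
  zero_mem' := by
    refine ⟨fun W hW e he W' hW' hWW Y hY => ?_, ∅, isCompact_empty, empty_subset _, ?_⟩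
    · exact contMDiffOn_const
    · intro x _
      rfl
  smul_mem' := by
    rintro c a ⟨ha, K, hK, hKV, hK0⟩
    refine ⟨fun W hW e he W' hW' hWW Y hY => ?_, K, hK, hKV, ?_⟩
    · exact ((c • ContinuousLinearMap.id ℝ ℂ).contMDiff).comp_contMDiffOn
        (ha W hW e he W' hW' hWW Y hY)
    · intro x hx
      simp [hK0 x hx]

/-- Distributional sections of `F` on `V`: linear functionals on test sections that are
continuous, i.e. tend to zero along every sequence of test sections with supports in a common
compact subset of `V` all of whose derivatives tend to zero uniformly on compact sets. -/
structure DistSection (S : (∀ x, F x) → Set M → Prop) (N : ℕ) (V : Set M) where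
  /-- the pairing with test sections -/
  toFun : testSpace (E := E) S N V →ₗ[ℂ] ℂ
  continuous : ∀ Φ : ℕ → testSpace (E := E) S N V,
    (∃ K : Set M, IsCompact K ∧ K ⊆ V ∧ ∀ j, ∀ x ∉ K, (Φ j).1 x = 0) →
    (∀ W : Set M, IsOpen W → ∀ e, S e W →
      ∀ Y : Fin N → ∀ x : M, TangentSpace 𝓘(ℝ, E) x, (∀ i, SmoothFieldOn (Y i) W) →
      ∀ Z : List (∀ x : M, TangentSpace 𝓘(ℝ, E) x), (∀ X ∈ Z, SmoothFieldOn X W) →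
      ∀ K : Set M, IsCompact K → K ⊆ W →
        TendstoUniformlyOn
          (fun j => iterDeriv Z (fun x => (Φ j).1 x (e x) (fun i => Y i x))) 0 atTop K) →
    Tendsto (fun j => toFun (Φ j)) atTop (𝓝 0)

theorem testSpace_mono (S : (∀ x, F x) → Set M → Prop) (N : ℕ) {V V' : Set M} (hV : V ⊆ V') :
    testSpace (E := E) S N V ≤ testSpace (E := E) S N V' := by
  rintro Φ ⟨h, K, hK, hKV, hK0⟩
  exact ⟨h, K, hK, hKV.trans hV, hK0⟩

/-- Extension by zero of test sections; pairing after it is the restriction of distributional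
sections to a smaller open set. -/
def extendTest (S : (∀ x, F x) → Set M → Prop) (N : ℕ) {V V' : Set M} (hV : V ⊆ V') :
    testSpace (E := E) S N V →ₗ[ℂ] testSpace (E := E) S N V' :=
  Submodule.inclusion (testSpace_mono S N hV)

end Distributions

section PolarizedDistributions

variable {L : M → Type*} [TopologicalSpace (TotalSpace ℂ L)]
  [∀ x, AddCommGroup (L x)] [∀ x, Module ℂ (L x)] [∀ x, TopologicalSpace (L x)]
  [FiberBundle ℂ L]
  {κ : M → Type*} [TopologicalSpace (TotalSpace ℂ κ)]
  [∀ x, AddCommGroup (κ x)] [∀ x, Module ℂ (κ x)] [∀ x, TopologicalSpace (κ x)]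
  [FiberBundle ℂ κ]

variable (E L) in
/-- Distributional sections of the line bundle `L` on `V`. -/
abbrev LineDist (N : ℕ) (V : Set M) : Type _ :=
  DistSection (E := E) (F := L) (fun l W => SmoothSectionOn (E := E) l W) N V

/-- The smooth local sections `l ⊗ c` that define the smooth structure of `L ⊗ κ`. -/
def SmoothProductOn (E : Type*) [NormedAddCommGroup E] [NormedSpace ℝ E] [ChartedSpace E M]
    (e : ∀ x, L x ⊗[ℂ] κ x) (W : Set M) : Prop :=
  ∃ (l : ∀ x, L x) (c : ∀ x, κ x), SmoothSectionOn (E := E) l W ∧ SmoothSectionOn (E := E) c W ∧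
    ∀ x, e x = l x ⊗ₜ c x

variable (E L κ) in
/-- Test sections for `L ⊗ κ` on `V`. -/
abbrev ProdTest (N : ℕ) (V : Set M) :
    Submodule ℂ (∀ x, L x ⊗[ℂ] κ x →ₗ[ℂ] FormAt (E := E) (Fin N) ℂ x) :=
  testSpace (E := E) (F := fun x => L x ⊗[ℂ] κ x) (SmoothProductOn E) N V

variable (E L κ) in
/-- Distributional sections of `L ⊗ κ` on `V`. -/
abbrev ProdDist (N : ℕ) (V : Set M) : Type _ :=
  DistSection (E := E) (F := fun x => L x ⊗[ℂ] κ x) (SmoothProductOn E) N V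

/-- Contraction of a test section `Φ` for `L ⊗ κ` on `W` with a smooth section `τ` of `κ` on `W`:
the test section `l ↦ Φ(l ⊗ τ)` for `L`. -/
def contract [T2Space M] {N : ℕ} {W : Set M} (hW : IsOpen W) (τ : ∀ x, κ x)
    (hτ : SmoothSectionOn (E := E) τ W) (Φ : ProdTest E L κ N W) :
    testSpace (E := E) (F := L) (fun l W => SmoothSectionOn (E := E) l W) N W :=
  ⟨fun x => (Φ.1 x).comp ((TensorProduct.mk ℂ (L x) (κ x)).flip (τ x)), by
    obtain ⟨Φ, hΦ, K, hK, hKW, hK0⟩ := Φ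
    refine ⟨fun W₁ hW₁ l hl W₂ hW₂ h₂₁ Y hY => ?_, K, hK, hKW, fun x hx => ?_⟩
    · intro x hx
      by_cases hxW : x ∈ W
      · have hprod : SmoothProductOn E (fun x => l x ⊗ₜ[ℂ] τ x) (W₂ ∩ W) :=
          ⟨l, τ, ContMDiffOn.mono hl (inter_subset_left.trans h₂₁),
            ContMDiffOn.mono hτ inter_subset_right, fun _ => rfl⟩
        have := hΦ _ (hW₂.inter hW) _ hprod _ (hW₂.inter hW) subset_rfl Y
          (fun i => ContMDiffOn.mono (hY i) inter_subset_left)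
        exact ((this x ⟨hx, hxW⟩).contMDiffAt ((hW₂.inter hW).mem_nhds ⟨hx, hxW⟩)).contMDiffWithinAt
      · have hxK : x ∈ Kᶜ := fun h => hxW (hKW h)
        refine ContMDiffAt.contMDiffWithinAt ?_
        refine (contMDiffAt_const (c := (0 : ℂ))).congr_of_eventuallyEq ?_
        filter_upwards [hK.isClosed.isOpen_compl.mem_nhds hxK] with y hy
        simp [hK0 y hy]
    · simp [hK0 x hx]⟩

variable [∀ x, IsTopologicalAddGroup (L x)] [∀ x, ContinuousSMul ℝ (L x)] [VectorBundle ℝ ℂ L]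

/-- The covariant Lie derivative along the real vector field `X` of a section `Φ` of
`L^* ⊗ ⋀^N T^*_ℂ M`, evaluated on a section `l` and vector fields `Y`:
`(ℒ_X Φ)(l) = ℒ_X (Φ(l)) - Φ(∇_X l)`. -/
def covLieDeriv {N : ℕ} (nabla : CovariantDerivative 𝓘(ℝ, E) ℂ L)
    (X : ∀ x : M, TangentSpace 𝓘(ℝ, E) x)
    (Φ : ∀ x, L x →ₗ[ℂ] FormAt (E := E) (Fin N) ℂ x) (l : ∀ x, L x)
    (Y : Fin N → ∀ x : M, TangentSpace 𝓘(ℝ, E) x) (x : M) : ℂ :=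
  lieDerivForm X (fun y => Φ y (l y)) Y x - Φ x (nabla l x (X x)) (fun i => Y i x)

/-- The distributional section `s` of `L` on `W` is polarized: `∇_Z s = 0` weakly for all smooth
sections `Z = X + i Y` of `conj P` on `W`. Since `∫ (ℒ_Z Φ)(s) = - ∫ Φ(∇_Z s)` for smooth `s`, this
means that `s` vanishes on every test section `Ψ = ℒ_Z Φ`. -/
def IsPolarizedLineDist {omega : ∀ x : M, FormAt (E := E) (Fin 2) ℝ x} {n N : ℕ}
    (P : Polarization omega n) (nabla : CovariantDerivative 𝓘(ℝ, E) ℂ L) {W : Set M}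
    (s : LineDist E L N W) : Prop :=
  ∀ X Y : ∀ x : M, TangentSpace 𝓘(ℝ, E) x, SmoothFieldOn X W → SmoothFieldOn Y W →
    (∀ x ∈ W, cvec (X x) (Y x) ∈ conjSpace (P.space x)) →
    ∀ Φ Ψ : testSpace (E := E) (F := L) (fun l W => SmoothSectionOn (E := E) l W) N W,
      (∀ W' : Set M, IsOpen W' → W' ⊆ W → ∀ l : ∀ x, L x, SmoothSectionOn (E := E) l W' →
        ∀ V : Fin N → ∀ x : M, TangentSpace 𝓘(ℝ, E) x, (∀ i, SmoothFieldOn (V i) W') →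
        ∀ x ∈ W', Ψ.1 x (l x) (fun i => V i x)
          = covLieDeriv nabla X Φ.1 l V x + Complex.I * covLieDeriv nabla Y Φ.1 l V x) →
      s.toFun Ψ = 0

/-- The distributional section `s` of `L ⊗ κ` on `V` is polarized, `s ∈ ℋ_P^{-∞}(V)`: locally it is
an element of the tensor product of the polarized distributional sections of `L` and the
polarized smooth sections of `κ`. -/
def IsPolarizedDist [T2Space M] {omega : ∀ x : M, FormAt (E := E) (Fin 2) ℝ x} {m k n N : ℕ}
    {EB : Type*} [NormedAddCommGroup EB] [NormedSpace ℝ EB]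
    {B : Type*} [TopologicalSpace B] [ChartedSpace EB B] [IsManifold 𝓘(ℝ, EB) 1 B]
    {P : Polarization omega n} (nabla : CovariantDerivative 𝓘(ℝ, E) ℂ L)
    (h : HalfForm κ P (Fin m ⊕ Fin k)) (μ : M → Fin k → ℝ) (pr : M → B) (φ : B → Fin k → ℝ)
    {V : Set M} (s : ProdDist E L κ N V) : Prop :=
  ∀ x₀ ∈ V, ∃ (W : Set M) (hW : IsOpen W) (hWV : W ⊆ V), x₀ ∈ W ∧
    ∃ (r : ℕ) (σ : Fin r → LineDist E L N W) (τ : Fin r → ∀ x, κ x)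
      (hτ : ∀ j, IsPolarizedHalfForm (EB := EB) h μ pr φ (τ j) W),
      (∀ j, IsPolarizedLineDist P nabla (σ j)) ∧
      ∀ Φ : ProdTest E L κ N W,
        s.toFun (extendTest _ N hWV Φ) = ∑ j, (σ j).toFun (contract hW (τ j) (hτ j).1 Φ)

end PolarizedDistributions

end Basic

end GeomQuant

end

open Bundle Set Filter Topology Manifold ContDiff TensorProduct

noncomputable section

namespace GeomQuant

set_option linter.unusedSectionVars false

/-! ### Parameter integrals and integration along a fixed direction -/

section DirectionalCalculus

variable {E : Type*} [NormedAddCommGroup E] [NormedSpace ℝ E]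

/-! Fix `η` in the kernel of the exponential map, with fundamental field X. The torus orbits are
tangent to ker dπ, so X is a real section of both P and its conjugate (`IsFibering.fundField_mem`).
Hence polarized distributional sections of L are covariantly constant along X. Polarized half-forms
are invariant along the orbits as well, because their squares are built from pullbacks by the
invariant maps π and μ (`wedgePullback_flow`). So a polarized section s of L ⊗ κ is invariant under
the lifted flow of X. At time 1 the flow is the identity of M and its lift is multiplication by a
function H, the holonomy. Invariance then reads (H - 1) s = 0, and s vanishes wherever H ≠ 1
(`exists_vanishing_nhds`).

If the leaf of p is not Bohr–Sommerfeld, some `η` has H ≠ 1 at some point of the leaf, and this must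
be carried to p itself. The factor of H coming from κ is a sign, since its square is 1, and by
continuity it is locally constant. The factor g coming from L satisfies dg = -i g dμ_η, where μ_η is
the component of the moment map, because the curvature is -iω and ω(X, ·) = dμ_η. So H is locally
constant along the fibres of μ, and these are connected.

For distributions the argument is run in adapted boxes: charts with convex image in which the flow
is a translation, with a frame of L parallel along the orbits and a frame of κ whose square is
invariant. There a test section is a single function f, and polarization says that s kills the
functions X f (`IsPolarizedDist.exists_nhds`). A function minus its translate by the flow is X F
with F compactly supported in the box (`FlowBox.exists_primitive_sub`), so s is invariant for short
times. A `Continuation` follows an orbit through a chain of boxes and accumulates the transition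
functions of the frames and volume forms. Closing the loop at time 1 gives H (`exists_holonomy`).

The lifts in the Bohr–Sommerfeld condition are instances of `IsTransport`, whose coefficients in
adapted boxes are locally constant, and H relates the two ends of every transport
(`hasHolonomy_iff`). Local vanishing becomes global vanishing by a partition of unity
(`DistSection.toFun_eq_zero_of_locally`). -/

theorem hasFDerivAt_integral_of_contDiff {G : E × ℝ → ℂ} (hG : ContDiff ℝ 1 G)
    [FiniteDimensional ℝ E] (y : E) :
    HasFDerivAt (fun y => ∫ u in (0 : ℝ)..1, G (y, u))
      (∫ u in (0 : ℝ)..1, (fderiv ℝ G (y, u)).comp (ContinuousLinearMap.inl ℝ E ℝ)) y := by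
  have hd : ∀ y u, HasFDerivAt (fun y => G (y, u))
      ((fderiv ℝ G (y, u)).comp (ContinuousLinearMap.inl ℝ E ℝ)) y := fun y u =>
    (hG.differentiable one_ne_zero (y, u)).hasFDerivAt.comp y (hasFDerivAt_prodMk_left y u)
  have hc : Continuous fun q : E × ℝ =>
      (fderiv ℝ G q).comp (ContinuousLinearMap.inl ℝ E ℝ) :=
    (hG.continuous_fderiv one_ne_zero).clm_comp continuous_const
  obtain ⟨C, hC⟩ := ((isCompact_closedBall y 1).prod (isCompact_Icc (a := (0 : ℝ)) (b := 1)))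
    |>.exists_bound_of_continuousOn hc.continuousOn
  refine (intervalIntegral.hasFDerivAt_integral_of_dominated_of_fderiv_le (𝕜 := ℝ)
    (F' := fun y u => (fderiv ℝ G (y, u)).comp (ContinuousLinearMap.inl ℝ E ℝ))
    (s := Metric.closedBall y 1) (bound := fun _ => C)
    (F := fun y u => G (y, u)) (Metric.closedBall_mem_nhds y one_pos) ?_ ?_ ?_ ?_ ?_ ?_)
  · exact Eventually.of_forall fun x =>
      (hG.continuous.comp (by fun_prop : Continuous fun u : ℝ => (x, u))).aestronglyMeasurable
  · exact (hG.continuous.comp (by fun_prop : Continuous fun u : ℝ => (y, u))).intervalIntegrable _ _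
  · exact (hc.comp (by fun_prop : Continuous fun u : ℝ => (y, u))).aestronglyMeasurable
  · refine Eventually.of_forall fun u hu x hx => hC (x, u) ⟨hx, ?_⟩
    rw [uIoc_of_le zero_le_one] at hu
    exact ⟨hu.1.le, hu.2⟩
  · exact intervalIntegrable_const
  · exact Eventually.of_forall fun u _ x _ => hd x u

/-- Induction on the order of differentiability, with the integrand generalized: each directional
derivative of the integral is again such an integral, with the smooth integrand `fderiv ℝ G q (v,
0)`. -/
theorem contDiff_integral [FiniteDimensional ℝ E] {G : E × ℝ → ℂ} (hG : ContDiff ℝ ∞ G) :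
    ContDiff ℝ ∞ fun y => ∫ u in (0 : ℝ)..1, G (y, u) := by
  rw [contDiff_infty]
  intro n
  induction n generalizing G with
  | zero =>
    refine contDiff_zero.2 (Differentiable.continuous (𝕜 := ℝ) fun y => ?_)
    exact (hasFDerivAt_integral_of_contDiff (hG.of_le (by exact_mod_cast le_top)) y).differentiableAt
  | succ n ih =>
    have h1 : ContDiff ℝ 1 G := hG.of_le (by exact_mod_cast le_top)
    have h := hasFDerivAt_integral_of_contDiff h1
    rw [Nat.cast_succ]
    refine contDiff_succ_iff_fderiv_apply.2 ⟨fun y => (h y).differentiableAt, fun hn => ?_, fun v => ?_⟩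
    · exact absurd hn (by exact_mod_cast WithTop.coe_ne_top)
    have : (fun y => fderiv ℝ (fun y => ∫ u in (0 : ℝ)..1, G (y, u)) y v)
        = fun y => ∫ u in (0 : ℝ)..1, (fun q : E × ℝ => fderiv ℝ G q (v, 0)) (y, u) := by
      funext y
      rw [(h y).fderiv, ContinuousLinearMap.intervalIntegral_apply]
      · rfl
      · refine Continuous.intervalIntegrable ?_ _ _
        exact ((h1.continuous_fderiv one_ne_zero).comp
          (by fun_prop : Continuous fun u : ℝ => (y, u))).clm_comp continuous_const
    rw [this]
    exact ih ((hG.fderiv_right (m := ∞) (by simp)).clm_apply contDiff_const)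

theorem fderiv_apply_of_hasDerivAt {F : Type*} [NormedAddCommGroup F] [NormedSpace ℝ F]
    {f : E → F} {y e : E} {c : F} (hf : DifferentiableAt ℝ f y)
    (h : HasDerivAt (fun s : ℝ => f (y + s • e)) c 0) : fderiv ℝ f y e = c := by
  have h1 : HasDerivAt (fun s : ℝ => y + s • e) e 0 := by
    simpa using ((hasDerivAt_id (0 : ℝ)).smul_const e).const_add y
  have h2 : HasFDerivAt f (fderiv ℝ f y) (y + (0 : ℝ) • e) := by simpa using hf.hasFDerivAt
  exact (h2.comp_hasDerivAt 0 h1).unique h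

theorem hasDerivAt_line {F : Type*} [NormedAddCommGroup F] [NormedSpace ℝ F]
    {f : E → F} {y e : E} {t : ℝ} (hf : DifferentiableAt ℝ f (y + t • e)) :
    HasDerivAt (fun s : ℝ => f (y + s • e)) (fderiv ℝ f (y + t • e) e) t := by
  have h1 : HasDerivAt (fun s : ℝ => y + s • e) e t := by
    simpa using ((hasDerivAt_id t).smul_const e).const_add y
  exact hf.hasFDerivAt.comp_hasDerivAt t h1

/-- The average of `g` over the segment from `y` to `y - δ e`, times `δ`. -/
def segmentIntegral (g : E → ℂ) (δ : ℝ) (e y : E) : ℂ :=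
  δ * ∫ u in (0 : ℝ)..1, g (y - (u * δ) • e)

/-- The substitution r = uδ - s moves the dependence on `s` from the integrand to the endpoints, so
that differentiating along `e` only needs the fundamental theorem of calculus. -/
theorem segmentIntegral_eq (g : E → ℂ) (δ : ℝ) (e y : E) (s : ℝ) :
    segmentIntegral g δ e (y + s • e) = ∫ r in (-s)..(δ - s), g (y - r • e) := by
  have := intervalIntegral.smul_integral_comp_mul_add (a := 0) (b := 1)
    (fun r => g (y - r • e)) δ (-s)
  simp only [mul_zero, zero_add, mul_one] at this
  rw [sub_eq_add_neg, ← this, segmentIntegral, ← Complex.real_smul]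
  congr 1
  refine intervalIntegral.integral_congr fun u _ => ?_
  congr 1
  module

/-- The slope `c` serves two cases: -1 for a window of fixed length that slides, 0 when only the
lower endpoint moves. -/
theorem hasDerivAt_integral_endpoints {φ : ℝ → ℂ} (hφ : Continuous φ) (b c : ℝ) :
    HasDerivAt (fun s : ℝ => ∫ r in (-s)..(b + c * s), φ r) (c * φ b + φ 0) 0 := by
  have hi : ∀ x y : ℝ, IntervalIntegrable φ MeasureTheory.volume x y :=
    fun x y => hφ.intervalIntegrable _ _
  have h1 : ∀ x : ℝ, HasDerivAt (fun u => ∫ r in (0 : ℝ)..u, φ r) (φ x) x := fun x =>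
    intervalIntegral.integral_hasDerivAt_right (hi _ _)
      (hφ.stronglyMeasurableAtFilter _ _) hφ.continuousAt
  have h2 : HasDerivAt (fun s : ℝ => b + c * s) c 0 := by
    simpa using ((hasDerivAt_id (0 : ℝ)).const_mul c).const_add b
  have h3 : HasDerivAt (fun s : ℝ => -s) (-1) 0 := hasDerivAt_neg 0
  have h4 := (h1 (b + c * 0)).scomp (0 : ℝ) h2
  have h5 := (h1 (-0)).scomp (0 : ℝ) h3
  have h6 := h4.sub h5
  have h7 : (fun s : ℝ => ∫ r in (-s)..(b + c * s), φ r) =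
      (((fun u => ∫ r in (0 : ℝ)..u, φ r) ∘ fun s => b + c * s)
        - (fun u => ∫ r in (0 : ℝ)..u, φ r) ∘ Neg.neg) := by
    funext s
    simp only [Pi.sub_apply, Function.comp_apply]
    rw [intervalIntegral.integral_interval_sub_left (hi _ _) (hi _ _)]
  rw [h7]
  exact h6.congr_deriv (by simp)

theorem exists_of_segmentIntegral_ne_zero {g : E → ℂ} {δ : ℝ} {e y : E}
    (h : segmentIntegral g δ e y ≠ 0) : ∃ u ∈ Icc (0 : ℝ) 1, g (y - (u * δ) • e) ≠ 0 := by
  by_contra! hc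
  refine h ?_
  rw [segmentIntegral, intervalIntegral.integral_congr (g := fun _ => (0 : ℂ))]
  · simp
  · intro u hu
    rw [uIcc_of_le zero_le_one] at hu
    exact hc u hu

variable [FiniteDimensional ℝ E]

theorem contDiff_segmentIntegral {g : E → ℂ} (hg : ContDiff ℝ ∞ g) (δ : ℝ) (e : E) :
    ContDiff ℝ ∞ (segmentIntegral g δ e) := by
  refine contDiff_const.mul (contDiff_integral (G := fun q => g (q.1 - (q.2 * δ) • e)) ?_)
  exact hg.comp (by fun_prop)

/-- Sliding the segment gains mass at one end and loses it at the other. This identity is what makes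
a function minus its translate a derivative, with a primitive of controlled support. -/
theorem fderiv_segmentIntegral {g : E → ℂ} (hg : ContDiff ℝ ∞ g) (δ : ℝ) (e y : E) :
    fderiv ℝ (segmentIntegral g δ e) y e = g y - g (y - δ • e) := by
  refine fderiv_apply_of_hasDerivAt
    ((contDiff_segmentIntegral hg δ e).differentiable (by simp) y) ?_
  have := hasDerivAt_integral_endpoints (φ := fun r => g (y - r • e))
    (hg.continuous.comp (by fun_prop)) δ (-1)
  have h1 : (fun s : ℝ => segmentIntegral g δ e (y + s • e))
      = fun s => ∫ r in (-s)..(δ + -1 * s), g (y - r • e) := by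
    funext s
    rw [segmentIntegral_eq, neg_one_mul, sub_eq_add_neg]
  rw [h1]
  refine this.congr_deriv ?_
  simp only [Complex.ofReal_neg, Complex.ofReal_one, zero_smul, sub_zero]
  ring

/-- Smooth functions have smooth primitives in a given nonzero direction. -/
theorem exists_directional_primitive (e : E) {a : E → ℂ} (ha : ContDiff ℝ ∞ a)
    (h : e = 0 → ∀ y, a y = 0) :
    ∃ A : E → ℂ, ContDiff ℝ ∞ A ∧ ∀ y, fderiv ℝ A y e = a y := by
  rcases eq_or_ne e 0 with he | he
  · exact ⟨0, contDiff_const, fun y => by simp [he, h he y]⟩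
  obtain ⟨l₀, -, hl₀⟩ := exists_dual_vector ℝ e (norm_ne_zero_iff.2 he)
  have hne : l₀ e ≠ 0 := by simpa [hl₀] using he
  -- Normalized so that `l` measures time along `e`.
  set l : E →L[ℝ] ℝ := (l₀ e)⁻¹ • l₀ with hl
  have hle : l e = 1 := by simp [hl, hne]
  -- The integral of `a` along the line through `y`, from the hyperplane `l = 0` up to `y`, rescaled
  -- to the interval [0, 1]. Moving `y` along `e` leaves the starting point in the hyperplane fixed.
  have hA : ContDiff ℝ ∞ fun y => (l y : ℂ) * ∫ u in (0 : ℝ)..1, a (y - (u * l y) • e) := by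
    refine ContDiff.mul (Complex.ofRealCLM.contDiff.comp l.contDiff) (contDiff_integral (G := fun q => a (q.1 - (q.2 * l q.1) • e)) ?_)
    exact ha.comp (by fun_prop)
  refine ⟨_, hA, fun y => fderiv_apply_of_hasDerivAt (hA.differentiable (by simp) y) ?_⟩
  have := hasDerivAt_integral_endpoints (φ := fun r => a (y - r • e))
    (ha.continuous.comp (by fun_prop)) (l y) 0
  have h2 : (fun s : ℝ => (l (y + s • e) : ℂ)
      * ∫ u in (0 : ℝ)..1, a (y + s • e - (u * l (y + s • e)) • e))
      = fun s => ∫ r in (-s)..(l y + 0 * s), a (y - r • e) := by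
    funext s
    have h1 := segmentIntegral_eq a (l y + s) e y s
    rw [segmentIntegral] at h1
    rw [map_add, map_smul, hle, smul_eq_mul, mul_one, h1]
    congr 1
    ring
  rw [h2]
  exact this.congr_deriv (by simp)

end DirectionalCalculus

/-! ### The one-parameter flow of an element of the Lie algebra -/

section Flow

variable {k : ℕ} {E : Type*} [NormedAddCommGroup E] [NormedSpace ℝ E]
  {M : Type*} [TopologicalSpace M] [ChartedSpace E M]
  [MulAction (Fin k → Circle) M]

theorem expT_add (a b : Fin k → ℝ) : expT (a + b) = expT a * expT b := by
  funext i
  simp [expT, Circle.exp_add]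

theorem expT_zero : expT (0 : Fin k → ℝ) = 1 := by
  funext i
  simp [expT]

/-- The flow `x ↦ exp(tη) • x`. -/
def flow (η : Fin k → ℝ) (t : ℝ) (x : M) : M := expT (t • η) • x

theorem flow_zero (η : Fin k → ℝ) (x : M) : flow η 0 x = x := by
  simp [flow, expT_zero]

theorem flow_add (η : Fin k → ℝ) (s t : ℝ) (x : M) :
    flow η (s + t) x = flow η s (flow η t x) := by
  simp [flow, add_smul, expT_add, mul_smul]

theorem flow_neg_flow (η : Fin k → ℝ) (t : ℝ) (x : M) : flow η (-t) (flow η t x) = x := by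
  rw [← flow_add, neg_add_cancel, flow_zero]

theorem flow_flow_neg (η : Fin k → ℝ) (t : ℝ) (x : M) : flow η t (flow η (-t) x) = x := by
  rw [← flow_add, add_neg_cancel, flow_zero]

theorem flow_zero_left (t : ℝ) (x : M) : flow (0 : Fin k → ℝ) t x = x := by
  simp [flow, expT_zero]

theorem flow_one {η : Fin k → ℝ} (hη : expT η = 1) (x : M) : flow η 1 x = x := by
  simp [flow, hη]

/-- Smoothness of the torus action, as a map on `𝔱 × M`. -/
abbrev SmoothTorusAction (k : ℕ) (E M : Type*) [NormedAddCommGroup E] [NormedSpace ℝ E]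
    [TopologicalSpace M] [ChartedSpace E M] [MulAction (Fin k → Circle) M] : Prop :=
  ContMDiff (𝓘(ℝ, Fin k → ℝ).prod 𝓘(ℝ, E)) 𝓘(ℝ, E) ∞
    (fun q : (Fin k → ℝ) × M => expT q.1 • q.2)

variable (hT : SmoothTorusAction k E M)

include hT

theorem contMDiff_flow_uncurry (η : Fin k → ℝ) :
    ContMDiff (𝓘(ℝ, ℝ).prod 𝓘(ℝ, E)) 𝓘(ℝ, E) ∞ (fun q : ℝ × M => flow η q.1 q.2) := by
  have h1 : ContMDiff 𝓘(ℝ, ℝ) 𝓘(ℝ, Fin k → ℝ) ∞ fun t : ℝ => t • η :=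
    (contDiff_id.smul contDiff_const).contMDiff
  exact hT.comp (h1.prodMap contMDiff_id)

theorem contMDiff_flow (η : Fin k → ℝ) (t : ℝ) :
    ContMDiff 𝓘(ℝ, E) 𝓘(ℝ, E) ∞ (flow (M := M) η t) :=
  (contMDiff_flow_uncurry hT η).comp (contMDiff_const.prodMk contMDiff_id)

theorem contMDiff_orbit (η : Fin k → ℝ) (x : M) :
    ContMDiff 𝓘(ℝ, ℝ) 𝓘(ℝ, E) ∞ (fun t => flow η t x) :=
  (contMDiff_flow_uncurry hT η).comp (contMDiff_id.prodMk contMDiff_const)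

end Flow

/-! ### Straightening the flow: existence of flow boxes -/

section FlowBox

variable {k : ℕ} (E : Type*) [NormedAddCommGroup E] [NormedSpace ℝ E]
  (M : Type*) [TopologicalSpace M] [ChartedSpace E M]
  [MulAction (Fin k → Circle) M]

/-- A chart with convex image in which the flow of `η` is the translation in a fixed direction. -/
structure FlowBox (η : Fin k → ℝ) where
  /-- the chart -/
  chart : OpenPartialHomeomorph M E
  smooth : ContMDiffOn 𝓘(ℝ, E) 𝓘(ℝ, E) ∞ chart chart.source
  smooth_symm : ContMDiffOn 𝓘(ℝ, E) 𝓘(ℝ, E) ∞ chart.symm chart.target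
  convex : Convex ℝ chart.target
  /-- the direction of the flow -/
  dir : E
  symm_add : ∀ y (t : ℝ), y ∈ chart.target → y + t • dir ∈ chart.target →
    chart.symm (y + t • dir) = flow η t (chart.symm y)

variable {E M} {η : Fin k → ℝ}

/-- Restriction of a flow box to a convex open subset of its image. -/
def FlowBox.restrict (b : FlowBox E M η) {C : Set E} (hC : IsOpen C) (hC' : Convex ℝ C) :
    FlowBox E M η where
  chart := (b.chart.symm.restrOpen C hC).symm
  smooth := b.smooth.mono fun x hx => by
    have h := (b.chart.symm.restrOpen C hC).map_target hx
    have h' := (b.chart.symm.restrOpen C hC).right_inv hx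
    rw [← h']
    exact b.chart.map_target h.1
  smooth_symm := b.smooth_symm.mono fun y hy => hy.1
  convex := b.convex.inter hC'
  dir := b.dir
  symm_add y t hy hy' := b.symm_add y t hy.1 hy'.1

theorem FlowBox.restrict_source (b : FlowBox E M η) {C : Set E} (hC : IsOpen C)
    (hC' : Convex ℝ C) :
    (b.restrict hC hC').chart.source = b.chart.source ∩ b.chart ⁻¹' C := by
  ext x
  constructor
  · intro hx
    have h := (b.chart.symm.restrOpen C hC).map_target hx
    have h' := (b.chart.symm.restrOpen C hC).right_inv hx
    refine ⟨?_, h.2⟩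
    rw [← h']
    exact b.chart.map_target h.1
  · rintro ⟨hx, hxC⟩
    have h : b.chart x ∈ (b.chart.symm.restrOpen C hC).source := ⟨b.chart.map_source hx, hxC⟩
    have h' := (b.chart.symm.restrOpen C hC).map_source h
    have h'' : (b.chart.symm.restrOpen C hC) (b.chart x) = x := b.chart.left_inv hx
    rwa [h''] at h'

variable [IsManifold 𝓘(ℝ, E) ∞ M] [FiniteDimensional ℝ E]

/-- The tangent space at `q` is `E` as seen in the preferred chart at `q`, so in that particular
chart the fundamental vector is an ordinary derivative. -/
theorem hasDerivAt_chart_flow (hT : SmoothTorusAction k E M) (η : Fin k → ℝ) (q : M) :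
    HasDerivAt (fun t : ℝ => chartAt E q (flow η t q)) (fundField (E := E) η q : E) 0 := by
  have hd : MDifferentiableAt 𝓘(ℝ, ℝ) 𝓘(ℝ, E) (orbitCurve η q) 0 :=
    (contMDiff_orbit hT η q).mdifferentiableAt (by simp)
  have h1 := hd.mfderiv
  have h2 := hd.differentiableWithinAt_writtenInExtChartAt
  have h0 : orbitCurve η q 0 = q := flow_zero η q
  have h3 : writtenInExtChartAt 𝓘(ℝ, ℝ) 𝓘(ℝ, E) (0 : ℝ) (orbitCurve η q)
      = fun t : ℝ => chartAt E q (flow η t q) := by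
    funext t
    simp only [writtenInExtChartAt, h0]
    simp [orbitCurve, flow, chartAt_self_eq]
  have h5 : extChartAt 𝓘(ℝ, ℝ) (0 : ℝ) 0 = 0 := rfl
  simp only [h3, h5, ModelWithCorners.range_eq_univ, fderivWithin_univ,
    differentiableWithinAt_univ] at h1 h2
  have h2' : DifferentiableAt ℝ (fun t : ℝ => chartAt E q (flow η t q)) 0 := h2
  have h4 : (fundField (E := E) η q : E)
      = fderiv ℝ (fun t : ℝ => chartAt E q (flow η t q)) 0 1 := by
    rw [fundField, h1]
    rfl
  rw [h4]
  exact h2'.hasFDerivAt.hasDerivAt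

/-- A point `y` is sent to the flow for time `l y` of the point with chart coordinates `x₀ + y - l y
• e`, which lies on a slice transverse to the orbit. By construction translation by `t • e` becomes
the flow for time `t`, and the inverse function theorem turns this map into a chart. If `e = 0`, the
hypothesis forces `η = 0` and the flow is trivial. -/
theorem exists_flowBox_aux (hT : SmoothTorusAction k E M) (η : Fin k → ℝ) (q : M)
    (hη : fundField (E := E) η q = (0 : E) → η = 0) :
    ∃ (c : OpenPartialHomeomorph M E) (e : E), q ∈ c.source ∧
      ContMDiffOn 𝓘(ℝ, E) 𝓘(ℝ, E) ∞ c c.source ∧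
      ContMDiffOn 𝓘(ℝ, E) 𝓘(ℝ, E) ∞ c.symm c.target ∧
      ∀ y (t : ℝ), y ∈ c.target → y + t • e ∈ c.target →
        c.symm (y + t • e) = flow η t (c.symm y) := by
  set χ := chartAt E q with hχ
  have hq : q ∈ χ.source := mem_chart_source E q
  set x₀ := χ q with hx₀
  have hx₀t : x₀ ∈ χ.target := mem_chart_target E q
  have hχs : ContMDiffOn 𝓘(ℝ, E) 𝓘(ℝ, E) ∞ χ χ.source := contMDiffOn_chart
  have hχs' : ContMDiffOn 𝓘(ℝ, E) 𝓘(ℝ, E) ∞ χ.symm χ.target := contMDiffOn_chart_symm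
  set e : E := fundField (E := E) η q with he
  -- Taking `l = 0` when `e = 0` lets one formula serve both cases.
  obtain ⟨l, hl⟩ : ∃ l : E →L[ℝ] ℝ, (e ≠ 0 → l e = 1) := by
    rcases eq_or_ne e 0 with h | h
    · exact ⟨0, fun h' => absurd h h'⟩
    · obtain ⟨l₀, -, hl₀⟩ := exists_dual_vector ℝ e (norm_ne_zero_iff.2 h)
      have hne : l₀ e ≠ 0 := by simpa [hl₀] using h
      exact ⟨(l₀ e)⁻¹ • l₀, fun _ => by simp [hne]⟩
  have hflow0 : e = 0 → ∀ t (x : M), flow η t x = x := fun h t x => by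
    rw [hη h, flow_zero_left]
  -- the flow in the chart
  let z : E → E := fun y => x₀ + y - l y • e
  let Ψ : E → M := fun y => flow η (l y) (χ.symm (z y))
  have hzs : ContMDiff 𝓘(ℝ, E) 𝓘(ℝ, E) ∞ z := by
    refine ContDiff.contMDiff ?_
    fun_prop
  have hls : ContMDiff 𝓘(ℝ, E) 𝓘(ℝ, ℝ) ∞ l := l.contDiff.contMDiff
  have hz0 : z 0 = x₀ := by simp [z]
  have hΨ0 : Ψ 0 = q := by
    simp [Ψ, hz0, flow_zero, hx₀, χ.left_inv hq]
  let S₁ : Set E := z ⁻¹' χ.target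
  have hS₁ : IsOpen S₁ := χ.open_target.preimage hzs.continuous
  have hΨs : ContMDiffOn 𝓘(ℝ, E) 𝓘(ℝ, E) ∞ Ψ S₁ := by
    have h1 : ContMDiffOn 𝓘(ℝ, E) 𝓘(ℝ, E) ∞ (fun y => χ.symm (z y)) S₁ :=
      hχs'.comp hzs.contMDiffOn fun y hy => hy
    exact (contMDiff_flow_uncurry hT η).comp_contMDiffOn (hls.contMDiffOn.prodMk h1)
  have hΨadd : ∀ y (t : ℝ), Ψ (y + t • e) = flow η t (Ψ y) := by
    intro y t
    rcases eq_or_ne e 0 with h | h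
    · rw [hflow0 h, h, smul_zero, add_zero]
    · have h1 : z (y + t • e) = z y := by
        simp only [z, map_add, map_smul, hl h, smul_eq_mul, mul_one]
        module
      simp only [Ψ, h1, ← flow_add]
      rw [map_add, map_smul, hl h, smul_eq_mul, mul_one, add_comm]
  let S₂ : Set E := S₁ ∩ Ψ ⁻¹' χ.source
  have hS₂ : IsOpen S₂ := hΨs.continuousOn.isOpen_inter_preimage hS₁ χ.open_source
  have h0S₂ : (0 : E) ∈ S₂ := ⟨by simpa [S₁, hz0] using hx₀t, by simpa [hΨ0] using hq⟩
  let F : E → E := fun y => χ (Ψ y)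
  have hFs : ContDiffOn ℝ ∞ F S₂ :=
    (hχs.comp (hΨs.mono inter_subset_left) fun y hy => hy.2).contDiffOn
  have hderiv : HasDerivAt (fun t : ℝ => χ (flow η t q)) e 0 := hasDerivAt_chart_flow hT η q
  let G : ℝ × E → E := fun p => χ (flow η p.1 (χ.symm p.2))
  have hGs : ContMDiffAt 𝓘(ℝ, ℝ × E) 𝓘(ℝ, E) ∞ G (0, x₀) := by
    have h1 : ContMDiffAt 𝓘(ℝ, ℝ × E) 𝓘(ℝ, E) ∞ (fun p : ℝ × E => χ.symm p.2) (0, x₀) :=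
      (hχs'.contMDiffAt (χ.open_target.mem_nhds hx₀t)).comp (0, x₀)
        (contDiff_snd.contMDiff.contMDiffAt)
    have h2 : ContMDiffAt 𝓘(ℝ, ℝ × E) 𝓘(ℝ, E) ∞ (fun p : ℝ × E => flow η p.1 (χ.symm p.2)) (0, x₀) :=
      (contMDiff_flow_uncurry hT η).contMDiffAt.comp (0, x₀)
        (contDiff_fst.contMDiff.contMDiffAt.prodMk h1)
    refine ContMDiffAt.comp (0, x₀) (hχs.contMDiffAt ?_) h2
    simpa [flow_zero, hx₀, χ.left_inv hq] using χ.open_source.mem_nhds hq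
  have hGd : DifferentiableAt ℝ G (0, x₀) :=
    (hGs.contDiffAt.differentiableAt (by simp))
  have hG1 : fderiv ℝ G (0, x₀) (1, 0) = e := by
    have h1 : HasDerivAt (fun t : ℝ => G (t, x₀)) (fderiv ℝ G (0, x₀) (1, 0)) 0 := by
      have h0 : HasFDerivAt G (fderiv ℝ G (0, x₀)) ((fun t : ℝ => (t, x₀)) 0) := hGd.hasFDerivAt
      exact h0.comp_hasDerivAt (0 : ℝ) ((hasDerivAt_id' (0 : ℝ)).prodMk (hasDerivAt_const (0 : ℝ) x₀))
    have h2 : (fun t : ℝ => G (t, x₀)) = fun t => χ (flow η t q) := by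
      funext t
      simp only [G, hx₀, χ.left_inv hq]
    rw [h2] at h1
    exact h1.unique hderiv
  have hG2 : ∀ w, fderiv ℝ G (0, x₀) (0, w) = w := by
    intro w
    have h1 : HasFDerivAt (fun y : E => G (0, y))
        ((fderiv ℝ G (0, x₀)).comp (ContinuousLinearMap.inr ℝ ℝ E)) x₀ :=
      hGd.hasFDerivAt.comp x₀ (hasFDerivAt_prodMk_right (0 : ℝ) x₀)
    have h2 : (fun y : E => G (0, y)) =ᶠ[𝓝 x₀] id := by
      filter_upwards [χ.open_target.mem_nhds hx₀t] with y hy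
      simp [G, flow_zero, χ.right_inv hy]
    have h3 := (h1.congr_of_eventuallyEq h2.symm).unique (hasFDerivAt_id x₀)
    simpa using congrArg (fun T : E →L[ℝ] E => T w) h3
  have hF0 : HasFDerivAt F ((ContinuousLinearEquiv.refl ℝ E : E ≃L[ℝ] E) : E →L[ℝ] E) 0 := by
    have hz : HasFDerivAt (fun y : E => (l y, z y))
        (l.prod (ContinuousLinearMap.id ℝ E - l.smulRight e)) 0 := by
      refine l.hasFDerivAt.prodMk ?_
      exact ((hasFDerivAt_id (0 : E)).const_add x₀).sub (l.smulRight e).hasFDerivAt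
    have hG' : HasFDerivAt G (fderiv ℝ G (0, x₀)) (l 0, z 0) := by
      simpa [hz0] using hGd.hasFDerivAt
    have h1 := hG'.comp (0 : E) hz
    refine h1.congr_fderiv ?_
    ext v
    have h2 : ((l v, v - l v • e) : ℝ × E) = l v • (1, 0) + (0, v - l v • e) := by
      simp
    simp only [ContinuousLinearMap.comp_apply, ContinuousLinearMap.prod_apply,
      sub_apply, ContinuousLinearMap.id_apply,
      ContinuousLinearMap.smulRight_apply, ContinuousLinearEquiv.coe_coe,
      ContinuousLinearEquiv.refl_apply]
    rw [h2, map_add, map_smul, hG1, hG2]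
    simp
  have hFc : ContDiffAt ℝ ∞ F 0 := hFs.contDiffAt (hS₂.mem_nhds h0S₂)
  -- Invertibility of the derivative at 0 alone gives a smooth inverse only near one point.
  -- Shrinking to a set where the derivative stays invertible makes the inverse smooth on the whole
  -- target.
  obtain ⟨S₃, hS₃, hS₃o, h0S₃⟩ : ∃ S₃ ⊆ {y | y ∈ S₂ ∧
      ∃ f' : E ≃L[ℝ] E, HasFDerivAt F (f' : E →L[ℝ] E) y}, IsOpen S₃ ∧ (0 : E) ∈ S₃ := by
    refine mem_nhds_iff.1 ?_
    have h1 : ContinuousAt (fderiv ℝ F) 0 :=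
      (hFs.continuousOn_fderiv_of_isOpen hS₂ (by simp)).continuousAt (hS₂.mem_nhds h0S₂)
    have h2 : range ((↑) : (E ≃L[ℝ] E) → E →L[ℝ] E) ∈ 𝓝 (fderiv ℝ F 0) := by
      rw [hF0.fderiv]
      exact ContinuousLinearEquiv.nhds _
    filter_upwards [h1.preimage_mem_nhds h2, hS₂.mem_nhds h0S₂] with y ⟨f', hf'⟩ hy
    refine ⟨hy, f', ?_⟩
    rw [hf']
    exact ((hFs.contDiffAt (hS₂.mem_nhds hy)).differentiableAt (by simp)).hasFDerivAt
  let P := (hFc.toOpenPartialHomeomorph F hF0 (by simp)).restrOpen S₃ hS₃o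
  have hPS : P.source ⊆ S₃ := fun y hy => hy.2
  have h0P : (0 : E) ∈ P.source :=
    ⟨hFc.mem_toOpenPartialHomeomorph_source hF0 (by simp), h0S₃⟩
  have hPF : ∀ y, P y = F y := fun y => rfl
  have hF0' : F 0 = x₀ := by simp [F, hΨ0, hx₀]
  have hPsymm : ContDiffOn ℝ ∞ P.symm P.target := by
    intro y hy
    have h1 := P.map_target hy
    obtain ⟨hy2, f', hf'⟩ := hS₃ (hPS h1)
    exact (P.contDiffAt_symm hy hf' (hFs.contDiffAt (hS₂.mem_nhds hy2))).contDiffWithinAt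
  refine ⟨χ.trans P.symm, e, ?_, ?_, ?_, ?_⟩
  · rw [OpenPartialHomeomorph.trans_source]
    refine ⟨hq, ?_⟩
    have := P.map_source h0P
    rwa [hPF, hF0'] at this
  · rw [OpenPartialHomeomorph.trans_source]
    exact hPsymm.contMDiffOn.comp (hχs.mono inter_subset_left) fun x hx => hx.2
  · have h1 : ContMDiffOn 𝓘(ℝ, E) 𝓘(ℝ, E) ∞ F S₂ := hFs.contMDiffOn
    rw [OpenPartialHomeomorph.trans_target]
    exact hχs'.comp (h1.mono fun y hy => (hS₃ (hPS hy.1)).1) fun y hy => hy.2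
  · have hsymm : ∀ y ∈ (χ.trans P.symm).target, (χ.trans P.symm).symm y = Ψ y := by
      intro y hy
      rw [OpenPartialHomeomorph.trans_target] at hy
      have h1 : y ∈ S₂ := (hS₃ (hPS hy.1)).1
      change χ.symm (χ (Ψ y)) = Ψ y
      exact χ.left_inv h1.2
    intro y t hy hy'
    rw [hsymm _ hy, hsymm _ hy', hΨadd]

/-- Around each point, inside each neighbourhood, there is a flow box. -/
theorem exists_flowBox (hT : SmoothTorusAction k E M) (η : Fin k → ℝ) (q : M)
    (hη : fundField (E := E) η q = (0 : E) → η = 0) {O : Set M} (hO : IsOpen O) (hq : q ∈ O) :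
    ∃ b : FlowBox E M η, q ∈ b.chart.source ∧ b.chart.source ⊆ O := by
  obtain ⟨c, e, hqc, hc, hc', hadd⟩ := exists_flowBox_aux hT η q hη
  have hc0 : c q ∈ c.target := c.map_source hqc
  obtain ⟨r, hr, hball⟩ := Metric.isOpen_iff.1
    (c.isOpen_inter_preimage_symm hO) (c q) ⟨hc0, by simpa [c.left_inv hqc] using hq⟩
  -- A ball as target provides the convexity, and it was chosen so small that the source lies in
  -- `O`.
  let c' := (c.symm.restrOpen (Metric.ball (c q) r) Metric.isOpen_ball).symm
  have ht : c'.target = Metric.ball (c q) r := by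
    change c.target ∩ _ = _
    exact inter_eq_right.2 fun y hy => (hball hy).1
  have hs : ∀ x ∈ c'.source, x ∈ c.source ∧ x ∈ O := by
    intro x hx
    have h := c'.map_source hx
    rw [ht] at h
    have h' := c'.left_inv hx
    have h2 := hball h
    have h3 : c.symm (c' x) = x := h'
    refine ⟨?_, ?_⟩
    · rw [← h3]
      exact c.map_target h2.1
    · rw [← h3]
      exact h2.2
  refine ⟨⟨c', hc.mono fun x hx => (hs x hx).1, hc'.mono fun y hy => hy.1, ?_, e,
    fun y t hy hy' => hadd y t hy.1 hy'.1⟩, ?_, fun x hx => (hs x hx).2⟩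
  · rw [ht]
    exact convex_ball _ _
  · have h1 : c q ∈ c'.target := by
      rw [ht]
      exact Metric.mem_ball_self hr
    have h2 := c'.map_target h1
    have h3 : c'.symm (c q) = q := c.left_inv hqc
    rwa [h3] at h2

end FlowBox

/-! ### Tangent vectors and Lie brackets in a flow box -/

section BoxCalculus

variable {k : ℕ} {E : Type*} [NormedAddCommGroup E] [NormedSpace ℝ E]
  {M : Type*} [TopologicalSpace M] [ChartedSpace E M]
  [MulAction (Fin k → Circle) M] [IsManifold 𝓘(ℝ, E) ∞ M]
  {F : Type*} [NormedAddCommGroup F] [NormedSpace ℝ F] {η : Fin k → ℝ}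

/-- The derivative along the flow of `η` is the derivative in the direction of the fundamental
vector field. -/
theorem hasDerivAt_flow (hT : SmoothTorusAction k E M) {f : M → F} {x : M} {t : ℝ}
    (hf : MDifferentiableAt 𝓘(ℝ, E) 𝓘(ℝ, F) f (flow η t x)) :
    HasDerivAt (fun s => f (flow η s x))
      (mvfderiv 𝓘(ℝ, E) f (flow η t x) (fundField η (flow η t x))) t := by
  have key : ∀ z : M, MDifferentiableAt 𝓘(ℝ, E) 𝓘(ℝ, F) f z →
      HasDerivAt (fun s => f (flow η s z)) (mvfderiv 𝓘(ℝ, E) f z (fundField η z)) 0 := by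
    intro z hz
    have h0 : orbitCurve η z 0 = z := flow_zero η z
    have hd : MDifferentiableAt 𝓘(ℝ, ℝ) 𝓘(ℝ, E) (orbitCurve η z) 0 :=
      (contMDiff_orbit hT η z).mdifferentiableAt (by simp)
    have h1 : HasMFDerivAt 𝓘(ℝ, ℝ) 𝓘(ℝ, F) (f ∘ orbitCurve η z) 0
        ((mfderiv 𝓘(ℝ, E) 𝓘(ℝ, F) f z).comp (mfderiv 𝓘(ℝ, ℝ) 𝓘(ℝ, E) (orbitCurve η z) 0)) := by
      refine HasMFDerivAt.comp (0 : ℝ) ?_ hd.hasMFDerivAt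
      rw [h0]
      exact hz.hasMFDerivAt
    have h2 : HasFDerivAt (fun s => f (flow η s z)) ((mvfderiv 𝓘(ℝ, E) f z).comp
        (mfderiv 𝓘(ℝ, ℝ) 𝓘(ℝ, E) (orbitCurve η z) 0 : ℝ →L[ℝ] TangentSpace 𝓘(ℝ, E) z)) 0 :=
      hasMFDerivAt_iff_hasFDerivAt.1 h1
    exact h2.hasDerivAt
  -- The group law of the flow shifts the statement at time 0 to time `t`.
  have h2 := (key _ hf)
  have h3 : (fun s => f (flow η s x)) = fun s => (fun r => f (flow η r (flow η t x))) (s - t) := by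
    funext s
    simp only [← flow_add, sub_add_cancel]
  rw [h3]
  refine HasDerivAt.comp_sub_const (f := fun r => f (flow η r (flow η t x))) t t ?_
  rwa [sub_self]

namespace FlowBox

variable (b : FlowBox E M η)

theorem mdifferentiable : b.chart.MDifferentiable 𝓘(ℝ, E) 𝓘(ℝ, E) :=
  ⟨b.smooth.mdifferentiableOn (by simp), b.smooth_symm.mdifferentiableOn (by simp)⟩

/-- The coordinates of tangent vectors in a flow box. -/
def coord (x : M) : TangentSpace 𝓘(ℝ, E) x →L[ℝ] E := mvfderiv 𝓘(ℝ, E) b.chart x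

/-- The vector field with constant coordinates `v`. -/
def field (v : E) (x : M) : TangentSpace 𝓘(ℝ, E) x :=
  VectorField.mpullback 𝓘(ℝ, E) 𝓘(ℝ, E) b.chart (fun _ => v) x

variable {b} {x : M}

theorem source_mem_nhds (hx : x ∈ b.chart.source) : b.chart.source ∈ 𝓝 x :=
  b.chart.open_source.mem_nhds hx

theorem contMDiffAt_chart (hx : x ∈ b.chart.source) :
    ContMDiffAt 𝓘(ℝ, E) 𝓘(ℝ, E) ∞ b.chart x :=
  b.smooth.contMDiffAt (source_mem_nhds hx)

theorem mdifferentiableAt_chart (hx : x ∈ b.chart.source) :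
    MDifferentiableAt 𝓘(ℝ, E) 𝓘(ℝ, E) b.chart x :=
  (contMDiffAt_chart hx).mdifferentiableAt (by simp)

theorem isInvertible (hx : x ∈ b.chart.source) :
    (mfderiv 𝓘(ℝ, E) 𝓘(ℝ, E) b.chart x).IsInvertible :=
  ⟨b.mdifferentiable.mfderiv hx, rfl⟩

theorem coord_field (hx : x ∈ b.chart.source) (v : E) : b.coord x (b.field v x) = v :=
  (isInvertible hx).self_apply_inverse _

theorem field_coord (hx : x ∈ b.chart.source) (u : TangentSpace 𝓘(ℝ, E) x) :
    b.field (b.coord x u) x = u :=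
  (isInvertible hx).inverse_apply_self _

theorem coord_injective (hx : x ∈ b.chart.source) : Function.Injective (b.coord x) := by
  intro u v h
  rw [← field_coord hx u, h, field_coord hx]

theorem coord_mpullback (hx : x ∈ b.chart.source) (V : ∀ y : E, TangentSpace 𝓘(ℝ, E) y) :
    b.coord x (VectorField.mpullback 𝓘(ℝ, E) 𝓘(ℝ, E) b.chart V x) = V (b.chart x) :=
  (isInvertible hx).self_apply_inverse _

/-- The point at time `t` on the flow line of `x` in a flow box. -/
theorem flow_mem (hx : x ∈ b.chart.source) {t : ℝ} (ht : b.chart x + t • b.dir ∈ b.chart.target) :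
    flow η t x ∈ b.chart.source ∧ b.chart (flow η t x) = b.chart x + t • b.dir := by
  have h := b.symm_add (b.chart x) t (b.chart.map_source hx) ht
  rw [b.chart.left_inv hx] at h
  rw [← h]
  exact ⟨b.chart.map_target ht, b.chart.right_inv ht⟩

theorem eventually_add_mem (hx : x ∈ b.chart.source) :
    ∀ᶠ t : ℝ in 𝓝 0, b.chart x + t • b.dir ∈ b.chart.target := by
  have hc : Continuous fun t : ℝ => b.chart x + t • b.dir := by fun_prop
  refine hc.continuousAt.preimage_mem_nhds ?_
  simpa using b.chart.open_target.mem_nhds (b.chart.map_source hx)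

/-- Along the flow the coordinates are `b.chart x + t • b.dir`. Comparing this derivative at time 0
with the chain rule identifies the coordinates of the fundamental vector. -/
theorem fundField_eq (hT : SmoothTorusAction k E M) (hx : x ∈ b.chart.source) :
    fundField η x = b.field b.dir x := by
  refine coord_injective hx ?_
  rw [coord_field hx]
  have h1 := hasDerivAt_flow (η := η) (x := x) (t := 0) hT (f := b.chart)
    (by rw [flow_zero]; exact mdifferentiableAt_chart hx)
  have h2 : HasDerivAt (fun s => b.chart (flow η s x)) b.dir 0 := by
    have h3 : HasDerivAt (fun s : ℝ => b.chart x + s • b.dir) b.dir 0 := by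
      simpa using ((hasDerivAt_id' (0 : ℝ)).smul_const b.dir).const_add (b.chart x)
    refine h3.congr_of_eventuallyEq ?_
    filter_upwards [eventually_add_mem hx] with t ht
    exact (flow_mem hx ht).2
  have h3 := h1.unique h2
  rw [flow_zero] at h3
  exact h3

theorem mdifferentiableAt_const_field (v : E) (y : E) :
    MDifferentiableAt 𝓘(ℝ, E) 𝓘(ℝ, E).tangent
      (fun y => (⟨y, v⟩ : TangentBundle 𝓘(ℝ, E) E)) y := by
  have : ContMDiffAt 𝓘(ℝ, E) 𝓘(ℝ, E).tangent ∞
      (fun y => (⟨y, v⟩ : TangentBundle 𝓘(ℝ, E) E)) y :=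
    contMDiffAt_vectorSpace_iff_contDiffAt.2 contDiffAt_const
  exact this.mdifferentiableAt (by simp)

theorem smoothFieldOn_field [CompleteSpace E] (v : E) :
    SmoothFieldOn (b.field v) b.chart.source := by
  intro x hx
  have h : ContMDiffAt 𝓘(ℝ, E) 𝓘(ℝ, E).tangent ∞
      (fun y => (⟨y, v⟩ : TangentBundle 𝓘(ℝ, E) E)) (b.chart x) :=
    contMDiffAt_vectorSpace_iff_contDiffAt.2 contDiffAt_const
  exact (h.mpullback_vectorField_preimage (contMDiffAt_chart hx) (isInvertible hx)
    (by simp)).contMDiffWithinAt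

theorem contMDiffOn_coord {V : ∀ x : M, TangentSpace 𝓘(ℝ, E) x} {W : Set M}
    (hW : IsOpen W) (hV : SmoothFieldOn V W) :
    ContMDiffOn 𝓘(ℝ, E) 𝓘(ℝ, E) ∞ (fun x => b.coord x (V x)) (b.chart.source ∩ W) := by
  have h1 := (b.smooth.mono inter_subset_left).contMDiffOn_tangentMapWithin (m := ∞) (by simp)
    (b.chart.open_source.inter hW).uniqueMDiffOn
  have h2 : ContMDiffOn 𝓘(ℝ, E) (𝓘(ℝ, E).tangent) ∞
      (fun x => TotalSpace.mk' E x (V x)) (b.chart.source ∩ W) := hV.mono inter_subset_right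
  refine ((contMDiff_snd_tangentBundle_modelSpace (n := ∞) E 𝓘(ℝ, E)).comp_contMDiffOn
    (h1.comp h2 fun x hx => hx)).congr fun x hx => ?_
  have h3 : mfderivWithin 𝓘(ℝ, E) 𝓘(ℝ, E) b.chart (b.chart.source ∩ W) x
      = mfderiv 𝓘(ℝ, E) 𝓘(ℝ, E) b.chart x :=
    mfderivWithin_of_isOpen (b.chart.open_source.inter hW) hx
  change _ = mfderivWithin 𝓘(ℝ, E) 𝓘(ℝ, E) b.chart (b.chart.source ∩ W) x (V x)
  rw [h3]
  rfl

/-- A field is the pullback of its coordinate representation. -/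
theorem field_rep (V : ∀ x : M, TangentSpace 𝓘(ℝ, E) x) (hx : x ∈ b.chart.source) :
    V x = VectorField.mpullback 𝓘(ℝ, E) 𝓘(ℝ, E) b.chart
      (fun y => (b.coord (b.chart.symm y) (V (b.chart.symm y)) : E)) x := by
  refine coord_injective hx ?_
  refine Eq.trans ?_ (coord_mpullback hx _).symm
  exact congrArg (fun z => (b.coord z (V z) : E)) (b.chart.left_inv hx).symm

theorem contDiffAt_rep {f : M → F} {x : M} (hx : x ∈ b.chart.source)
    (hf : ContMDiffAt 𝓘(ℝ, E) 𝓘(ℝ, F) ∞ f x) :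
    ContDiffAt ℝ ∞ (fun y => f (b.chart.symm y)) (b.chart x) := by
  refine ContMDiffAt.contDiffAt ?_
  refine ContMDiffAt.comp (b.chart x) ?_
    (b.smooth_symm.contMDiffAt (b.chart.open_target.mem_nhds (b.chart.map_source hx)))
  rwa [b.chart.left_inv hx]

theorem mlieBracket_const_left (v : E) (V : ∀ y : E, TangentSpace 𝓘(ℝ, E) y) (y : E) :
    VectorField.mlieBracket 𝓘(ℝ, E) (fun y => (v : TangentSpace 𝓘(ℝ, E) y)) V y
      = fderiv ℝ (fun y => (V y : E)) y v := by
  have h : VectorField.mlieBracket 𝓘(ℝ, E) (fun y => (v : TangentSpace 𝓘(ℝ, E) y)) V y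
      = VectorField.lieBracket ℝ (fun _ : E => v) (fun y => (V y : E)) y := by
    have h1 := VectorField.mlieBracketWithin_eq_lieBracketWithin (𝕜 := ℝ) (E := E) (s := univ)
      (V := fun y => (v : TangentSpace 𝓘(ℝ, E) y)) (W := V)
    exact congrFun (VectorField.mlieBracketWithin_univ.symm.trans
      (h1.trans VectorField.lieBracketWithin_univ)) y
  refine h.trans ((congrFun VectorField.lieBracket_eq y).trans ?_)
  have h2 : fderiv ℝ (fun _ : E => v) y = 0 := fderiv_const_apply v
  simp only [h2]
  exact sub_zero _

/-- In a flow box, the bracket with the fundamental vector field is the derivative of the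
coordinates along the flow. -/
theorem coord_mlieBracket [FiniteDimensional ℝ E] (hT : SmoothTorusAction k E M)
    {V : ∀ x : M, TangentSpace 𝓘(ℝ, E) x} {W : Set M} (hW : IsOpen W) (hV : SmoothFieldOn V W)
    (hx : x ∈ b.chart.source) (hxW : x ∈ W) :
    b.coord x (VectorField.mlieBracket 𝓘(ℝ, E) (fundField η) V x)
      = mvfderiv 𝓘(ℝ, E) (fun y => b.coord y (V y)) x (fundField η x) := by
  set Vt : E → E := fun y => b.coord (b.chart.symm y) (V (b.chart.symm y)) with hVt
  have hs : ContMDiffAt 𝓘(ℝ, E) 𝓘(ℝ, E) ∞ (fun y => b.coord y (V y)) x :=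
    (contMDiffOn_coord hW hV).contMDiffAt ((b.chart.open_source.inter hW).mem_nhds ⟨hx, hxW⟩)
  have hVts : ContDiffAt ℝ ∞ Vt (b.chart x) := contDiffAt_rep hx hs
  have hcs : CompleteSpace E := FiniteDimensional.complete ℝ E
  have h2' : IsManifold 𝓘(ℝ, E) (minSmoothness ℝ 2) M :=
    IsManifold.of_le (n := ∞) (by simpa using WithTop.coe_le_coe.2 (le_top : (2 : ℕ∞) ≤ ⊤))
  -- The bracket commutes with pullback by the chart. In `E` the fundamental field is constant, and
  -- the bracket with a constant field is a directional derivative.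
  have h1 : VectorField.mlieBracket 𝓘(ℝ, E) (fundField η) V x
      = VectorField.mpullback 𝓘(ℝ, E) 𝓘(ℝ, E) b.chart
        (VectorField.mlieBracket 𝓘(ℝ, E) (fun _ : E => b.dir) Vt) x := by
    refine Eq.trans ?_ (VectorField.mpullback_mlieBracket (n := ∞)
      (V := fun y => (b.dir : TangentSpace 𝓘(ℝ, E) y)) (W := Vt)
      (mdifferentiableAt_const_field _ _) ?_
      (contMDiffAt_chart hx) (by simpa using WithTop.coe_le_coe.2 (le_top : (2 : ℕ∞) ≤ ⊤))).symm
    · refine Filter.EventuallyEq.mlieBracket_vectorField_eq ?_ ?_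
      · filter_upwards [source_mem_nhds hx] with y hy
        exact fundField_eq hT hy
      · filter_upwards [source_mem_nhds hx] with y hy
        exact field_rep V hy
    · exact (contMDiffAt_vectorSpace_iff_contDiffAt.2 hVts).mdifferentiableAt (by simp)
  rw [h1]
  refine (coord_mpullback hx _).trans ((mlieBracket_const_left _ _ _).trans ?_)
  have h2 := hasDerivAt_flow (η := η) (x := x) (t := 0) hT (f := fun y => b.coord y (V y))
    (by rw [flow_zero]; exact hs.mdifferentiableAt (by simp))
  have h3 : HasDerivAt (fun s => b.coord (flow η s x) (V (flow η s x)))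
      (fderiv ℝ Vt (b.chart x) b.dir) 0 := by
    have h4 := hasDerivAt_line (f := Vt) (y := b.chart x) (e := b.dir) (t := 0)
      (by simpa using hVts.differentiableAt (by simp))
    simp only [zero_smul, add_zero] at h4
    refine h4.congr_of_eventuallyEq ?_
    filter_upwards [eventually_add_mem hx] with t ht
    have h5 := b.symm_add (b.chart x) t (b.chart.map_source hx) ht
    rw [b.chart.left_inv hx] at h5
    exact congrArg (fun z => (b.coord z (V z) : E)) h5.symm
  have h4 := h2.unique h3
  rw [flow_zero] at h4
  exact h4.symm

end FlowBox

end BoxCalculus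

/-! ### Products and inverses of complex valued smooth functions -/

section ComplexFunctions

variable {E : Type*} [NormedAddCommGroup E] [NormedSpace ℝ E]
  {M : Type*} [TopologicalSpace M] [ChartedSpace E M]

theorem _root_.ContMDiffWithinAt.cmul {f g : M → ℂ} {s : Set M} {x : M}
    (hf : ContMDiffWithinAt 𝓘(ℝ, E) 𝓘(ℝ, ℂ) ∞ f s x)
    (hg : ContMDiffWithinAt 𝓘(ℝ, E) 𝓘(ℝ, ℂ) ∞ g s x) :
    ContMDiffWithinAt 𝓘(ℝ, E) 𝓘(ℝ, ℂ) ∞ (fun y => f y * g y) s x :=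
  (contDiff_mul (𝕜 := ℝ) (𝔸 := ℂ)).contDiffAt.contMDiffAt.comp_contMDiffWithinAt x
    (hf.prodMk_space hg)

theorem _root_.ContMDiffAt.cmul {f g : M → ℂ} {x : M}
    (hf : ContMDiffAt 𝓘(ℝ, E) 𝓘(ℝ, ℂ) ∞ f x) (hg : ContMDiffAt 𝓘(ℝ, E) 𝓘(ℝ, ℂ) ∞ g x) :
    ContMDiffAt 𝓘(ℝ, E) 𝓘(ℝ, ℂ) ∞ (fun y => f y * g y) x :=
  ContMDiffWithinAt.cmul hf hg

theorem _root_.ContMDiffOn.cmul {f g : M → ℂ} {s : Set M}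
    (hf : ContMDiffOn 𝓘(ℝ, E) 𝓘(ℝ, ℂ) ∞ f s) (hg : ContMDiffOn 𝓘(ℝ, E) 𝓘(ℝ, ℂ) ∞ g s) :
    ContMDiffOn 𝓘(ℝ, E) 𝓘(ℝ, ℂ) ∞ (fun y => f y * g y) s :=
  fun x hx => (hf x hx).cmul (hg x hx)

theorem _root_.ContMDiffOn.cinv {f : M → ℂ} {s : Set M}
    (hf : ContMDiffOn 𝓘(ℝ, E) 𝓘(ℝ, ℂ) ∞ f s) (h0 : ∀ x ∈ s, f x ≠ 0) :
    ContMDiffOn 𝓘(ℝ, E) 𝓘(ℝ, ℂ) ∞ (fun y => (f y)⁻¹) s :=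
  fun x hx => (contDiffAt_inv ℝ (h0 x hx)).contMDiffAt.comp_contMDiffWithinAt x (hf x hx)

theorem smul_eq_re_add_im {V : Type*} [AddCommGroup V] [Module ℂ V] (z : ℂ) (a : V) :
    z • a = z.re • a + z.im • (Complex.I • a) := by
  rw [← Complex.coe_smul, ← Complex.coe_smul, smul_smul, ← add_smul, Complex.re_add_im]

end ComplexFunctions

/-! ### Frames of complex line bundles -/

section LineFrames

variable {E : Type*} [NormedAddCommGroup E] [NormedSpace ℝ E]
  {M : Type*} [TopologicalSpace M] [ChartedSpace E M]
  (L : M → Type*) [TopologicalSpace (TotalSpace ℂ L)]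
  [∀ x, AddCommGroup (L x)] [∀ x, Module ℂ (L x)] [∀ x, TopologicalSpace (L x)]
  [FiberBundle ℂ L]

variable (E) in
/-- A smooth frame of a complex line bundle over the set `W`, together with the coordinates in
this frame. -/
structure LineFrame (W : Set M) where
  /-- the frame -/
  sec : ∀ x, L x
  /-- the coordinate of vectors in the fibres -/
  coef : ∀ x, L x →ₗ[ℂ] ℂ
  coef_smul : ∀ x ∈ W, ∀ a : L x, coef x a • sec x = a
  coef_sec : ∀ x ∈ W, coef x (sec x) = 1
  smooth_sec : SmoothSectionOn (E := E) sec W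
  smooth_coef : ∀ W' : Set M, IsOpen W' → ∀ σ : ∀ x, L x, SmoothSectionOn (E := E) σ W' →
    ContMDiffOn 𝓘(ℝ, E) 𝓘(ℝ, ℂ) ∞ (fun x => coef x (σ x)) (W ∩ W')
  continuous_coef : ContinuousOn (fun p : TotalSpace ℂ L => coef p.1 p.2)
    (TotalSpace.proj ⁻¹' W)

variable {L} {W : Set M}

namespace LineFrame

/-- Restriction of a frame to a smaller set. -/
def restrict (f : LineFrame E L W) {W' : Set M} (h : W' ⊆ W) : LineFrame E L W' where
  sec := f.sec
  coef := f.coef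
  coef_smul x hx := f.coef_smul x (h hx)
  coef_sec x hx := f.coef_sec x (h hx)
  smooth_sec := f.smooth_sec.mono h
  smooth_coef W₁ hW₁ σ hσ := (f.smooth_coef W₁ hW₁ σ hσ).mono (inter_subset_inter_left _ h)
  continuous_coef := f.continuous_coef.mono (preimage_mono h)

theorem sec_ne_zero (f : LineFrame E L W) {x : M} (hx : x ∈ W) : f.sec x ≠ 0 := by
  intro h
  have := f.coef_sec x hx
  rw [h, map_zero] at this
  exact zero_ne_one this

variable [VectorBundle ℂ ℂ L] [VectorBundle ℝ ℂ L] [IsManifold 𝓘(ℝ, E) ∞ M]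
  [ContMDiffVectorBundle ∞ ℂ L 𝓘(ℝ, E)]

theorem _root_.GeomQuant.SmoothSectionOn.smul {σ : ∀ x, L x} {G : M → ℂ} (hW : IsOpen W)
    (hσ : SmoothSectionOn (E := E) σ W) (hG : ContMDiffOn 𝓘(ℝ, E) 𝓘(ℝ, ℂ) ∞ G W) :
    SmoothSectionOn (E := E) (fun x => G x • σ x) W := by
  intro x hx
  have h1 : ContMDiffAt 𝓘(ℝ, E) (𝓘(ℝ, E).prod 𝓘(ℝ, ℂ)) ∞
      (fun x => TotalSpace.mk' ℂ x (σ x)) x := (hσ x hx).contMDiffAt (hW.mem_nhds hx)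
  rw [contMDiffAt_section] at h1
  refine ContMDiffAt.contMDiffWithinAt ?_
  rw [contMDiffAt_section]
  have h2 := (hG.contMDiffAt (hW.mem_nhds hx)).cmul h1
  refine h2.congr_of_eventuallyEq ?_
  filter_upwards [(trivializationAt ℂ L x).open_baseSet.mem_nhds
    (mem_baseSet_trivializationAt ℂ L x)] with y hy
  have h3 := ((trivializationAt ℂ L x).linear ℂ hy).map_smul (G y) (σ y)
  simpa using h3

variable (E L) in
/-- The frame of a local trivialization. -/
def ofTrivialization (q : M) : LineFrame E L (trivializationAt ℂ L q).baseSet where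
  sec x := (trivializationAt ℂ L q).symm x 1
  coef x := (trivializationAt ℂ L q).linearMapAt ℂ x
  coef_smul x hx a := by
    have h := (trivializationAt ℂ L q).symmₗ_linearMapAt (R := ℂ) hx a
    rw [← (trivializationAt ℂ L q).symmₗ_apply (R := ℂ) hx, ← map_smul, smul_eq_mul, mul_one, h]
  coef_sec x hx := (trivializationAt ℂ L q).linearMapAt_symm hx 1
  smooth_sec := by
    rw [SmoothSectionOn, (trivializationAt ℂ L q).contMDiffOn_section_baseSet_iff]
    refine (contMDiffOn_const (c := (1 : ℂ))).congr fun x hx => ?_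
    rw [(trivializationAt ℂ L q).apply_mk_symm hx]
  smooth_coef W' hW' σ hσ := by
    have h := ((trivializationAt ℂ L q).contMDiffOn_section_iff (IB := 𝓘(ℝ, E)) (n := ∞)
      ((trivializationAt ℂ L q).open_baseSet.inter hW') inter_subset_left).1
      (hσ.mono inter_subset_right)
    refine h.congr fun x hx => ?_
    rw [(trivializationAt ℂ L q).coe_linearMapAt_of_mem hx.1]
  continuous_coef := by
    have h : ContinuousOn (fun p => (trivializationAt ℂ L q p).2) (trivializationAt ℂ L q).source :=
      continuous_snd.comp_continuousOn (trivializationAt ℂ L q).continuousOn_toFun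
    rw [(trivializationAt ℂ L q).source_eq] at h
    refine h.congr fun p hp => ?_
    rw [(trivializationAt ℂ L q).coe_linearMapAt_of_mem hp]

/-- The product of a frame with a nowhere vanishing function. -/
def smul (f : LineFrame E L W) (hW : IsOpen W) (G : M → ℂ)
    (hG : ContMDiffOn 𝓘(ℝ, E) 𝓘(ℝ, ℂ) ∞ G W) (hG0 : ∀ x ∈ W, G x ≠ 0) : LineFrame E L W where
  sec x := G x • f.sec x
  coef x := (G x)⁻¹ • f.coef x
  coef_smul x hx a := by
    rw [LinearMap.smul_apply, smul_eq_mul, smul_smul, mul_comm, ← mul_assoc,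
      mul_inv_cancel₀ (hG0 x hx), one_mul, f.coef_smul x hx]
  coef_sec x hx := by
    rw [LinearMap.smul_apply, map_smul, f.coef_sec x hx, smul_eq_mul, smul_eq_mul, mul_one,
      inv_mul_cancel₀ (hG0 x hx)]
  smooth_sec := f.smooth_sec.smul hW hG
  smooth_coef W' hW' σ hσ := by
    exact ((hG.cinv hG0).mono inter_subset_left).cmul (f.smooth_coef W' hW' σ hσ)
  continuous_coef := by
    have h1 : ContinuousOn (fun x => (G x)⁻¹) W := hG.continuousOn.inv₀ hG0
    have h2 : ContinuousOn (fun p : TotalSpace ℂ L => (G p.1)⁻¹) (TotalSpace.proj ⁻¹' W) :=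
      h1.comp (FiberBundle.continuous_proj ℂ L).continuousOn fun p hp => hp
    exact h2.mul f.continuous_coef

end LineFrame

end LineFrames

/-! ### The complex Leibniz rule for a prequantum connection -/

section Connection

variable {E : Type*} [NormedAddCommGroup E] [NormedSpace ℝ E] [FiniteDimensional ℝ E]
  {M : Type*} [TopologicalSpace M] [ChartedSpace E M] [IsManifold 𝓘(ℝ, E) ∞ M]
  {L : M → Type*} [TopologicalSpace (TotalSpace ℂ L)]
  [∀ x, AddCommGroup (L x)] [∀ x, Module ℂ (L x)] [∀ x, TopologicalSpace (L x)]
  [∀ x, IsTopologicalAddGroup (L x)] [∀ x, ContinuousSMul ℝ (L x)]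
  [FiberBundle ℂ L] [VectorBundle ℂ ℂ L] [VectorBundle ℝ ℂ L]
  [ContMDiffVectorBundle ∞ ℂ L 𝓘(ℝ, E)]
  {nabla : CovariantDerivative 𝓘(ℝ, E) ℂ L}
  {omega : ∀ x : M, FormAt (E := E) (Fin 2) ℝ x} {W : Set M}

theorem SmoothSectionOn.mdifferentiableAt {σ : ∀ x, L x} (hσ : SmoothSectionOn (E := E) σ W)
    (hW : IsOpen W) {x : M} (hx : x ∈ W) :
    MDifferentiableAt 𝓘(ℝ, E) (𝓘(ℝ, E).prod 𝓘(ℝ, ℂ)) (fun x => TotalSpace.mk' ℂ x (σ x)) x :=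
  ((hσ x hx).contMDiffAt (hW.mem_nhds hx)).mdifferentiableAt (by simp)

theorem mdifferentiableAt_re {g : M → ℂ} {x : M}
    (hg : MDifferentiableAt 𝓘(ℝ, E) 𝓘(ℝ, ℂ) g x) :
    HasMFDerivAt 𝓘(ℝ, E) 𝓘(ℝ, ℝ) (fun y => (g y).re) x
      (Complex.reCLM.comp (mvfderiv 𝓘(ℝ, E) g x)) := by
  have h : HasMFDerivAt 𝓘(ℝ, ℂ) 𝓘(ℝ, ℝ) Complex.reCLM (g x) Complex.reCLM :=
    Complex.reCLM.hasMFDerivAt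
  exact h.comp x hg.hasMFDerivAt

theorem mdifferentiableAt_im {g : M → ℂ} {x : M}
    (hg : MDifferentiableAt 𝓘(ℝ, E) 𝓘(ℝ, ℂ) g x) :
    HasMFDerivAt 𝓘(ℝ, E) 𝓘(ℝ, ℝ) (fun y => (g y).im) x
      (Complex.imCLM.comp (mvfderiv 𝓘(ℝ, E) g x)) := by
  have h : HasMFDerivAt 𝓘(ℝ, ℂ) 𝓘(ℝ, ℝ) Complex.imCLM (g x) Complex.imCLM :=
    Complex.imCLM.hasMFDerivAt
  exact h.comp x hg.hasMFDerivAt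

/-- The Leibniz rule of a prequantum connection for complex valued functions. -/
theorem IsPrequantum.leibniz (hL : IsPrequantum omega nabla) (hW : IsOpen W) {σ : ∀ x, L x}
    (hσ : SmoothSectionOn (E := E) σ W) {g : M → ℂ} {x : M} (hx : x ∈ W)
    (hg : MDifferentiableAt 𝓘(ℝ, E) 𝓘(ℝ, ℂ) g x) (v : TangentSpace 𝓘(ℝ, E) x) :
    nabla (fun y => g y • σ y) x v
      = g x • nabla σ x v + mvfderiv 𝓘(ℝ, E) g x v • σ x := by
  have hI : SmoothSectionOn (E := E) (fun y => Complex.I • σ y) W :=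
    hσ.smul hW contMDiffOn_const
  have h1 := mdifferentiableAt_re hg
  have h2 := mdifferentiableAt_im hg
  have hs1 : MDifferentiableAt 𝓘(ℝ, E) (𝓘(ℝ, E).prod 𝓘(ℝ, ℂ))
      (fun y => TotalSpace.mk' ℂ y (((fun y => (g y).re) • σ) y)) x :=
    MDifferentiableAt.smul_section h1.mdifferentiableAt (hσ.mdifferentiableAt hW hx)
  have hs2 : MDifferentiableAt 𝓘(ℝ, E) (𝓘(ℝ, E).prod 𝓘(ℝ, ℂ))
      (fun y => TotalSpace.mk' ℂ y (((fun y => (g y).im) • (fun y => Complex.I • σ y)) y)) x :=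
    MDifferentiableAt.smul_section h2.mdifferentiableAt (hI.mdifferentiableAt hW hx)
  -- The Leibniz rule built into `nabla` is for real functions. Splitting `g` into real and
  -- imaginary parts reduces to it, once complex linearity handles `Complex.I • σ`.
  have h3 : (fun y => g y • σ y) = ((fun y => (g y).re) • σ : ∀ y, L y)
      + ((fun y => (g y).im) • (fun y => Complex.I • σ y) : ∀ y, L y) := by
    funext y
    change g y • σ y = (g y).re • σ y + (g y).im • (Complex.I • σ y)
    exact smul_eq_re_add_im _ _
  have hC := nabla.isCovariantDerivativeOnUniv
  rw [h3, hC.add hs1 hs2, hC.leibniz (hσ.mdifferentiableAt hW hx) h1.mdifferentiableAt,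
    hC.leibniz (hI.mdifferentiableAt hW hx) h2.mdifferentiableAt]
  have h4 : mvfderiv 𝓘(ℝ, E) (fun y => (g y).re) x v = (mvfderiv 𝓘(ℝ, E) g x v).re := by
    rw [mvfderiv, h1.mfderiv]
    rfl
  have h5 : mvfderiv 𝓘(ℝ, E) (fun y => (g y).im) x v = (mvfderiv 𝓘(ℝ, E) g x v).im := by
    rw [mvfderiv, h2.mfderiv]
    rfl
  have h6 := hL.complex_linear W hW σ hσ Complex.I x hx v
  change (g x).re • nabla σ x v + mvfderiv 𝓘(ℝ, E) (fun y => (g y).re) x v • σ x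
    + ((g x).im • nabla (fun y => Complex.I • σ y) x v
      + mvfderiv 𝓘(ℝ, E) (fun y => (g y).im) x v • (Complex.I • σ x)) = _
  rw [h4, h5, h6]
  rw [smul_eq_re_add_im (g x), smul_eq_re_add_im (mvfderiv 𝓘(ℝ, E) g x v)]
  abel

end Connection

/-! ### Submersions have surjective derivative -/

section Submersion

variable {E : Type*} [NormedAddCommGroup E] [NormedSpace ℝ E]
  {M : Type*} [TopologicalSpace M] [ChartedSpace E M] [IsManifold 𝓘(ℝ, E) ∞ M]
  {F : Type*} [NormedAddCommGroup F] [NormedSpace ℝ F]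

/-- In the charts provided by the definition the map is a linear projection, and the derivatives of
the two charts are bijective. -/
theorem _root_.Manifold.IsSubmersion.surjective_mvfderiv {f : M → F}
    (hf : IsSubmersion 𝓘(ℝ, E) 𝓘(ℝ, F) ∞ f) (x : M) :
    Function.Surjective (mvfderiv 𝓘(ℝ, E) f x) := by
  have h := hf.isSubmersionAt x
  have hχ : ContMDiffOn 𝓘(ℝ, E) 𝓘(ℝ, E) ∞ h.domChart h.domChart.source :=
    contMDiffOn_of_mem_maximalAtlas h.domChart_mem_maximalAtlas
  have hχ' : ContMDiffOn 𝓘(ℝ, F) 𝓘(ℝ, F) ∞ h.codChart h.codChart.source :=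
    contMDiffOn_of_mem_maximalAtlas h.codChart_mem_maximalAtlas
  have hχs' : ContMDiffOn 𝓘(ℝ, F) 𝓘(ℝ, F) ∞ h.codChart.symm h.codChart.target :=
    contMDiffOn_symm_of_mem_maximalAtlas h.codChart_mem_maximalAtlas
  have hfs : MDifferentiableAt 𝓘(ℝ, E) 𝓘(ℝ, F) f x :=
    (h.contMDiffAt).mdifferentiableAt (by simp)
  have hw : ∀ z ∈ h.domChart.source, h.codChart (f z) = (h.equiv (h.domChart z)).1 := by
    intro z hz
    have h1 : (h.domChart.extend 𝓘(ℝ, E)) z ∈ (h.domChart.extend 𝓘(ℝ, E)).target := by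
      simpa using h.domChart.map_source hz
    have := h.writtenInCharts h1
    simpa [hz] using this
  have hx := h.mem_domChart_source
  have hfx := h.mem_codChart_source
  have hD : h.domChart.MDifferentiable 𝓘(ℝ, E) 𝓘(ℝ, E) :=
    ⟨hχ.mdifferentiableOn (by simp), (contMDiffOn_symm_of_mem_maximalAtlas
      h.domChart_mem_maximalAtlas (n := ∞) (I := 𝓘(ℝ, E))).mdifferentiableOn (by simp)⟩
  have hC : h.codChart.MDifferentiable 𝓘(ℝ, F) 𝓘(ℝ, F) :=
    ⟨hχ'.mdifferentiableOn (by simp), hχs'.mdifferentiableOn (by simp)⟩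
  have h1 : HasMFDerivAt 𝓘(ℝ, E) 𝓘(ℝ, F) (fun z => h.codChart (f z)) x
      ((mfderiv 𝓘(ℝ, F) 𝓘(ℝ, F) h.codChart (f x)).comp (mfderiv 𝓘(ℝ, E) 𝓘(ℝ, F) f x)) :=
    HasMFDerivAt.comp x ((hC.1 _ hfx).mdifferentiableAt
      (h.codChart.open_source.mem_nhds hfx)).hasMFDerivAt hfs.hasMFDerivAt
  let p : E →L[ℝ] F := (ContinuousLinearMap.fst ℝ F _).comp h.equiv.toContinuousLinearMap
  have h2 : HasMFDerivAt 𝓘(ℝ, E) 𝓘(ℝ, F) (fun z => p (h.domChart z)) x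
      (p.comp (mfderiv 𝓘(ℝ, E) 𝓘(ℝ, E) h.domChart x)) :=
    HasMFDerivAt.comp x (p.hasMFDerivAt) ((hD.1 _ hx).mdifferentiableAt
      (h.domChart.open_source.mem_nhds hx)).hasMFDerivAt
  have h3 := hasMFDerivAt_unique h1 (h2.congr_of_eventuallyEq (by
    filter_upwards [h.domChart.open_source.mem_nhds hx] with z hz
    exact hw z hz))
  intro w
  obtain ⟨v, hv⟩ := (hD.mfderiv_surjective hx)
    (h.equiv.symm (mfderiv 𝓘(ℝ, F) 𝓘(ℝ, F) h.codChart (f x) w, 0))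
  refine ⟨v, hC.mfderiv_injective hfx ?_⟩
  refine (DFunLike.congr_fun h3 v).trans ?_
  change p (mfderiv 𝓘(ℝ, E) 𝓘(ℝ, E) h.domChart x v) = _
  refine (congrArg p hv).trans ?_
  change (h.equiv (h.equiv.symm _)).1 = _
  rw [h.equiv.apply_symm_apply]

end Submersion

/-! ### The moment map and the fundamental fields -/

section Moment

variable {E : Type*} [NormedAddCommGroup E] [NormedSpace ℝ E]
  {M : Type*} [TopologicalSpace M] [ChartedSpace E M] [IsManifold 𝓘(ℝ, E) ∞ M]
  {k : ℕ} [MulAction (Fin k → Circle) M]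
  {omega : ∀ x : M, FormAt (E := E) (Fin 2) ℝ x} {μ : M → Fin k → ℝ}

/-- The component of the moment map in the direction `η`. -/
def momentComp (μ : M → Fin k → ℝ) (η : Fin k → ℝ) (x : M) : ℝ := ∑ i, μ x i * η i

theorem IsHamiltonianTorusAction.contMDiff_momentComp (hμ : IsHamiltonianTorusAction omega μ)
    (η : Fin k → ℝ) : ContMDiff 𝓘(ℝ, E) 𝓘(ℝ, ℝ) ∞ (momentComp μ η) := by
  have h : ContDiff ℝ ∞ (fun y : Fin k → ℝ => ∑ i, y i * η i) := by fun_prop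
  exact h.contMDiff.comp hμ.smooth_moment

/-- Where the fundamental field vanishes, so does the differential of the component of `μ` along
`η`. Since `μ` is a submersion, some `v` has dμ(v) = `η`, and evaluating on it gives ∑ η_i² = 0.
Thus the action is locally free and flow boxes exist everywhere. -/
theorem IsHamiltonianTorusAction.eq_zero_of_fundField_eq_zero
    (hμ : IsHamiltonianTorusAction omega μ) (hs : IsSubmersion 𝓘(ℝ, E) 𝓘(ℝ, Fin k → ℝ) ∞ μ)
    (η : Fin k → ℝ) (q : M) (h : fundField (E := E) η q = (0 : E)) : η = 0 := by
  obtain ⟨v, hv⟩ := hs.surjective_mvfderiv q η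
  have h1 := hμ.moment η q v
  have h2 : omega q ![fundField η q, v] = 0 := by
    refine (omega q).map_coord_zero 0 ?_
    exact h
  rw [h2] at h1
  let p : (Fin k → ℝ) →L[ℝ] ℝ := ∑ i, η i • ContinuousLinearMap.proj i
  have hp : ∀ y, p y = ∑ i, y i * η i := by
    intro y
    simp [p, mul_comm]
  have h3 : HasMFDerivAt 𝓘(ℝ, E) 𝓘(ℝ, ℝ) (fun y => ∑ i, μ y i * η i) q
      (p.comp (mvfderiv 𝓘(ℝ, E) μ q)) := by
    have h4 : (fun y => ∑ i, μ y i * η i) = fun y => p (μ y) := by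
      funext y
      rw [hp]
    rw [h4]
    exact p.hasMFDerivAt.comp q (hμ.smooth_moment.mdifferentiableAt (by simp)).hasMFDerivAt
  have h4 : mvfderiv 𝓘(ℝ, E) (fun y => ∑ i, μ y i * η i) q v = p (mvfderiv 𝓘(ℝ, E) μ q v) := by
    rw [mvfderiv, h3.mfderiv]
    rfl
  rw [h4, hv, hp] at h1
  have h5 := (Finset.sum_eq_zero_iff_of_nonneg fun i _ => mul_self_nonneg (η i)).1 h1.symm
  funext i
  exact mul_self_eq_zero.1 (h5 i (Finset.mem_univ i))

theorem IsHamiltonianTorusAction.momentComp_flow (hμ : IsHamiltonianTorusAction omega μ)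
    (η η' : Fin k → ℝ) (t : ℝ) (x : M) : momentComp μ η (flow η' t x) = momentComp μ η x := by
  simp only [momentComp, flow, hμ.invariant]

variable {n : ℕ} {P : Polarization omega n}
  {EB : Type*} [NormedAddCommGroup EB] [NormedSpace ℝ EB]
  {B : Type*} [TopologicalSpace B] [ChartedSpace EB B] [IsManifold 𝓘(ℝ, EB) ∞ B]
  {pr : M → B} {φ : B → Fin k → ℝ}

theorem IsFibering.pr_flow (hP : IsFibering (EB := EB) P μ pr φ) (η : Fin k → ℝ) (t : ℝ) (x : M) :
    pr (flow η t x) = pr x :=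
  ((hP.quotient_eq_iff x _).2 ⟨_, rfl⟩).symm

theorem IsFibering.mfderiv_fundField (hP : IsFibering (EB := EB) P μ pr φ)
    (hT : SmoothTorusAction k E M) (η : Fin k → ℝ) (x : M) :
    mfderiv 𝓘(ℝ, E) 𝓘(ℝ, EB) pr x (fundField η x) = 0 := by
  have h0 : orbitCurve η x 0 = x := flow_zero η x
  have hd : MDifferentiableAt 𝓘(ℝ, ℝ) 𝓘(ℝ, E) (orbitCurve η x) 0 :=
    (contMDiff_orbit hT η x).mdifferentiableAt (by simp)
  have h1 : HasMFDerivAt 𝓘(ℝ, ℝ) 𝓘(ℝ, EB) (pr ∘ orbitCurve η x) 0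
      ((mfderiv 𝓘(ℝ, E) 𝓘(ℝ, EB) pr x).comp (mfderiv 𝓘(ℝ, ℝ) 𝓘(ℝ, E) (orbitCurve η x) 0)) := by
    refine HasMFDerivAt.comp (0 : ℝ) ?_ hd.hasMFDerivAt
    rw [h0]
    exact (hP.submersion_quotient.contMDiff.mdifferentiableAt (by simp)).hasMFDerivAt
  have h2 : pr ∘ orbitCurve η x = fun _ => pr x := funext fun t => hP.pr_flow η t x
  rw [h2] at h1
  exact DFunLike.congr_fun (hasMFDerivAt_unique h1 (hasMFDerivAt_const _ _)) (1 : ℝ)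

/-- Orbits are contracted by `pr`, and ker dπ is the real part of the polarization. Membership in P
makes differentiation along the orbits preserve the canonical bundle; membership in the conjugate of
P makes the orbits directions in which polarized sections are parallel. -/
theorem IsFibering.fundField_mem (hP : IsFibering (EB := EB) P μ pr φ)
    (hT : SmoothTorusAction k E M) (η : Fin k → ℝ) (x : M) :
    cvec (fundField η x) 0 ∈ P.space x ∧ cvec (fundField η x) 0 ∈ conjSpace (P.space x) :=
  (hP.real_part x _).2 (hP.mfderiv_fundField hT η x)

end Moment

/-! ### Cutoffs, extensions and locality of the connection -/

section Extension

variable {E : Type*} [NormedAddCommGroup E] [NormedSpace ℝ E] [FiniteDimensional ℝ E]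
  {M : Type*} [TopologicalSpace M] [T2Space M] [ChartedSpace E M] [IsManifold 𝓘(ℝ, E) ∞ M]

theorem exists_cutoff {O : Set M} {q : M} (hO : O ∈ 𝓝 q) :
    ∃ χ : M → ℂ, ContMDiff 𝓘(ℝ, E) 𝓘(ℝ, ℂ) ∞ χ ∧ HasCompactSupport χ ∧ tsupport χ ⊆ O ∧
      ∀ᶠ x in 𝓝 q, χ x = 1 := by
  obtain ⟨f, -, hf⟩ := (SmoothBumpFunction.nhds_basis_tsupport (I := 𝓘(ℝ, E)) q).mem_iff.1 hO
  have hs : tsupport (fun x => (f x : ℂ)) = tsupport f := by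
    simp only [tsupport]
    congr 1
    ext x
    simp
  refine ⟨fun x => (f x : ℂ), Complex.ofRealCLM.contMDiff.comp f.contMDiff, ?_, ?_, ?_⟩
  · rw [HasCompactSupport, hs]
    exact f.hasCompactSupport
  · rwa [hs]
  · filter_upwards [f.eventuallyEq_one] with x hx
    rw [hx]
    simp

theorem exists_contMDiff_extension {f : M → ℂ} {O : Set M} {q : M} (hO : IsOpen O) (hq : q ∈ O)
    (hf : ContMDiffOn 𝓘(ℝ, E) 𝓘(ℝ, ℂ) ∞ f O) :
    ∃ g : M → ℂ, ContMDiff 𝓘(ℝ, E) 𝓘(ℝ, ℂ) ∞ g ∧ g =ᶠ[𝓝 q] f ∧ ∀ x, f x = 0 → g x = 0 := by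
  obtain ⟨χ, hχ, -, hχO, hχ1⟩ := exists_cutoff (E := E) (hO.mem_nhds hq)
  refine ⟨fun x => χ x * f x, contMDiff_of_tsupport fun x hx => ?_, ?_, ?_⟩
  · have hx' : x ∈ O := hχO (tsupport_mul_subset_left hx)
    exact hχ.contMDiffAt.cmul (hf.contMDiffAt (hO.mem_nhds hx'))
  · filter_upwards [hχ1] with x hx
    rw [hx, one_mul]
  · intro x hx
    simp only [hx, mul_zero]

variable {L : M → Type*} [TopologicalSpace (TotalSpace ℂ L)]
  [∀ x, AddCommGroup (L x)] [∀ x, Module ℂ (L x)] [∀ x, TopologicalSpace (L x)]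
  [FiberBundle ℂ L] [VectorBundle ℂ ℂ L] [VectorBundle ℝ ℂ L]
  [ContMDiffVectorBundle ∞ ℂ L 𝓘(ℝ, E)]

theorem SmoothSectionOn.exists_extension {σ : ∀ x, L x} {O : Set M} {q : M} (hO : IsOpen O)
    (hq : q ∈ O) (hσ : SmoothSectionOn (E := E) σ O) :
    ∃ σ' : ∀ x, L x, SmoothSectionOn (E := E) σ' univ ∧ ∀ᶠ x in 𝓝 q, σ' x = σ x := by
  obtain ⟨χ, hχ, -, hχO, hχ1⟩ := exists_cutoff (E := E) (hO.mem_nhds hq)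
  refine ⟨fun x => χ x • σ x, fun x _ => ?_, ?_⟩
  · by_cases hx : x ∈ tsupport χ
    · have h1 : SmoothSectionOn (E := E) (fun x => χ x • σ x) O := hσ.smul hO hχ.contMDiffOn
      exact ((h1 x (hχO hx)).contMDiffAt (hO.mem_nhds (hχO hx))).contMDiffWithinAt
    · have h1 : ContMDiffAt 𝓘(ℝ, E) (𝓘(ℝ, E).prod 𝓘(ℝ, ℂ)) ∞
          (fun x => TotalSpace.mk' ℂ x (0 : L x)) x :=
        (contMDiff_zeroSection ℝ L).contMDiffAt
      refine (h1.congr_of_eventuallyEq ?_).contMDiffWithinAt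
      filter_upwards [(isClosed_tsupport χ).isOpen_compl.mem_nhds hx] with y hy
      simp only [image_eq_zero_of_notMem_tsupport hy, zero_smul]
  · filter_upwards [hχ1] with x hx
    rw [hx, one_smul]

variable [∀ x, IsTopologicalAddGroup (L x)] [∀ x, ContinuousSMul ℝ (L x)]
  {nabla : CovariantDerivative 𝓘(ℝ, E) ℂ L}
  {omega : ∀ x : M, FormAt (E := E) (Fin 2) ℝ x}

theorem nabla_congr {σ σ' : ∀ x, L x} {W : Set M} (hW : IsOpen W)
    (hσ : SmoothSectionOn (E := E) σ W) {x : M} (hx : x ∈ W) (h : ∀ᶠ y in 𝓝 x, σ' y = σ y) :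
    nabla σ' x = nabla σ x := by
  have h1 := hσ.mdifferentiableAt hW hx
  refine nabla.isCovariantDerivativeOnUniv.congr_of_eventuallyEq ?_ h1 univ_mem h
  refine h1.congr_of_eventuallyEq ?_
  filter_upwards [h] with y hy
  rw [hy]

/-- Covariant derivatives of smooth sections along smooth vector fields are smooth. -/
theorem IsPrequantum.smoothSectionOn (hL : IsPrequantum omega nabla) {σ : ∀ x, L x} {W : Set M}
    (hW : IsOpen W) (hσ : SmoothSectionOn (E := E) σ W) {V : ∀ x : M, TangentSpace 𝓘(ℝ, E) x}
    (hV : SmoothFieldOn V W) : SmoothSectionOn (E := E) (fun x => nabla σ x (V x)) W := by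
  intro x hx
  -- Smoothness of the connection is applied to a section smooth on all of M. The cutoff supplies
  -- one, and locality of `nabla` compares it with `σ` near `x`.
  obtain ⟨σ', hσ', hσσ'⟩ := hσ.exists_extension hW hx
  have h1 := hL.smooth.contMDiff.contMDiff (σ := σ') hσ'
  have h2 := ContMDiffAt.clm_bundle_apply ((h1 x (mem_univ x)).contMDiffAt univ_mem)
    ((hV x hx).contMDiffAt (hW.mem_nhds hx))
  refine (h2.congr_of_eventuallyEq ?_).contMDiffWithinAt
  filter_upwards [hσσ'.eventually_nhds, hW.mem_nhds hx] with y hy hyW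
  rw [← nabla_congr hW hσ hyW hy]

end Extension

/-! ### Functions and primitives along the flow in a box -/

section BoxAnalysis

variable {k : ℕ} {E : Type*} [NormedAddCommGroup E] [NormedSpace ℝ E] [FiniteDimensional ℝ E]
  {M : Type*} [TopologicalSpace M] [ChartedSpace E M]
  [MulAction (Fin k → Circle) M] [IsManifold 𝓘(ℝ, E) ∞ M]
  {F : Type*} [NormedAddCommGroup F] [NormedSpace ℝ F] {η : Fin k → ℝ}

/-- The derivative along the flow of `η` at time `0`. -/
theorem hasDerivAt_flow_zero (hT : SmoothTorusAction k E M) {f : M → F} {x : M}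
    (hf : MDifferentiableAt 𝓘(ℝ, E) 𝓘(ℝ, F) f x) :
    HasDerivAt (fun s => f (flow η s x)) (mvfderiv 𝓘(ℝ, E) f x (fundField η x)) 0 := by
  have h := hasDerivAt_flow (η := η) (x := x) (t := 0) hT (f := f) (by rwa [flow_zero])
  rwa [flow_zero] at h

theorem eventually_flow_mem (hT : SmoothTorusAction k E M) {O : Set M} {x : M} (hO : O ∈ 𝓝 x) :
    ∀ᶠ t in 𝓝 (0 : ℝ), flow η t x ∈ O := by
  have h : ContinuousAt (fun t => flow η t x) 0 :=
    (contMDiff_orbit hT η x).continuous.continuousAt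
  refine h.preimage_mem_nhds ?_
  rwa [flow_zero]

namespace FlowBox

variable {b : FlowBox E M η} {x : M}

theorem exists_restrict_subset (b : FlowBox E M η) {q : M} (hq : q ∈ b.chart.source) {O : Set M}
    (hO : O ∈ 𝓝 q) : ∃ (C : Set E) (hC : IsOpen C) (hC' : Convex ℝ C),
      q ∈ (b.restrict hC hC').chart.source ∧ (b.restrict hC hC').chart.source ⊆ O := by
  have h1 : b.chart.symm ⁻¹' O ∩ b.chart.target ∈ 𝓝 (b.chart q) := by
    refine inter_mem ?_ (b.chart.open_target.mem_nhds (b.chart.map_source hq))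
    refine (b.chart.symm.continuousAt (b.chart.map_source hq)).preimage_mem_nhds ?_
    rwa [b.chart.left_inv hq]
  obtain ⟨r, hr, hrO⟩ := Metric.mem_nhds_iff.1 h1
  refine ⟨Metric.ball (b.chart q) r, Metric.isOpen_ball, convex_ball _ _, ?_, ?_⟩
  · rw [restrict_source]
    exact ⟨hq, Metric.mem_ball_self hr⟩
  · rw [restrict_source]
    rintro y ⟨hy, hy'⟩
    have := (hrO hy').1
    rwa [mem_preimage, b.chart.left_inv hy] at this

theorem field_add (hx : x ∈ b.chart.source) (u v : E) :
    b.field (u + v) x = b.field u x + b.field v x := by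
  refine coord_injective hx ?_
  rw [coord_field hx, map_add, coord_field hx, coord_field hx]

theorem field_smul (hx : x ∈ b.chart.source) (r : ℝ) (v : E) :
    b.field (r • v) x = r • b.field v x := by
  refine coord_injective hx ?_
  rw [coord_field hx, map_smul, coord_field hx]

/-- The linear map `v ↦ b.field v x`. -/
def fieldMap (hx : x ∈ b.chart.source) : E →ₗ[ℝ] TangentSpace 𝓘(ℝ, E) x where
  toFun v := b.field v x
  map_add' := field_add hx
  map_smul' r v := field_smul hx r v

theorem smoothFieldOn_fundField (hT : SmoothTorusAction k E M) :
    SmoothFieldOn (E := E) (fundField η) b.chart.source := by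
  have hcs : CompleteSpace E := FiniteDimensional.complete ℝ E
  refine (b.smoothFieldOn_field b.dir).congr fun x hx => ?_
  rw [fundField_eq hT hx]

theorem mvfderiv_comp_chart (hx : x ∈ b.chart.source) {g : E → F}
    (hg : DifferentiableAt ℝ g (b.chart x)) (v : TangentSpace 𝓘(ℝ, E) x) :
    mvfderiv 𝓘(ℝ, E) (fun y => g (b.chart y)) x v = fderiv ℝ g (b.chart x) (b.coord x v) := by
  have h : HasMFDerivAt 𝓘(ℝ, E) 𝓘(ℝ, F) (fun y => g (b.chart y)) x
      ((fderiv ℝ g (b.chart x)).comp (mfderiv 𝓘(ℝ, E) 𝓘(ℝ, E) b.chart x)) :=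
    HasMFDerivAt.comp x hg.hasFDerivAt.hasMFDerivAt (mdifferentiableAt_chart hx).hasMFDerivAt
  rw [mvfderiv, h.mfderiv]
  rfl

theorem mvfderiv_eq_fderiv (hx : x ∈ b.chart.source) {f : M → F}
    (hf : ContMDiffAt 𝓘(ℝ, E) 𝓘(ℝ, F) ∞ f x) (v : TangentSpace 𝓘(ℝ, E) x) :
    mvfderiv 𝓘(ℝ, E) f x v
      = fderiv ℝ (fun y => f (b.chart.symm y)) (b.chart x) (b.coord x v) := by
  rw [← mvfderiv_comp_chart hx ((contDiffAt_rep hx hf).differentiableAt (by simp))]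
  have h : f =ᶠ[𝓝 x] fun y => f (b.chart.symm (b.chart y)) := by
    filter_upwards [source_mem_nhds hx] with y hy
    rw [b.chart.left_inv hy]
  rw [mvfderiv, mvfderiv, h.mfderiv_eq]
  rfl

theorem contMDiffOn_mvfderiv_field {f : M → F} {W : Set M} (hW : IsOpen W)
    (hWb : W ⊆ b.chart.source) (hf : ContMDiffOn 𝓘(ℝ, E) 𝓘(ℝ, F) ∞ f W) (v : E) :
    ContMDiffOn 𝓘(ℝ, E) 𝓘(ℝ, F) ∞ (fun x => mvfderiv 𝓘(ℝ, E) f x (b.field v x)) W := by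
  have hO : IsOpen (b.chart.target ∩ b.chart.symm ⁻¹' W) := b.chart.isOpen_inter_preimage_symm hW
  have h1 : ContDiffOn ℝ ∞ (fun y => f (b.chart.symm y)) (b.chart.target ∩ b.chart.symm ⁻¹' W) := by
    refine ContMDiffOn.contDiffOn ?_
    exact hf.comp (b.smooth_symm.mono inter_subset_left) fun y hy => hy.2
  have h2 : ContDiffOn ℝ ∞ (fun y => fderiv ℝ (fun y => f (b.chart.symm y)) y v)
      (b.chart.target ∩ b.chart.symm ⁻¹' W) :=
    (h1.fderiv_of_isOpen hO (m := ∞) (by simp)).clm_apply contDiffOn_const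
  refine (h2.contMDiffOn.comp (b.smooth.mono hWb) fun x hx => ?_).congr fun x hx => ?_
  · refine ⟨b.chart.map_source (hWb hx), ?_⟩
    rwa [mem_preimage, b.chart.left_inv (hWb hx)]
  · rw [mvfderiv_eq_fderiv (hWb hx) (hf.contMDiffAt (hW.mem_nhds hx)), coord_field (hWb hx)]
    rfl

theorem contMDiffOn_mvfderiv_fundField (hT : SmoothTorusAction k E M) {f : M → F} {W : Set M}
    (hW : IsOpen W) (hWb : W ⊆ b.chart.source) (hf : ContMDiffOn 𝓘(ℝ, E) 𝓘(ℝ, F) ∞ f W) :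
    ContMDiffOn 𝓘(ℝ, E) 𝓘(ℝ, F) ∞ (fun x => mvfderiv 𝓘(ℝ, E) f x (fundField η x)) W := by
  refine (contMDiffOn_mvfderiv_field hW hWb hf b.dir).congr fun x hx => ?_
  rw [fundField_eq hT (hWb hx)]

/-- Local solutions of `X A = a` for the fundamental vector field `X`. -/
theorem exists_primitive (hT : SmoothTorusAction k E M) {q : M} {W : Set M} (hW : IsOpen W)
    (hq : q ∈ W) (hWb : W ⊆ b.chart.source) {a : M → ℂ}
    (ha : ContMDiffOn 𝓘(ℝ, E) 𝓘(ℝ, ℂ) ∞ a W) (h0 : b.dir = 0 → ∀ x ∈ W, a x = 0) :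
    ∃ A : M → ℂ, ContMDiffOn 𝓘(ℝ, E) 𝓘(ℝ, ℂ) ∞ A b.chart.source ∧
      ∀ᶠ x in 𝓝 q, mvfderiv 𝓘(ℝ, E) A x (fundField η x) = a x := by
  by_cases hd : b.dir = 0
  · refine ⟨fun _ => 0, contMDiffOn_const, ?_⟩
    filter_upwards [hW.mem_nhds hq] with x hx
    rw [h0 hd x hx]
    have : mvfderiv 𝓘(ℝ, E) (fun _ : M => (0 : ℂ)) x = 0 := mvfderiv_const _
    rw [this]
    rfl
  have hO : IsOpen (b.chart.target ∩ b.chart.symm ⁻¹' W) := b.chart.isOpen_inter_preimage_symm hW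
  have h1 : ContMDiffOn 𝓘(ℝ, E) 𝓘(ℝ, ℂ) ∞ (fun y => a (b.chart.symm y))
      (b.chart.target ∩ b.chart.symm ⁻¹' W) :=
    ha.comp (b.smooth_symm.mono inter_subset_left) fun y hy => hy.2
  have hq' : b.chart q ∈ b.chart.target ∩ b.chart.symm ⁻¹' W := by
    refine ⟨b.chart.map_source (hWb hq), ?_⟩
    rwa [mem_preimage, b.chart.left_inv (hWb hq)]
  -- The directional primitive needs a function on all of `E`, so the coordinate expression of `a`
  -- is cut off. The price is that the equation holds only near `q`.
  obtain ⟨g, hg, hga, -⟩ := exists_contMDiff_extension hO hq' h1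
  obtain ⟨A, hA, hAg⟩ := exists_directional_primitive b.dir hg.contDiff (fun h => absurd h hd)
  refine ⟨fun x => A (b.chart x), hA.contMDiff.comp_contMDiffOn b.smooth, ?_⟩
  have h2 := (b.chart.continuousAt (hWb hq)).eventually hga
  filter_upwards [hW.mem_nhds hq, h2] with x hx hx2
  rw [mvfderiv_comp_chart (hWb hx) (hA.differentiable (by simp) _), fundField_eq hT (hWb hx),
    coord_field (hWb hx), hAg, hx2, b.chart.left_inv (hWb hx)]

end FlowBox

end BoxAnalysis

/-! ### Frames of L parallel along the orbits -/

section ParallelFrames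

variable {k : ℕ} {E : Type*} [NormedAddCommGroup E] [NormedSpace ℝ E] [FiniteDimensional ℝ E]
  {M : Type*} [TopologicalSpace M] [T2Space M] [ChartedSpace E M] [IsManifold 𝓘(ℝ, E) ∞ M]
  [MulAction (Fin k → Circle) M] {η : Fin k → ℝ}
  {L : M → Type*} [TopologicalSpace (TotalSpace ℂ L)]
  [∀ x, AddCommGroup (L x)] [∀ x, Module ℂ (L x)] [∀ x, TopologicalSpace (L x)]
  [∀ x, IsTopologicalAddGroup (L x)] [∀ x, ContinuousSMul ℝ (L x)]
  [FiberBundle ℂ L] [VectorBundle ℂ ℂ L] [VectorBundle ℝ ℂ L]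
  [ContMDiffVectorBundle ∞ ℂ L 𝓘(ℝ, E)]
  {nabla : CovariantDerivative 𝓘(ℝ, E) ℂ L}
  {omega : ∀ x : M, FormAt (E := E) (Fin 2) ℝ x}

theorem mvfderiv_cexp_neg {A : M → ℂ} {x : M} (hA : MDifferentiableAt 𝓘(ℝ, E) 𝓘(ℝ, ℂ) A x)
    (v : TangentSpace 𝓘(ℝ, E) x) :
    mvfderiv 𝓘(ℝ, E) (fun y => Complex.exp (-A y)) x v
      = -(mvfderiv 𝓘(ℝ, E) A x v) * Complex.exp (-A x) := by
  have h1 : HasFDerivAt (𝕜 := ℝ) (fun z : ℂ => Complex.exp (-z))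
      ((-Complex.exp (-A x)) • (1 : ℂ →L[ℝ] ℂ)) (A x) := by
    have h2 : HasDerivAt (fun z : ℂ => Complex.exp (-z)) (-Complex.exp (-A x)) (A x) := by
      simpa using (hasDerivAt_neg (A x)).cexp
    refine (h2.hasFDerivAt.restrictScalars ℝ).congr_fderiv ?_
    ext z
    simp [mul_comm]
  have h2 : HasMFDerivAt 𝓘(ℝ, E) 𝓘(ℝ, ℂ) (fun y => Complex.exp (-A y)) x
      (((-Complex.exp (-A x)) • (1 : ℂ →L[ℝ] ℂ)).comp (mfderiv 𝓘(ℝ, E) 𝓘(ℝ, ℂ) A x)) :=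
    HasMFDerivAt.comp (g := fun z : ℂ => Complex.exp (-z)) x h1.hasMFDerivAt hA.hasMFDerivAt
  rw [mvfderiv, h2.mfderiv]
  change -Complex.exp (-A x) * (mvfderiv 𝓘(ℝ, E) A x v) = _
  ring

theorem contMDiffOn_cexp_neg {A : M → ℂ} {W : Set M}
    (hA : ContMDiffOn 𝓘(ℝ, E) 𝓘(ℝ, ℂ) ∞ A W) :
    ContMDiffOn 𝓘(ℝ, E) 𝓘(ℝ, ℂ) ∞ (fun y => Complex.exp (-A y)) W := by
  have h : ContDiff ℝ ∞ (fun z : ℂ => Complex.exp (-z)) :=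
    (Complex.contDiff_exp (𝕜 := ℝ)).comp contDiff_neg
  exact h.contMDiff.comp_contMDiffOn hA

/-- Near every point there is a frame that is parallel along the orbits. -/
theorem exists_parallel_frame (hT : SmoothTorusAction k E M) (hL : IsPrequantum omega nabla)
    (b : FlowBox E M η) {q : M} (hq : q ∈ b.chart.source) :
    ∃ (W : Set M) (f : LineFrame E L W), IsOpen W ∧ q ∈ W ∧
      ∀ x ∈ W, nabla f.sec x (fundField η x) = 0 := by
  set W := b.chart.source ∩ (trivializationAt ℂ L q).baseSet with hWdef
  have hW : IsOpen W := b.chart.open_source.inter (trivializationAt ℂ L q).open_baseSet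
  have hqW : q ∈ W := ⟨hq, mem_baseSet_trivializationAt ℂ L q⟩
  let f₀ : LineFrame E L W := (LineFrame.ofTrivialization E L q).restrict inter_subset_right
  have hX : SmoothFieldOn (E := E) (fundField η) W :=
    (b.smoothFieldOn_fundField hT).mono inter_subset_left
  have hs := hL.smoothSectionOn hW f₀.smooth_sec hX
  have ha : ContMDiffOn 𝓘(ℝ, E) 𝓘(ℝ, ℂ) ∞
      (fun x => f₀.coef x (nabla f₀.sec x (fundField η x))) W := by
    simpa using f₀.smooth_coef W hW _ hs
  -- Multiplying the frame by exp(-A) lowers its connection coefficient along the orbits by X A, so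
  -- solving X A = a makes the frame parallel.
  obtain ⟨A, hA, hAa⟩ := b.exists_primitive hT hW hqW inter_subset_left ha (by
    intro hd x hx
    have h0 : fundField η x = (0 : TangentSpace 𝓘(ℝ, E) x) := by
      refine FlowBox.coord_injective hx.1 ?_
      rw [FlowBox.fundField_eq hT hx.1, FlowBox.coord_field hx.1, hd, map_zero]
    rw [h0, map_zero, map_zero])
  obtain ⟨W', hW'A, hW', hqW'⟩ := eventually_nhds_iff.1 hAa
  refine ⟨W ∩ W', (f₀.smul hW (fun x => Complex.exp (-A x))
    (contMDiffOn_cexp_neg (hA.mono inter_subset_left)) fun x _ => Complex.exp_ne_zero _).restrict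
    inter_subset_left, hW.inter hW', ⟨hqW, hqW'⟩, ?_⟩
  rintro x ⟨hxW, hxW'⟩
  have hAx : MDifferentiableAt 𝓘(ℝ, E) 𝓘(ℝ, ℂ) A x :=
    (hA.contMDiffAt (b.chart.open_source.mem_nhds hxW.1)).mdifferentiableAt (by simp)
  have hEx : MDifferentiableAt 𝓘(ℝ, E) 𝓘(ℝ, ℂ) (fun y => Complex.exp (-A y)) x :=
    ((contMDiffOn_cexp_neg hA).contMDiffAt
      (b.chart.open_source.mem_nhds hxW.1)).mdifferentiableAt (by simp)
  refine (hL.leibniz hW f₀.smooth_sec hxW hEx _).trans ?_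
  rw [mvfderiv_cexp_neg hAx, hW'A x hxW', ← f₀.coef_smul x hxW (nabla f₀.sec x (fundField η x)),
    smul_smul, ← add_smul, f₀.coef_smul x hxW]
  rw [show ∀ z w : ℂ, z * w + -w * z = 0 by intros; ring, zero_smul]

end ParallelFrames

/-! ### Pointwise linear algebra of the canonical bundle and its square roots -/

section CanonicalSpace

variable {E : Type*} [NormedAddCommGroup E] [NormedSpace ℝ E]
  {M : Type*} [TopologicalSpace M] [ChartedSpace E M] [IsManifold 𝓘(ℝ, E) ∞ M]
  {omega : ∀ x : M, FormAt (E := E) (Fin 2) ℝ x} {n : ℕ} {P : Polarization omega n}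
  {ι : Type*} [DecidableEq ι]

theorem conjMap_cvec (x : M) (u v : TangentSpace 𝓘(ℝ, E) x) :
    conjMap x (cvec u v) = cvec u (-v) := by
  simp [conjMap, cvec, TensorProduct.neg_tmul, TensorProduct.tmul_neg]

theorem conjMap_conjMap (x : M) (z : CTangent (E := E) x) : conjMap x (conjMap x z) = z := by
  induction z using TensorProduct.induction_on with
  | zero => simp
  | tmul a v => simp [conjMap]
  | add a b ha hb => rw [map_add, map_add, ha, hb]

theorem mem_conjSpace_cvec {x : M} {S : Submodule ℂ (CTangent (E := E) x)}
    {u v : TangentSpace 𝓘(ℝ, E) x} : cvec u v ∈ conjSpace S ↔ cvec u (-v) ∈ S := by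
  rw [← conjMap_cvec]
  rfl

/-- The complex linear extension of a complex valued real linear form. -/
def complexify {x : M} (f : TangentSpace 𝓘(ℝ, E) x →ₗ[ℝ] ℂ) : CTangent (E := E) x →ₗ[ℂ] ℂ :=
  TensorProduct.AlgebraTensorModule.lift
    (LinearMap.toSpanSingleton ℂ (TangentSpace 𝓘(ℝ, E) x →ₗ[ℝ] ℂ) f)

theorem complexify_cvec {x : M} (f : TangentSpace 𝓘(ℝ, E) x →ₗ[ℝ] ℂ)
    (u v : TangentSpace 𝓘(ℝ, E) x) : complexify f (cvec u v) = f u + Complex.I * f v := by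
  simp [complexify, cvec]

/-- Contraction is complex linear in the contracted vector, so generators suffice. The minus sign
appears because the generators span P, whereas the defining condition concerns its conjugate. -/
theorem mem_canonicalSpace_of_span {x : M} {J : Type*} {X Y : J → TangentSpace 𝓘(ℝ, E) x}
    (hs : P.space x = Submodule.span ℂ (range fun j => cvec (X j) (Y j)))
    {α : FormAt (E := E) ι ℂ x}
    (h : ∀ j (w : ι → TangentSpace 𝓘(ℝ, E) x) i,
      α (Function.update w i (X j)) - Complex.I * α (Function.update w i (Y j)) = 0) :
    α ∈ canonicalSpace P ι x := by
  intro u v huv w i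
  set f : TangentSpace 𝓘(ℝ, E) x →ₗ[ℝ] ℂ := α.toMultilinearMap.toLinearMap w i with hf
  have hfu : ∀ u, f u = α (Function.update w i u) := fun u => rfl
  rw [← hfu, ← hfu, ← complexify_cvec]
  have hle : P.space x ≤ conjSpace (LinearMap.ker (complexify f)) := by
    rw [hs, Submodule.span_le]
    rintro _ ⟨j, rfl⟩
    change cvec (X j) (Y j) ∈ conjSpace _
    rw [mem_conjSpace_cvec, LinearMap.mem_ker, complexify_cvec, map_neg, hfu, hfu]
    linear_combination h j w i
  have h1 : conjMap x (conjMap x (cvec u v)) ∈ LinearMap.ker (complexify f) := hle huv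
  rwa [conjMap_conjMap] at h1

variable (κ : M → Type*) [TopologicalSpace (TotalSpace ℂ κ)]
  [∀ x, AddCommGroup (κ x)] [∀ x, Module ℂ (κ x)] [∀ x, TopologicalSpace (κ x)]
  [FiberBundle ℂ κ]
variable {κ} (h : HalfForm κ P ι)

theorem HalfForm.sq_smul {x : M} (z : ℂ) (a : κ x) : h.sq (z • a) = (z * z) • h.sq a := by
  rw [HalfForm.sq, HalfForm.sq, TensorProduct.smul_tmul_smul, map_smul]
  rfl

/-- The coordinate functional of the frame, applied to both tensor factors, takes the value 1 on the
square of the frame in κ ⊗ κ. -/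
theorem HalfForm.sq_ne_zero {W : Set M} (f : LineFrame E κ W) {x : M} (hx : x ∈ W) :
    h.sq (f.sec x) ≠ 0 := by
  intro h0
  have h1 : h.iso x (f.sec x ⊗ₜ f.sec x) = 0 := Subtype.ext h0
  have h2 : f.sec x ⊗ₜ[ℂ] f.sec x = 0 := (h.iso x).map_eq_zero_iff.1 h1
  have h3 := congrArg (LinearMap.mul' ℂ ℂ ∘ₗ TensorProduct.map (f.coef x) (f.coef x)) h2
  simp [f.coef_sec x hx] at h3

/-- Since κ has rank one, so does κ ⊗ κ, and hence each fibre of the canonical bundle is a line.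
This lets a derivative of the square be compared with the square itself. -/
theorem HalfForm.exists_eq_smul_sq {W : Set M} (f : LineFrame E κ W) {x : M} (hx : x ∈ W)
    {α : FormAt (E := E) ι ℂ x} (hα : α ∈ canonicalSpace P ι x) :
    ∃ γ : ℂ, α = γ • h.sq (f.sec x) := by
  have key : ∀ z : κ x ⊗[ℂ] κ x, ∃ γ : ℂ, z = γ • (f.sec x ⊗ₜ[ℂ] f.sec x) := by
    intro z
    induction z using TensorProduct.induction_on with
    | zero => exact ⟨0, (zero_smul _ _).symm⟩
    | tmul a b =>
      refine ⟨f.coef x a * f.coef x b, ?_⟩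
      conv_lhs => rw [← f.coef_smul x hx a, ← f.coef_smul x hx b]
      rw [TensorProduct.smul_tmul_smul]
    | add a b ha hb =>
      obtain ⟨γ, rfl⟩ := ha
      obtain ⟨δ, rfl⟩ := hb
      exact ⟨γ + δ, (add_smul _ _ _).symm⟩
  obtain ⟨γ, hγ⟩ := key ((h.iso x).symm ⟨α, hα⟩)
  refine ⟨γ, ?_⟩
  have h1 := congrArg (h.iso x) hγ
  rw [LinearEquiv.apply_symm_apply, map_smul] at h1
  exact congrArg Subtype.val h1

end CanonicalSpace

/-! ### Differentiating forms along the flow -/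

section InvariantHalfForms

variable {k : ℕ} {E : Type*} [NormedAddCommGroup E] [NormedSpace ℝ E] [FiniteDimensional ℝ E]
  {M : Type*} [TopologicalSpace M] [T2Space M] [ChartedSpace E M] [IsManifold 𝓘(ℝ, E) ∞ M]
  [MulAction (Fin k → Circle) M] {η : Fin k → ℝ}
  {omega : ∀ x : M, FormAt (E := E) (Fin 2) ℝ x} {n : ℕ} {P : Polarization omega n}
  {ι : Type*} [dι : DecidableEq ι] [Fintype ι]

namespace FlowBox

variable (b : FlowBox E M η)

/-- The components of a form in a flow box. -/
def component (α : ∀ x : M, FormAt (E := E) ι ℂ x) (v : ι → E) (x : M) : ℂ :=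
  α x (fun i => b.field (v i) x)

variable {b}

theorem component_update {α : ∀ x : M, FormAt (E := E) ι ℂ x} {x : M} (v : ι → E) (i : ι) (u : E) :
    b.component α (Function.update v i u) x
      = α x (Function.update (fun j => b.field (v j) x) i (b.field u x)) := by
  rw [component]
  congr 1
  funext j
  rcases eq_or_ne j i with rfl | hj
  · simp
  · simp [hj]

theorem component_coord {α : ∀ x : M, FormAt (E := E) ι ℂ x} {x : M} (hx : x ∈ b.chart.source)
    (w : ι → TangentSpace 𝓘(ℝ, E) x) : b.component α (fun i => b.coord x (w i)) x = α x w :=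
  congrArg (α x) (funext fun i => field_coord hx (w i))

theorem contMDiffOn_component {α : ∀ x : M, FormAt (E := E) ι ℂ x} {W : Set M} (hW : IsOpen W)
    (hα : SmoothFormOn α W) (hWb : W ⊆ b.chart.source) (v : ι → E) :
    ContMDiffOn 𝓘(ℝ, E) 𝓘(ℝ, ℂ) ∞ (b.component α v) W := by
  have hcs : CompleteSpace E := FiniteDimensional.complete ℝ E
  exact hα W hW subset_rfl _ fun i => (b.smoothFieldOn_field (v i)).mono hWb

/-- The derivative of a form along the flow, in a flow box. -/
theorem exists_derivForm {α : ∀ x : M, FormAt (E := E) ι ℂ x} {x : M}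
    (hx : x ∈ b.chart.source)
    (hα : ∀ v : ι → E, MDifferentiableAt 𝓘(ℝ, E) 𝓘(ℝ, ℂ) (b.component α v) x) :
    ∃ β : FormAt (E := E) ι ℂ x, ∀ w : ι → TangentSpace 𝓘(ℝ, E) x,
      β w = mvfderiv 𝓘(ℝ, E) (b.component α fun i => b.coord x (w i)) x (fundField η x) := by
  have hupd : ∀ (w : ι → TangentSpace 𝓘(ℝ, E) x) (i : ι) (u : TangentSpace 𝓘(ℝ, E) x),
      (fun j => b.coord x (Function.update w i u j))
        = Function.update (fun j => b.coord x (w j)) i (b.coord x u) := by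
    intro w i u
    funext j
    rcases eq_or_ne j i with rfl | hj
    · simp
    · simp [hj]
  have hadd : ∀ (v : ι → E) (i : ι) (u u' : E),
      b.component α (Function.update v i (u + u')) =ᶠ[𝓝 x]
        b.component α (Function.update v i u) + b.component α (Function.update v i u') := by
    intro v i u u'
    filter_upwards [source_mem_nhds hx] with y hy
    rw [Pi.add_apply, component_update, component_update, component_update, field_add hy,
      AlternatingMap.map_update_add]
  have hsmul : ∀ (v : ι → E) (i : ι) (r : ℝ) (u : E),
      b.component α (Function.update v i (r • u)) =ᶠ[𝓝 x]
        r • b.component α (Function.update v i u) := by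
    intro v i r u
    filter_upwards [source_mem_nhds hx] with y hy
    rw [Pi.smul_apply, component_update, component_update, field_smul hy,
      AlternatingMap.map_update_smul]
  -- Fields with constant coordinates in the box are invariant under the flow, so differentiating
  -- the components gives the Lie derivative of `α`.
  refine ⟨{
    toFun := fun w =>
      mvfderiv 𝓘(ℝ, E) (b.component α fun i => b.coord x (w i)) x (fundField η x)
    map_update_add' := ?_
    map_update_smul' := ?_
    map_eq_zero_of_eq' := ?_ }, fun w => rfl⟩
  · intro hd w i u u'
    obtain rfl : dι = hd := Subsingleton.elim _ _
    rw [hupd, hupd, hupd, map_add, mvfderiv, (hadd _ _ _ _).mfderiv_eq]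
    have h1 := ((hα (Function.update (fun j => b.coord x (w j)) i (b.coord x u))).hasMFDerivAt.add
      (hα (Function.update (fun j => b.coord x (w j)) i (b.coord x u'))).hasMFDerivAt).mfderiv
    exact DFunLike.congr_fun h1 (fundField η x)
  · intro hd w i r u
    obtain rfl : dι = hd := Subsingleton.elim _ _
    rw [hupd, hupd, map_smul, mvfderiv, (hsmul _ _ _ _).mfderiv_eq]
    have h1 := ((hα (Function.update (fun j => b.coord x (w j)) i
      (b.coord x u))).hasMFDerivAt.const_smul r).mfderiv
    exact DFunLike.congr_fun h1 (fundField η x)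
  · intro w i j hij hne
    have h0 : b.component α (fun i => b.coord x (w i)) = fun _ => 0 := by
      funext y
      exact (α y).map_eq_zero_of_eq _ (by simp only [hij]) hne
    change mvfderiv 𝓘(ℝ, E) _ x _ = 0
    rw [h0]
    have : mvfderiv 𝓘(ℝ, E) (fun _ : M => (0 : ℂ)) x = 0 := mvfderiv_const _
    rw [this]
    rfl

/-- The product rule for the contraction of a form with a smooth vector field. -/
theorem hasDerivAt_contract (hT : SmoothTorusAction k E M) {α : ∀ x : M, FormAt (E := E) ι ℂ x}
    {x : M} (hx : x ∈ b.chart.source)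
    (hα : ∀ v : ι → E, MDifferentiableAt 𝓘(ℝ, E) 𝓘(ℝ, ℂ) (b.component α v) x)
    {W : Set M} (hW : IsOpen W) (hxW : x ∈ W) {U : ∀ x : M, TangentSpace 𝓘(ℝ, E) x}
    (hU : SmoothFieldOn U W) (v : ι → E) (i : ι) :
    HasDerivAt (fun t : ℝ => b.component α
        (Function.update v i (b.coord (flow η t x) (U (flow η t x)))) (flow η t x))
      (mvfderiv 𝓘(ℝ, E) (b.component α (Function.update v i (b.coord x (U x)))) x (fundField η x)
        + b.component α (Function.update v i
            (b.coord x (VectorField.mlieBracket 𝓘(ℝ, E) (fundField η) U x))) x) 0 := by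
  -- Differentiability is known only for components on constant vectors, so the moving coordinates
  -- of `U` are expanded in a fixed basis.
  set B := Module.finBasis ℝ E
  have hlin : ∀ y ∈ b.chart.source, ∀ u : E, b.component α (Function.update v i u) y
      = ∑ j, (B.repr u j : ℂ) * b.component α (Function.update v i (B j)) y := by
    intro y hy u
    simp only [component_update]
    have h1 : b.field u y = ∑ j, B.repr u j • b.field (B j) y := by
      conv_lhs => rw [← B.sum_repr u]
      have h2 := map_sum (fieldMap hy) (fun j => B.repr u j • B j) Finset.univ
      refine h2.trans (Finset.sum_congr rfl fun j _ => field_smul hy _ _)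
    rw [h1]
    have h3 := map_sum ((α y).toMultilinearMap.toLinearMap (fun j => b.field (v j) y) i)
      (fun j => B.repr u j • b.field (B j) y) Finset.univ
    refine h3.trans (Finset.sum_congr rfl fun j _ => ?_)
    rw [map_smul, Complex.real_smul]
    rfl
  have hs : MDifferentiableAt 𝓘(ℝ, E) 𝓘(ℝ, E) (fun y => b.coord y (U y)) x :=
    ((contMDiffOn_coord hW hU).contMDiffAt
      ((b.chart.open_source.inter hW).mem_nhds ⟨hx, hxW⟩)).mdifferentiableAt (by simp)
  have hd1 := hasDerivAt_flow_zero (η := η) hT hs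
  rw [← coord_mlieBracket hT hW hU hx hxW] at hd1
  have hd2 : ∀ j, HasDerivAt (fun t : ℝ =>
      ((B.repr (b.coord (flow η t x) (U (flow η t x))) j : ℝ) : ℂ))
      ((B.repr (b.coord x (VectorField.mlieBracket 𝓘(ℝ, E) (fundField η) U x)) j : ℝ) : ℂ) 0 := by
    intro j
    have h1 := ((B.coord j).toContinuousLinearMap.hasFDerivAt).comp_hasDerivAt (0 : ℝ) hd1
    exact h1.ofReal_comp
  have hd3 : ∀ j, HasDerivAt (fun t : ℝ => b.component α (Function.update v i (B j)) (flow η t x))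
      (mvfderiv 𝓘(ℝ, E) (b.component α (Function.update v i (B j))) x (fundField η x)) 0 :=
    fun j => hasDerivAt_flow_zero hT (hα _)
  have hd4 := HasDerivAt.fun_sum (u := Finset.univ) fun j _ => (hd2 j).mul (hd3 j)
  have heq : (fun t : ℝ => b.component α
        (Function.update v i (b.coord (flow η t x) (U (flow η t x)))) (flow η t x)) =ᶠ[𝓝 0]
      fun t : ℝ => ∑ j, ((B.repr (b.coord (flow η t x) (U (flow η t x))) j : ℝ) : ℂ)
        * b.component α (Function.update v i (B j)) (flow η t x) := by
    filter_upwards [eventually_flow_mem (η := η) hT (source_mem_nhds hx)] with t ht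
    exact hlin _ ht _
  refine (hd4.congr_of_eventuallyEq heq).congr_deriv ?_
  rw [flow_zero, Finset.sum_add_distrib, add_comm, hlin x hx]
  congr 1
  -- The remaining sum is the derivative of the component with the coordinates of `U x` frozen;
  -- uniqueness of derivatives identifies the two.
  have h5 := HasDerivAt.fun_sum (u := Finset.univ) fun j _ =>
    (hd3 j).const_mul ((B.repr (b.coord x (U x)) j : ℝ) : ℂ)
  have h6 := hasDerivAt_flow_zero (η := η) hT (hα (Function.update v i (b.coord x (U x))))
  refine (h5.congr_of_eventuallyEq ?_).unique h6
  filter_upwards [eventually_flow_mem (η := η) hT (source_mem_nhds hx)] with t ht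
  exact hlin _ ht _

end FlowBox

end InvariantHalfForms

/-! ### Frames of κ with invariant square -/

section InvariantFrames

variable {k : ℕ} {E : Type*} [NormedAddCommGroup E] [NormedSpace ℝ E] [FiniteDimensional ℝ E]
  {M : Type*} [TopologicalSpace M] [T2Space M] [ChartedSpace E M] [IsManifold 𝓘(ℝ, E) ∞ M]
  [MulAction (Fin k → Circle) M] {η : Fin k → ℝ}
  {omega : ∀ x : M, FormAt (E := E) (Fin 2) ℝ x} {n : ℕ} {P : Polarization omega n}
  {ι : Type*} [dι : DecidableEq ι] [Fintype ι]

theorem canonicalSpace_apply {x : M} {α : FormAt (E := E) ι ℂ x} (hα : α ∈ canonicalSpace P ι x)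
    {u v : TangentSpace 𝓘(ℝ, E) x} (huv : cvec u v ∈ P.space x)
    (w : ι → TangentSpace 𝓘(ℝ, E) x) (i : ι) :
    α (Function.update w i u) - Complex.I * α (Function.update w i v) = 0 := by
  have h := hα u (-v) (by rwa [mem_conjSpace_cvec, neg_neg]) w i
  have h1 : α (Function.update w i (-v)) = -α (Function.update w i v) :=
    map_neg (α.toMultilinearMap.toLinearMap w i) v
  rw [h1] at h
  linear_combination h

theorem smoothFieldOn_zero (W : Set M) :
    SmoothFieldOn (E := E) (fun x : M => (0 : TangentSpace 𝓘(ℝ, E) x)) W :=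
  (contMDiff_zeroSection ℝ (fun x : M => TangentSpace 𝓘(ℝ, E) x)).contMDiffOn

theorem mlieBracket_zero_left' (V : ∀ x : M, TangentSpace 𝓘(ℝ, E) x) (x : M) :
    VectorField.mlieBracket 𝓘(ℝ, E) (fun x : M => (0 : TangentSpace 𝓘(ℝ, E) x)) V x = 0 := by
  exact congrFun (VectorField.mlieBracket_zero_left (I := 𝓘(ℝ, E)) (W := V)) x

/-- The derivative of a section of the canonical bundle along the torus action is again a section
of the canonical bundle. -/
theorem derivForm_mem_canonicalSpace (hT : SmoothTorusAction k E M) {b : FlowBox E M η}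
    (hX : ∀ y, cvec (fundField η y) 0 ∈ P.space y)
    {α : ∀ x : M, FormAt (E := E) ι ℂ x} {W : Set M} (hW : IsOpen W) {x : M} (hxW : x ∈ W)
    (hx : x ∈ b.chart.source)
    (hα : ∀ v : ι → E, MDifferentiableAt 𝓘(ℝ, E) 𝓘(ℝ, ℂ) (b.component α v) x)
    (hαW : ∀ y ∈ W, α y ∈ canonicalSpace P ι y) {β : FormAt (E := E) ι ℂ x}
    (hβ : ∀ w : ι → TangentSpace 𝓘(ℝ, E) x,
      β w = mvfderiv 𝓘(ℝ, E) (b.component α fun i => b.coord x (w i)) x (fundField η x)) :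
    β ∈ canonicalSpace P ι x := by
  obtain ⟨W', hW', hxW', X, Y, hXY, hs⟩ := P.smooth x
  refine mem_canonicalSpace_of_span (hs x hxW') fun j w i => ?_
  set v : ι → E := fun i => b.coord x (w i) with hv
  have hupd : ∀ u : TangentSpace 𝓘(ℝ, E) x,
      (fun l => b.coord x (Function.update w i u l)) = Function.update v i (b.coord x u) := by
    intro u
    funext l
    rcases eq_or_ne l i with rfl | hl
    · simp
    · simp [hl, hv]
  have hmem : ∀ y ∈ W', cvec (X j y) (Y j y) ∈ P.space y := fun y hy => by
    rw [hs y hy]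
    exact Submodule.subset_span ⟨j, rfl⟩
  have h1 := FlowBox.hasDerivAt_contract hT hx hα hW' hxW' (hXY j).1 v i
  have h2 := FlowBox.hasDerivAt_contract hT hx hα hW' hxW' (hXY j).2 v i
  have h3 := h1.sub (h2.const_mul Complex.I)
  have h4 : HasDerivAt (fun _ : ℝ => (0 : ℂ)) 0 0 := hasDerivAt_const 0 0
  have hO : W ∩ W' ∩ b.chart.source ∈ 𝓝 x :=
    ((hW.inter hW').inter b.chart.open_source).mem_nhds ⟨⟨hxW, hxW'⟩, hx⟩
  -- The contraction of `α` with the conjugate of `X j + i Y j` vanishes along the orbit, hence so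
  -- does its derivative. By the product rule the contraction of `β` is minus the contraction of `α`
  -- with the bracket.
  have h5 := (h4.congr_of_eventuallyEq (by
    filter_upwards [eventually_flow_mem (η := η) hT hO] with t ht
    rw [Pi.sub_apply, FlowBox.component_update, FlowBox.component_update,
      FlowBox.field_coord ht.2, FlowBox.field_coord ht.2]
    exact canonicalSpace_apply (hαW _ ht.1.1) (hmem _ ht.1.2) _ i)).unique h3
  -- The fundamental field, taken with imaginary part zero, is a section of P, so involutivity puts
  -- the bracket in P and `α` annihilates its conjugate.
  have h6 := P.involutive (W' ∩ b.chart.source) (hW'.inter b.chart.open_source)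
    (fundField η) (fun x => 0) (X j) (Y j)
    ((b.smoothFieldOn_fundField hT).mono inter_subset_right) (smoothFieldOn_zero _)
    ((hXY j).1.mono inter_subset_left) ((hXY j).2.mono inter_subset_left)
    (fun y _ => hX y) (fun y hy => hmem y hy.1) x ⟨hxW', hx⟩
  rw [mlieBracket_zero_left', mlieBracket_zero_left', sub_zero, add_zero] at h6
  have h7 := canonicalSpace_apply (hαW x hxW) h6 w i
  rw [← FlowBox.component_coord (b := b) hx, ← FlowBox.component_coord (b := b) hx,
    hupd, hupd] at h7
  rw [hβ, hβ, hupd, hupd]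
  linear_combination -h5 - h7

variable {κ : M → Type*} [TopologicalSpace (TotalSpace ℂ κ)]
  [∀ x, AddCommGroup (κ x)] [∀ x, Module ℂ (κ x)] [∀ x, TopologicalSpace (κ x)]
  [FiberBundle ℂ κ] [VectorBundle ℂ ℂ κ] [VectorBundle ℝ ℂ κ]
  [ContMDiffVectorBundle ∞ ℂ κ 𝓘(ℝ, E)]

/-- Near every point there is a half-form whose square is invariant under the torus action. -/
theorem exists_invariant_frame (hT : SmoothTorusAction k E M)
    (hX : ∀ y, cvec (fundField η y) 0 ∈ P.space y) (h : HalfForm κ P ι)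
    (b : FlowBox E M η) {q : M} (hq : q ∈ b.chart.source) :
    ∃ (W : Set M) (f : LineFrame E κ W), IsOpen W ∧ q ∈ W ∧ W ⊆ b.chart.source ∧
      ∀ x ∈ W, ∀ v : ι → E,
        mvfderiv 𝓘(ℝ, E) (b.component (fun y => h.sq (f.sec y)) v) x (fundField η x) = 0 := by
  set W₀ := b.chart.source ∩ (trivializationAt ℂ κ q).baseSet with hW₀def
  have hW₀ : IsOpen W₀ := b.chart.open_source.inter (trivializationAt ℂ κ q).open_baseSet
  have hqW₀ : q ∈ W₀ := ⟨hq, mem_baseSet_trivializationAt ℂ κ q⟩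
  let f₀ : LineFrame E κ W₀ := (LineFrame.ofTrivialization E κ q).restrict inter_subset_right
  set C := fun v => b.component (fun y => h.sq (f₀.sec y)) v with hC
  have hCs : ∀ v, ContMDiffOn 𝓘(ℝ, E) 𝓘(ℝ, ℂ) ∞ (C v) W₀ := fun v =>
    FlowBox.contMDiffOn_component hW₀ (h.smooth W₀ hW₀ _ f₀.smooth_sec) inter_subset_left v
  have hCd : ∀ x ∈ W₀, ∀ v, MDifferentiableAt 𝓘(ℝ, E) 𝓘(ℝ, ℂ) (C v) x := fun x hx v =>
    ((hCs v).contMDiffAt (hW₀.mem_nhds hx)).mdifferentiableAt (by simp)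
  obtain ⟨v₀, hv₀⟩ : ∃ v, C v q ≠ 0 := by
    by_contra! hc
    refine h.sq_ne_zero f₀ hqW₀ ?_
    ext w
    rw [← FlowBox.component_coord (b := b) (α := fun y => h.sq (f₀.sec y)) hq]
    exact hc _
  set W := W₀ ∩ C v₀ ⁻¹' {0}ᶜ with hWdef
  have hW : IsOpen W := (hCs v₀).continuousOn.isOpen_inter_preimage hW₀ isOpen_compl_singleton
  have hqW : q ∈ W := ⟨hqW₀, hv₀⟩
  -- The derivative of the square stays in the canonical bundle, a line, so it is a multiple of the
  -- square. One nonvanishing component determines the factor, and all components share it.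
  set γ : M → ℂ := fun x => mvfderiv 𝓘(ℝ, E) (C v₀) x (fundField η x) * (C v₀ x)⁻¹ with hγ
  have hprop : ∀ x ∈ W, ∀ v, mvfderiv 𝓘(ℝ, E) (C v) x (fundField η x) = γ x * C v x := by
    intro x hx v
    obtain ⟨β, hβ⟩ := FlowBox.exists_derivForm (α := fun y => h.sq (f₀.sec y)) hx.1.1 (hCd x hx.1)
    obtain ⟨g, hg⟩ := h.exists_eq_smul_sq f₀ hx.1
      (derivForm_mem_canonicalSpace hT hX hW₀ hx.1 hx.1.1 (hCd x hx.1)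
        (fun y _ => (h.iso y _).2) hβ)
    have h1 : ∀ v, mvfderiv 𝓘(ℝ, E) (C v) x (fundField η x) = g * C v x := by
      intro v
      have h2 := hβ fun i => b.field (v i) x
      simp only [FlowBox.coord_field hx.1.1] at h2
      refine h2.symm.trans ?_
      rw [hg]
      rfl
    rw [hγ]
    simp only
    rw [h1 v₀, mul_assoc g, mul_inv_cancel₀ hx.2, mul_one, h1]
  -- The factor 1/2 is there because rescaling the frame by exp(-B) rescales its square by exp(-2B).
  have hγs : ContMDiffOn 𝓘(ℝ, E) 𝓘(ℝ, ℂ) ∞ (fun x => γ x * (1 / 2)) W := by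
    have h1 := FlowBox.contMDiffOn_mvfderiv_fundField hT hW
      (inter_subset_left.trans inter_subset_left) ((hCs v₀).mono inter_subset_left)
    exact (h1.cmul (((hCs v₀).mono inter_subset_left).cinv fun x hx => hx.2)).cmul
      contMDiffOn_const
  obtain ⟨B, hB, hBγ⟩ := b.exists_primitive hT hW hqW (inter_subset_left.trans inter_subset_left)
    hγs (by
      intro hd x hx
      have h0 : fundField η x = (0 : TangentSpace 𝓘(ℝ, E) x) := by
        refine FlowBox.coord_injective hx.1.1 ?_
        rw [FlowBox.fundField_eq hT hx.1.1, FlowBox.coord_field hx.1.1, hd, map_zero]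
      rw [hγ]
      simp only
      rw [h0, map_zero, zero_mul, zero_mul])
  obtain ⟨W', hW'B, hW', hqW'⟩ := eventually_nhds_iff.1 hBγ
  refine ⟨W ∩ W', ((f₀.restrict inter_subset_left).smul hW (fun x => Complex.exp (-B x))
    (contMDiffOn_cexp_neg (hB.mono (inter_subset_left.trans inter_subset_left)))
    fun x _ => Complex.exp_ne_zero _).restrict inter_subset_left, hW.inter hW', ⟨hqW, hqW'⟩,
    inter_subset_left.trans (inter_subset_left.trans inter_subset_left), ?_⟩
  rintro x ⟨hxW, hxW'⟩ v
  have hBx : MDifferentiableAt 𝓘(ℝ, E) 𝓘(ℝ, ℂ) B x :=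
    (hB.contMDiffAt (b.chart.open_source.mem_nhds hxW.1.1)).mdifferentiableAt (by simp)
  have hEx : MDifferentiableAt 𝓘(ℝ, E) 𝓘(ℝ, ℂ) (fun y => Complex.exp (-B y)) x :=
    ((contMDiffOn_cexp_neg hB).contMDiffAt
      (b.chart.open_source.mem_nhds hxW.1.1)).mdifferentiableAt (by simp)
  have heq : b.component (fun y => h.sq (Complex.exp (-B y) • f₀.sec y)) v
      = fun y => (Complex.exp (-B y) * Complex.exp (-B y)) * C v y := by
    funext y
    rw [FlowBox.component, h.sq_smul]
    rfl
  have h1 := hasDerivAt_flow_zero (η := η) hT hEx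
  have h2 := hasDerivAt_flow_zero (η := η) hT (hCd x hxW.1 v)
  have h3 := (h1.mul h1).mul h2
  have hd : MDifferentiableAt 𝓘(ℝ, E) 𝓘(ℝ, ℂ)
      (b.component (fun y => h.sq (Complex.exp (-B y) • f₀.sec y)) v) x := by
    rw [heq]
    have h4 := ((contMDiffOn_cexp_neg hB).contMDiffAt (b.chart.open_source.mem_nhds hxW.1.1))
    exact ((h4.cmul h4).cmul ((hCs v).contMDiffAt (hW₀.mem_nhds hxW.1))).mdifferentiableAt
      (by simp)
  have h4 := hasDerivAt_flow_zero (η := η) hT hd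
  rw [heq] at h4
  have h5 := h4.unique h3
  change mvfderiv 𝓘(ℝ, E) (b.component (fun y => h.sq (Complex.exp (-B y) • f₀.sec y)) v) x _ = 0
  rw [heq, h5]
  simp only [Pi.mul_apply, flow_zero]
  rw [mvfderiv_cexp_neg hBx, hW'B x hxW', hprop x hxW]
  ring

end InvariantFrames

/-! ### From infinitesimal to finite invariance -/

section FlowInvariance

variable {k : ℕ} {E : Type*} [NormedAddCommGroup E] [NormedSpace ℝ E] [FiniteDimensional ℝ E]
  {M : Type*} [TopologicalSpace M] [ChartedSpace E M] [IsManifold 𝓘(ℝ, E) ∞ M]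
  [MulAction (Fin k → Circle) M] {η : Fin k → ℝ}
  {F : Type*} [NormedAddCommGroup F] [NormedSpace ℝ F]

namespace FlowBox

variable {b : FlowBox E M η} {x : M}

theorem isOpen_times (b : FlowBox E M η) (y : E) :
    IsOpen {t : ℝ | y + t • b.dir ∈ b.chart.target} := by
  have hc : Continuous fun t : ℝ => y + t • b.dir := by fun_prop
  exact b.chart.open_target.preimage hc

theorem convex_times (b : FlowBox E M η) (y : E) :
    Convex ℝ {t : ℝ | y + t • b.dir ∈ b.chart.target} := by
  intro s hs t ht a c ha hc hac
  have h := b.convex hs ht ha hc hac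
  have h2 : a • (y + s • b.dir) + c • (y + t • b.dir) = y + (a • s + c • t) • b.dir := by
    rw [add_smul, smul_add, smul_add, smul_assoc, smul_assoc]
    nth_rewrite 3 [← one_smul ℝ y]
    rw [← hac, add_smul]
    abel
  rwa [h2] at h

/-- A function with vanishing derivative along the flow is constant on flow lines in a box. -/
theorem eq_of_mvfderiv_eq_zero (hT : SmoothTorusAction k E M) {f : M → F}
    (hf : ∀ y ∈ b.chart.source, MDifferentiableAt 𝓘(ℝ, E) 𝓘(ℝ, F) f y)
    (h0 : ∀ y ∈ b.chart.source, mvfderiv 𝓘(ℝ, E) f y (fundField η y) = 0)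
    (hx : x ∈ b.chart.source) {t : ℝ} (ht : b.chart x + t • b.dir ∈ b.chart.target) :
    f (flow η t x) = f x := by
  have h1 : ∀ s ∈ {t : ℝ | b.chart x + t • b.dir ∈ b.chart.target},
      HasDerivAt (fun s => f (flow η s x)) 0 s := by
    intro s hs
    have h2 := hasDerivAt_flow (η := η) hT (hf _ (flow_mem hx hs).1)
    rwa [h0 _ (flow_mem hx hs).1] at h2
  have h3 := (b.isOpen_times (b.chart x)).is_const_of_deriv_eq_zero
    (b.convex_times (b.chart x)).isPreconnected
    (f := fun s => f (flow η s x)) (fun s hs => (h1 s hs).differentiableAt.differentiableWithinAt)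
    (fun s hs => (h1 s hs).deriv) ht (by simpa using b.chart.map_source hx : (0 : ℝ) ∈ _)
  simpa [flow_zero] using h3

theorem mdifferentiableAt_flow (hT : SmoothTorusAction k E M) (t : ℝ) (y : M) :
    MDifferentiableAt 𝓘(ℝ, E) 𝓘(ℝ, E) (flow η t) y :=
  (contMDiff_flow hT η t).mdifferentiableAt (by simp)

/-- In the box the flow is a translation, whose derivative is the identity. -/
theorem coord_mfderiv_flow (hT : SmoothTorusAction k E M) (hx : x ∈ b.chart.source) {t : ℝ}
    (ht : b.chart x + t • b.dir ∈ b.chart.target) (u : TangentSpace 𝓘(ℝ, E) x) :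
    b.coord (flow η t x) (mfderiv 𝓘(ℝ, E) 𝓘(ℝ, E) (flow η t) x u) = b.coord x u := by
  have h1 : HasMFDerivAt 𝓘(ℝ, E) 𝓘(ℝ, E) (b.chart ∘ flow η t) x
      ((mfderiv 𝓘(ℝ, E) 𝓘(ℝ, E) b.chart (flow η t x)).comp
        (mfderiv 𝓘(ℝ, E) 𝓘(ℝ, E) (flow η t) x)) :=
    HasMFDerivAt.comp x (mdifferentiableAt_chart (flow_mem hx ht).1).hasMFDerivAt
      (mdifferentiableAt_flow hT t x).hasMFDerivAt
  have h2 : HasMFDerivAt 𝓘(ℝ, E) 𝓘(ℝ, E) (fun y => b.chart y + t • b.dir) x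
      (mfderiv 𝓘(ℝ, E) 𝓘(ℝ, E) b.chart x) := by
    have h3 : HasFDerivAt (fun z : E => z + t • b.dir) (ContinuousLinearMap.id ℝ E) (b.chart x) :=
      (hasFDerivAt_id _).add_const _
    exact HasMFDerivAt.comp (g := fun z : E => z + t • b.dir) x h3.hasMFDerivAt
      (mdifferentiableAt_chart hx).hasMFDerivAt
  have hev : (fun y => b.chart y + t • b.dir) =ᶠ[𝓝 x] b.chart ∘ flow η t := by
    have hc : ContinuousAt (fun y => b.chart y + t • b.dir) x :=
      (b.chart.continuousAt hx).add continuousAt_const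
    filter_upwards [source_mem_nhds hx, hc.preimage_mem_nhds (b.chart.open_target.mem_nhds ht)]
      with y hy hyt
    exact (flow_mem hy hyt).2.symm
  exact DFunLike.congr_fun (hasMFDerivAt_unique h1 (h2.congr_of_eventuallyEq hev.symm)) u

theorem mfderiv_flow_field (hT : SmoothTorusAction k E M) (hx : x ∈ b.chart.source) {t : ℝ}
    (ht : b.chart x + t • b.dir ∈ b.chart.target) (v : E) :
    mfderiv 𝓘(ℝ, E) 𝓘(ℝ, E) (flow η t) x (b.field v x) = b.field v (flow η t x) := by
  refine coord_injective (flow_mem hx ht).1 ?_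
  rw [coord_mfderiv_flow hT hx ht, coord_field hx, coord_field (flow_mem hx ht).1]

end FlowBox

/-- The two sides lie over points that are only propositionally equal. All tangent spaces are `E` by
definition, so the equation is stated in `E`; later comparisons along the flow use the same device.
-/
theorem mfderiv_flow_add (hT : SmoothTorusAction k E M) (s t : ℝ) (x : M)
    (u : TangentSpace 𝓘(ℝ, E) x) :
    mfderiv 𝓘(ℝ, E) 𝓘(ℝ, E) (flow η (s + t) : M → M) x u
      = (mfderiv 𝓘(ℝ, E) 𝓘(ℝ, E) (flow η s) (flow η t x)
          (mfderiv 𝓘(ℝ, E) 𝓘(ℝ, E) (flow η t) x u) : E) := by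
  have h1 : HasMFDerivAt 𝓘(ℝ, E) 𝓘(ℝ, E) (flow η s ∘ flow η t) x
      ((mfderiv 𝓘(ℝ, E) 𝓘(ℝ, E) (flow η s) (flow η t x)).comp
        (mfderiv 𝓘(ℝ, E) 𝓘(ℝ, E) (flow η t) x)) :=
    HasMFDerivAt.comp x (FlowBox.mdifferentiableAt_flow hT s _).hasMFDerivAt
      (FlowBox.mdifferentiableAt_flow hT t x).hasMFDerivAt
  have h2 : (flow η (s + t) : M → M) = flow η s ∘ flow η t := funext fun y => flow_add η s t y
  rw [h2, h1.mfderiv]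
  rfl

end FlowInvariance

/-! ### Boxes with adapted frames of L and κ -/

section AdaptedBoxes

variable {k : ℕ} {E : Type*} [NormedAddCommGroup E] [NormedSpace ℝ E] [FiniteDimensional ℝ E]
  {M : Type*} [TopologicalSpace M] [T2Space M] [ChartedSpace E M] [IsManifold 𝓘(ℝ, E) ∞ M]
  [MulAction (Fin k → Circle) M]
  {omega : ∀ x : M, FormAt (E := E) (Fin 2) ℝ x} {n : ℕ} {P : Polarization omega n}
  {ι : Type*} [dι : DecidableEq ι] [Fintype ι]
  {L : M → Type*} [TopologicalSpace (TotalSpace ℂ L)]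
  [∀ x, AddCommGroup (L x)] [∀ x, Module ℂ (L x)] [∀ x, TopologicalSpace (L x)]
  [∀ x, IsTopologicalAddGroup (L x)] [∀ x, ContinuousSMul ℝ (L x)]
  [FiberBundle ℂ L] [VectorBundle ℂ ℂ L] [VectorBundle ℝ ℂ L]
  [ContMDiffVectorBundle ∞ ℂ L 𝓘(ℝ, E)]
  {κ : M → Type*} [TopologicalSpace (TotalSpace ℂ κ)]
  [∀ x, AddCommGroup (κ x)] [∀ x, Module ℂ (κ x)] [∀ x, TopologicalSpace (κ x)]
  [FiberBundle ℂ κ] [VectorBundle ℂ ℂ κ] [VectorBundle ℝ ℂ κ]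
  [ContMDiffVectorBundle ∞ ℂ κ 𝓘(ℝ, E)]

/-- A flow box together with a frame of `L` that is parallel along the orbits, and a frame of `κ`
whose square is invariant under the torus action. -/
structure AdaptedBox (nabla : CovariantDerivative 𝓘(ℝ, E) ℂ L) (h : HalfForm κ P ι)
    (η : Fin k → ℝ) where
  /-- the flow box -/
  box : FlowBox E M η
  /-- the frame of `L` -/
  frL : LineFrame E L box.chart.source
  /-- the frame of `κ` -/
  frK : LineFrame E κ box.chart.source
  parallel : ∀ x ∈ box.chart.source, nabla frL.sec x (fundField η x) = 0
  invariant : ∀ x ∈ box.chart.source, ∀ v : ι → E,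
    mvfderiv 𝓘(ℝ, E) (box.component (fun y => h.sq (frK.sec y)) v) x (fundField η x) = 0

variable {nabla : CovariantDerivative 𝓘(ℝ, E) ℂ L} {h : HalfForm κ P ι} {η : Fin k → ℝ}

theorem exists_adaptedBox (hT : SmoothTorusAction k E M) (hL : IsPrequantum omega nabla)
    (hX : ∀ y, cvec (fundField η y) 0 ∈ P.space y) (h : HalfForm κ P ι) {q : M}
    (hη : fundField (E := E) η q = (0 : E) → η = 0) {O : Set M} (hO : IsOpen O) (hq : q ∈ O) :
    ∃ a : AdaptedBox nabla h η, q ∈ a.box.chart.source ∧ a.box.chart.source ⊆ O := by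
  obtain ⟨b, hqb, hbO⟩ := exists_flowBox hT η q hη hO hq
  obtain ⟨W, f, hW, hqW, hf⟩ := exists_parallel_frame hT hL b hqb
  obtain ⟨W', f', hW', hqW', hW'b, hf'⟩ := exists_invariant_frame hT hX h b hqb
  obtain ⟨C, hC, hC', hqC, hCW⟩ := b.exists_restrict_subset hqb
    (inter_mem (hW.mem_nhds hqW) (hW'.mem_nhds hqW'))
  refine ⟨⟨b.restrict hC hC', f.restrict (hCW.trans inter_subset_left),
    f'.restrict (hCW.trans inter_subset_right), fun x hx => hf x (hCW hx).1,
    fun x hx v => hf' x (hCW hx).2 v⟩, hqC, ?_⟩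
  rw [FlowBox.restrict_source]
  exact inter_subset_left.trans hbO

namespace AdaptedBox

variable {a : AdaptedBox nabla h η} {x : M}

/-- The coordinate of elements of `L ⊗ κ` in the frame of an adapted box. -/
def coef (a : AdaptedBox nabla h η) (x : M) : L x ⊗[ℂ] κ x →ₗ[ℂ] ℂ :=
  LinearMap.mul' ℂ ℂ ∘ₗ TensorProduct.map (a.frL.coef x) (a.frK.coef x)

theorem coef_tmul (l : L x) (c : κ x) : a.coef x (l ⊗ₜ c) = a.frL.coef x l * a.frK.coef x c := by
  simp [coef]

/-- The frame of `L ⊗ κ` of an adapted box. -/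
def sec (a : AdaptedBox nabla h η) (x : M) : L x ⊗[ℂ] κ x := a.frL.sec x ⊗ₜ a.frK.sec x

theorem coef_smul_sec (hx : x ∈ a.box.chart.source) (z : L x ⊗[ℂ] κ x) :
    a.coef x z • a.sec x = z := by
  induction z using TensorProduct.induction_on with
  | zero => rw [map_zero, zero_smul]
  | tmul l c =>
    rw [coef_tmul, sec, ← TensorProduct.smul_tmul_smul, a.frL.coef_smul x hx, a.frK.coef_smul x hx]
  | add y z hy hz => rw [map_add, add_smul, hy, hz]

theorem component_flow (hT : SmoothTorusAction k E M) (hx : x ∈ a.box.chart.source) {t : ℝ}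
    (ht : a.box.chart x + t • a.box.dir ∈ a.box.chart.target) (v : ι → E) :
    a.box.component (fun y => h.sq (a.frK.sec y)) v (flow η t x)
      = a.box.component (fun y => h.sq (a.frK.sec y)) v x := by
  refine FlowBox.eq_of_mvfderiv_eq_zero hT (fun y hy => ?_) (fun y hy => a.invariant y hy v) hx ht
  have := FlowBox.contMDiffOn_component (b := a.box) a.box.chart.open_source
    (h.smooth _ a.box.chart.open_source _ a.frK.smooth_sec) subset_rfl v
  exact (this.contMDiffAt (a.box.chart.open_source.mem_nhds hy)).mdifferentiableAt (by simp)

/-- Constant components together with preserved coordinates of vectors turn the vanishing derivative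
into invariance under pullback by the flow. -/
theorem sq_flow (hT : SmoothTorusAction k E M) (hx : x ∈ a.box.chart.source) {t : ℝ}
    (ht : a.box.chart x + t • a.box.dir ∈ a.box.chart.target)
    (w : ι → TangentSpace 𝓘(ℝ, E) x) :
    h.sq (a.frK.sec (flow η t x)) (fun i => mfderiv 𝓘(ℝ, E) 𝓘(ℝ, E) (flow η t) x (w i))
      = h.sq (a.frK.sec x) w := by
  have h1 := component_flow hT hx ht fun i => a.box.coord x (w i)
  rw [FlowBox.component_coord (α := fun y => h.sq (a.frK.sec y)) hx] at h1
  rw [← h1, ← FlowBox.component_coord (b := a.box) (α := fun y => h.sq (a.frK.sec y))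
    (FlowBox.flow_mem hx ht).1]
  simp only [FlowBox.coord_mfderiv_flow hT hx ht]

/-- The covariant derivative in a frame. -/
theorem coef_nabla (hL : IsPrequantum omega nabla) {W : Set M} (hW : IsOpen W) {l : ∀ x, L x}
    (hl : SmoothSectionOn (E := E) l W) (hx : x ∈ a.box.chart.source) (hxW : x ∈ W)
    (v : TangentSpace 𝓘(ℝ, E) x) :
    a.frL.coef x (nabla l x v) = mvfderiv 𝓘(ℝ, E) (fun y => a.frL.coef y (l y)) x v
      + a.frL.coef x (l x) * a.frL.coef x (nabla a.frL.sec x v) := by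
  have hs := a.frL.smooth_coef W hW l hl
  have hd : MDifferentiableAt 𝓘(ℝ, E) 𝓘(ℝ, ℂ) (fun y => a.frL.coef y (l y)) x :=
    (hs.contMDiffAt ((a.box.chart.open_source.inter hW).mem_nhds ⟨hx, hxW⟩)).mdifferentiableAt
      (by simp)
  have h1 := hL.leibniz a.box.chart.open_source a.frL.smooth_sec hx hd v
  have h2 : nabla (fun y => a.frL.coef y (l y) • a.frL.sec y) x = nabla l x := by
    refine nabla_congr hW hl hxW ?_
    filter_upwards [a.box.chart.open_source.mem_nhds hx] with y hy
    exact a.frL.coef_smul y hy _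
  rw [h2] at h1
  rw [h1, map_add, map_smul, map_smul, a.frL.coef_sec x hx]
  simp only [smul_eq_mul, mul_one]
  ring

/-- In a parallel frame the connection term vanishes along the orbits, so covariant differentiation
there is differentiation of the coefficient. -/
theorem coef_nabla_fundField (hL : IsPrequantum omega nabla) {W : Set M} (hW : IsOpen W)
    {l : ∀ x, L x} (hl : SmoothSectionOn (E := E) l W) (hx : x ∈ a.box.chart.source)
    (hxW : x ∈ W) : a.frL.coef x (nabla l x (fundField η x))
      = mvfderiv 𝓘(ℝ, E) (fun y => a.frL.coef y (l y)) x (fundField η x) := by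
  rw [coef_nabla hL hW hl hx hxW, a.parallel x hx, map_zero, mul_zero, add_zero]

/-- The connection form in a box. -/
def theta (a : AdaptedBox nabla h η) (x : M) (v : TangentSpace 𝓘(ℝ, E) x) : ℂ :=
  a.frL.coef x (nabla a.frL.sec x v)

theorem contMDiffOn_theta (hL : IsPrequantum omega nabla) (v : E) :
    ContMDiffOn 𝓘(ℝ, E) 𝓘(ℝ, ℂ) ∞ (fun x => a.theta x (a.box.field v x)) a.box.chart.source := by
  have hcs : CompleteSpace E := FiniteDimensional.complete ℝ E
  have h1 := hL.smoothSectionOn a.box.chart.open_source a.frL.smooth_sec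
    (a.box.smoothFieldOn_field v)
  have h2 := a.frL.smooth_coef _ a.box.chart.open_source _ h1
  rw [inter_self] at h2
  exact h2

theorem mlieBracket_field (hT : SmoothTorusAction k E M) (hx : x ∈ a.box.chart.source) (v : E) :
    VectorField.mlieBracket 𝓘(ℝ, E) (fundField η) (a.box.field v) x = 0 := by
  have hcs : CompleteSpace E := FiniteDimensional.complete ℝ E
  refine FlowBox.coord_injective hx ?_
  rw [FlowBox.coord_mlieBracket hT a.box.chart.open_source (a.box.smoothFieldOn_field v) hx hx,
    map_zero]
  have h1 : (fun y => (a.box.coord y (a.box.field v y) : E)) =ᶠ[𝓝 x] fun _ => v := by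
    filter_upwards [FlowBox.source_mem_nhds hx] with y hy
    exact FlowBox.coord_field hy v
  rw [mvfderiv, h1.mfderiv_eq]
  have h2 : mvfderiv 𝓘(ℝ, E) (fun _ : M => v) x = 0 := mvfderiv_const _
  exact DFunLike.congr_fun h2 _

/-- The derivative of the connection form along the flow is given by the curvature. -/
theorem mvfderiv_theta (hT : SmoothTorusAction k E M) (hL : IsPrequantum omega nabla)
    (hx : x ∈ a.box.chart.source) (v : E) :
    mvfderiv 𝓘(ℝ, E) (fun y => a.theta y (a.box.field v y)) x (fundField η x)
      = -(Complex.I * (omega x ![fundField η x, a.box.field v x] : ℂ)) := by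
  have hcs : CompleteSpace E := FiniteDimensional.complete ℝ E
  have hO := a.box.chart.open_source
  have h1 := hL.curvature _ hO a.frL.sec a.frL.smooth_sec (fundField η) (a.box.field v)
    (a.box.smoothFieldOn_fundField hT) (a.box.smoothFieldOn_field v) x hx
  rw [mlieBracket_field hT hx, map_zero, sub_zero] at h1
  -- The frame is parallel along the orbits throughout the box, so this section vanishes there and
  -- so does its covariant derivative. As the bracket vanishes too, only one term is left on the
  -- left side of the curvature identity.
  have h2 : nabla (fun y => nabla a.frL.sec y (fundField η y)) x = 0 := by
    have h3 : SmoothSectionOn (E := E) (fun x : M => (0 : L x)) a.box.chart.source :=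
      (contMDiff_zeroSection ℝ L).contMDiffOn
    have h4 := nabla_congr (nabla := nabla) hO h3 hx
      (σ' := fun y => nabla a.frL.sec y (fundField η y)) (by
        filter_upwards [hO.mem_nhds hx] with y hy
        exact a.parallel y hy)
    rw [h4]
    ext w
    have h5 := hL.complex_linear _ hO _ h3 0 x hx w
    simpa using h5
  rw [h2] at h1
  have h3 := hL.smoothSectionOn hO a.frL.smooth_sec (a.box.smoothFieldOn_field v)
  have h4 := coef_nabla_fundField (a := a) hL hO h3 hx hx
  have h5 := congrArg (a.frL.coef x) h1
  rw [map_smul, a.frL.coef_sec x hx, smul_eq_mul, mul_one] at h5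
  rw [← h5]
  refine h4.symm.trans ?_
  congr 1
  simp

end AdaptedBox

end AdaptedBoxes

/-! ### Determinants and forms of top degree -/

section Determinants

variable {E : Type*} [NormedAddCommGroup E] [NormedSpace ℝ E] [FiniteDimensional ℝ E]
  {N : ℕ} (bE : Module.Basis (Fin N) ℝ E)

/-- The determinant in a basis, as a continuous multilinear map. -/
def detMap : ContinuousMultilinearMap ℝ (fun _ : Fin N => E) ℝ :=
  { bE.det.toMultilinearMap with
    cont := by
      change Continuous fun u : Fin N → E => bE.det u
      simp only [Module.Basis.det_apply]
      refine Continuous.matrix_det (continuous_matrix fun i j => ?_)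
      exact (bE.coord i).toContinuousLinearMap.continuous.comp (continuous_apply j) }

theorem detMap_apply (u : Fin N → E) : detMap bE u = bE.det u := rfl

theorem contDiff_det : ContDiff ℝ ∞ fun u : Fin N → E => ((bE.det u : ℝ) : ℂ) :=
  Complex.ofRealCLM.contDiff.comp (detMap bE).contDiff

theorem hasDerivAt_det {u : Fin N → ℝ → E} {u' : Fin N → E} {t : ℝ}
    (hu : ∀ i, HasDerivAt (u i) (u' i) t) :
    HasDerivAt (fun s => ((bE.det fun i => u i s : ℝ) : ℂ))
      (∑ i, ((bE.det (Function.update (fun j => u j t) i (u' i)) : ℝ) : ℂ)) t := by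
  have h1 := (HasFDerivAt.multilinear_comp (f := detMap bE) fun i => (hu i).hasFDerivAt).hasDerivAt
  have h2 := h1.ofReal_comp
  refine h2.congr_deriv ?_
  simp [detMap_apply]

/-- Top degree forms make up a line, so one value on a basis determines them. -/
theorem eq_smul_det {V : Type*} [AddCommGroup V] [Module ℝ V] (e : Module.Basis (Fin N) ℝ V)
    (f : V [⋀^Fin N]→ₗ[ℝ] ℂ) (w : Fin N → V) : f w = f e * ((e.det w : ℝ) : ℂ) := by
  have h : f = (LinearMap.toSpanSingleton ℝ ℂ (f e)).compAlternatingMap e.det := by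
    refine Module.Basis.ext_alternating e fun i h => ?_
    let σ : Equiv.Perm (Fin N) := Equiv.ofBijective i (Finite.injective_iff_bijective.1 h)
    change f (e ∘ σ) = ((LinearMap.toSpanSingleton ℝ ℂ (f e)).compAlternatingMap e.det) (e ∘ σ)
    rw [AlternatingMap.map_perm, AlternatingMap.map_perm]
    simp [Module.Basis.det_self]
  conv_lhs => rw [h]
  simp [mul_comm]

end Determinants

/-! ### Evaluating wedge products -/

section WedgeProducts

variable {V V' : Type*} [AddCommGroup V] [Module ℝ V] [AddCommGroup V'] [Module ℝ V']
  {F G : Type*} [AddCommGroup F] [Module ℝ F] [AddCommGroup G] [Module ℝ G]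
  {ι₁ ι₂ : Type*} [Fintype ι₁] [Fintype ι₂] [DecidableEq ι₁] [DecidableEq ι₂]

theorem domCoprod_eq_sum (α : V [⋀^ι₁]→ₗ[ℝ] F) (β : V [⋀^ι₂]→ₗ[ℝ] G) (u : ι₁ ⊕ ι₂ → V) :
    α.domCoprod β u = ∑ σ, AlternatingMap.domCoprod.summand α β σ u := by
  change (α.domCoprod β : MultilinearMap ℝ (fun _ => V) (F ⊗[ℝ] G)) u = _
  rw [AlternatingMap.domCoprod_coe, sum_apply]

/-- The wedge product evaluates its factors only on families selected from `u`. Allowing different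
spaces `V` and `V'` lets forms at two points of an orbit be compared. -/
theorem domCoprod_congr {α : V [⋀^ι₁]→ₗ[ℝ] F} {β : V [⋀^ι₂]→ₗ[ℝ] G} {α' : V' [⋀^ι₁]→ₗ[ℝ] F}
    {β' : V' [⋀^ι₂]→ₗ[ℝ] G} {u : ι₁ ⊕ ι₂ → V} {u' : ι₁ ⊕ ι₂ → V'}
    (hα : ∀ s : ι₁ → ι₁ ⊕ ι₂, α (fun i => u (s i)) = α' (fun i => u' (s i)))
    (hβ : ∀ s : ι₂ → ι₁ ⊕ ι₂, β (fun i => u (s i)) = β' (fun i => u' (s i))) :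
    α.domCoprod β u = α'.domCoprod β' u' := by
  have h1 : ∀ σ, AlternatingMap.domCoprod.summand α β σ u
      = AlternatingMap.domCoprod.summand α' β' σ u' := by
    intro σ
    induction σ using Quotient.inductionOn' with
    | h σ =>
      rw [AlternatingMap.domCoprod.summand_mk'', AlternatingMap.domCoprod.summand_mk'']
      simp only [smul_apply, MultilinearMap.domDomCongr_apply,
        MultilinearMap.domCoprod_apply, AlternatingMap.coe_multilinearMap]
      rw [hα, hβ]
  rw [domCoprod_eq_sum, domCoprod_eq_sum]
  exact Finset.sum_congr rfl fun σ _ => h1 σ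

end WedgeProducts

/-! ### Invariance of polarized half-forms -/

section PolarizedHalfForms

variable {m k : ℕ} {E : Type*} [NormedAddCommGroup E] [NormedSpace ℝ E] [FiniteDimensional ℝ E]
  {M : Type*} [TopologicalSpace M] [T2Space M] [ChartedSpace E M] [IsManifold 𝓘(ℝ, E) ∞ M]
  [MulAction (Fin k → Circle) M]
  {omega : ∀ x : M, FormAt (E := E) (Fin 2) ℝ x} {n : ℕ} {P : Polarization omega n}
  {μ : M → Fin k → ℝ}
  {EB : Type*} [NormedAddCommGroup EB] [NormedSpace ℝ EB]
  {B : Type*} [TopologicalSpace B] [ChartedSpace EB B] [IsManifold 𝓘(ℝ, EB) ∞ B]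
  {pr : M → B} {φ : B → Fin k → ℝ}
  {η : Fin k → ℝ}

theorem mfderiv_comp_flow_eq {F : Type*} [NormedAddCommGroup F] [NormedSpace ℝ F]
    {B : Type*} [TopologicalSpace B] [ChartedSpace F B] {b : FlowBox E M η}
    (hT : SmoothTorusAction k E M) {f : M → B} (hf : ContMDiff 𝓘(ℝ, E) 𝓘(ℝ, F) ∞ f)
    (hinv : ∀ t y, f (flow η t y) = f y) {x : M} (hx : x ∈ b.chart.source) {t : ℝ}
    (ht : b.chart x + t • b.dir ∈ b.chart.target) (v : E) :
    (mfderiv 𝓘(ℝ, E) 𝓘(ℝ, F) f (flow η t x) (b.field v (flow η t x)) : F)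
      = mfderiv 𝓘(ℝ, E) 𝓘(ℝ, F) f x (b.field v x) := by
  have h1 : HasMFDerivAt 𝓘(ℝ, E) 𝓘(ℝ, F) (f ∘ flow η t) x
      ((mfderiv 𝓘(ℝ, E) 𝓘(ℝ, F) f (flow η t x)).comp
        (mfderiv 𝓘(ℝ, E) 𝓘(ℝ, E) (flow η t) x)) :=
    HasMFDerivAt.comp x (hf.mdifferentiableAt (by simp)).hasMFDerivAt
      (FlowBox.mdifferentiableAt_flow hT t x).hasMFDerivAt
  have h2 : f ∘ flow η t = f := funext fun y => hinv t y
  rw [h2] at h1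
  rw [h1.mfderiv, ← FlowBox.mfderiv_flow_field hT hx ht]
  rfl

/-- Both `pr` and `μ` are constant along the flow, so everything pulled back through them is
invariant, whatever the forms on the two bases are. -/
theorem wedgePullback_flow {b : FlowBox E M η}
    (hP : IsFibering (EB := EB) P μ pr φ) (hT : SmoothTorusAction k E M)
    (hμ : ∀ t y, μ (flow η t y) = μ y) (hμs : ContMDiff 𝓘(ℝ, E) 𝓘(ℝ, Fin k → ℝ) ∞ μ)
    (Ωφ : ∀ b : B, FormAt (E := EB) (Fin m) ℂ b)
    (ΩE : ∀ ξ : Fin k → ℝ, FormAt (E := Fin k → ℝ) (Fin k) ℝ ξ)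
    {x : M} (hx : x ∈ b.chart.source) {t : ℝ}
    (ht : b.chart x + t • b.dir ∈ b.chart.target) (v : Fin m ⊕ Fin k → E) :
    b.component (fun y => wedgePullback pr μ y (Ωφ (pr y)) (ΩE (μ y))) v (flow η t x)
      = b.component (fun y => wedgePullback pr μ y (Ωφ (pr y)) (ΩE (μ y))) v x := by
  -- The forms at the two base points have different types; substituting the equality of the points
  -- reduces the comparison to equal arguments.
  have key1 : ∀ (y y' : B), y = y' → ∀ (w w' : Fin m → EB), w = w' →
      (Ωφ y : EB [⋀^Fin m]→ₗ[ℝ] ℂ) w = (Ωφ y' : EB [⋀^Fin m]→ₗ[ℝ] ℂ) w' := by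
    rintro y _ rfl w _ rfl
    rfl
  have key2 : ∀ (y y' : Fin k → ℝ), y = y' → ∀ (w w' : Fin k → Fin k → ℝ), w = w' →
      (ΩE y : (Fin k → ℝ) [⋀^Fin k]→ₗ[ℝ] ℝ) w = (ΩE y' : (Fin k → ℝ) [⋀^Fin k]→ₗ[ℝ] ℝ) w' := by
    rintro y _ rfl w _ rfl
    rfl
  refine congrArg (TensorProduct.rid ℝ ℂ) (domCoprod_congr (fun s => ?_) fun s => ?_)
  · refine key1 _ _ (hP.pr_flow η t x) _ _ (funext fun i => ?_)
    exact mfderiv_comp_flow_eq hT hP.submersion_quotient.contMDiff (hP.pr_flow η) hx ht (v (s i))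
  · refine key2 _ _ (hμ t x) _ _ (funext fun i => ?_)
    exact mfderiv_comp_flow_eq hT hμs hμ hx ht (v (s i))

variable
  {L : M → Type*} [TopologicalSpace (TotalSpace ℂ L)]
  [∀ x, AddCommGroup (L x)] [∀ x, Module ℂ (L x)] [∀ x, TopologicalSpace (L x)]
  [∀ x, IsTopologicalAddGroup (L x)] [∀ x, ContinuousSMul ℝ (L x)]
  [FiberBundle ℂ L] [VectorBundle ℂ ℂ L] [VectorBundle ℝ ℂ L]
  [ContMDiffVectorBundle ∞ ℂ L 𝓘(ℝ, E)]
  {κ : M → Type*} [TopologicalSpace (TotalSpace ℂ κ)]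
  [∀ x, AddCommGroup (κ x)] [∀ x, Module ℂ (κ x)] [∀ x, TopologicalSpace (κ x)]
  [FiberBundle ℂ κ] [VectorBundle ℂ ℂ κ] [VectorBundle ℝ ℂ κ]
  [ContMDiffVectorBundle ∞ ℂ κ 𝓘(ℝ, E)]
  {nabla : CovariantDerivative 𝓘(ℝ, E) ℂ L} {h : HalfForm κ P (Fin m ⊕ Fin k)}

theorem AdaptedBox.exists_component_ne_zero {ι : Type*} [DecidableEq ι] [Fintype ι]
    {h : HalfForm κ P ι} (a : AdaptedBox nabla h η) {x : M} (hx : x ∈ a.box.chart.source) :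
    ∃ v, a.box.component (fun y => h.sq (a.frK.sec y)) v x ≠ 0 := by
  by_contra! hc
  refine h.sq_ne_zero a.frK hx ?_
  ext w
  rw [← FlowBox.component_coord (b := a.box) (α := fun y => h.sq (a.frK.sec y)) hx]
  exact hc _

/-- Half-forms with invariant square have constant coefficients along the orbits in an adapted
box. -/
theorem AdaptedBox.hasDerivAt_coefK {ι : Type*} [DecidableEq ι] [Fintype ι] {h : HalfForm κ P ι}
    (a : AdaptedBox nabla h η) (hT : SmoothTorusAction k E M) {τ : ∀ x, κ x} {W : Set M}
    (hW : IsOpen W) (hτ : SmoothSectionOn (E := E) τ W) {x : M} (hx : x ∈ a.box.chart.source)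
    (hxW : x ∈ W) (hinv : ∀ v, ∀ᶠ t in 𝓝 (0 : ℝ),
      a.box.component (fun y => h.sq (τ y)) v (flow η t x)
        = a.box.component (fun y => h.sq (τ y)) v x) :
    HasDerivAt (fun t => a.frK.coef (flow η t x) (τ (flow η t x))) 0 0 := by
  set g : M → ℂ := fun y => a.frK.coef y (τ y) with hg
  have hgd : MDifferentiableAt 𝓘(ℝ, E) 𝓘(ℝ, ℂ) g x :=
    ((a.frK.smooth_coef W hW τ hτ).contMDiffAt
      ((a.box.chart.open_source.inter hW).mem_nhds ⟨hx, hxW⟩)).mdifferentiableAt (by simp)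
  obtain ⟨v, hv⟩ := a.exists_component_ne_zero hx
  have hcomp : ∀ y ∈ a.box.chart.source, a.box.component (fun y => h.sq (τ y)) v y
      = (g y * g y) * a.box.component (fun y => h.sq (a.frK.sec y)) v y := by
    intro y hy
    have h1 : h.sq (τ y) = (g y * g y) • h.sq (a.frK.sec y) := by
      rw [← h.sq_smul, hg, a.frK.coef_smul y hy]
    rw [FlowBox.component, h1]
    rfl
  have hev : ∀ᶠ t in 𝓝 (0 : ℝ), g (flow η t x) * g (flow η t x) = g x * g x := by
    filter_upwards [hinv v, FlowBox.eventually_add_mem hx] with t h2 ht'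
    rw [hcomp x hx, hcomp _ (FlowBox.flow_mem hx ht').1, a.component_flow hT hx ht'] at h2
    exact mul_right_cancel₀ hv h2
  -- Only the square of the coefficient is known to be constant. At a zero the coefficient vanishes
  -- nearby along the orbit; elsewhere one differentiates the square and divides by `g x`.
  by_cases h0 : g x = 0
  · refine (hasDerivAt_const (0 : ℝ) (0 : ℂ)).congr_of_eventuallyEq ?_
    filter_upwards [hev] with t ht
    rw [h0, mul_zero] at ht
    exact mul_self_eq_zero.1 ht
  · have h1 := hasDerivAt_flow_zero (η := η) hT hgd
    have h2 := ((hasDerivAt_const (0 : ℝ) (g x * g x)).congr_of_eventuallyEq hev).unique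
      (h1.mul h1)
    rw [flow_zero] at h2
    have h3 : mvfderiv 𝓘(ℝ, E) g x (fundField η x) = 0 := by
      have h4 : g x * mvfderiv 𝓘(ℝ, E) g x (fundField η x) = 0 := by linear_combination -h2 / 2
      exact (mul_eq_zero.1 h4).resolve_left h0
    rwa [h3] at h1

/-- Polarized half-forms have constant coefficients along the orbits in an adapted box. -/
theorem AdaptedBox.hasDerivAt_polarized (a : AdaptedBox nabla h η)
    (hP : IsFibering (EB := EB) P μ pr φ) (hT : SmoothTorusAction k E M)
    (hμ : ∀ t y, μ (flow η t y) = μ y) (hμs : ContMDiff 𝓘(ℝ, E) 𝓘(ℝ, Fin k → ℝ) ∞ μ)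
    {τ : ∀ x, κ x} {W : Set M} (hW : IsOpen W)
    (hτ : IsPolarizedHalfForm (EB := EB) h μ pr φ τ W) {x : M} (hx : x ∈ a.box.chart.source)
    (hxW : x ∈ W) :
    HasDerivAt (fun t => a.frK.coef (flow η t x) (τ (flow η t x))) 0 0 := by
  obtain ⟨W', hW', hxW', -, Ωφ, ΩE, -, -, -, hΩ⟩ := hτ.2 x hxW
  refine a.hasDerivAt_coefK hT hW hτ.1 hx hxW fun v => ?_
  filter_upwards [eventually_flow_mem (η := η) hT (hW'.mem_nhds hxW'),
    FlowBox.eventually_add_mem hx] with t ht ht'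
  have h1 := wedgePullback_flow hP hT hμ hμs Ωφ ΩE hx ht' v
  simp only [FlowBox.component] at h1 ⊢
  have e1 := hΩ _ ht
  have e2 := hΩ _ hxW'
  simp only at e1 e2
  rw [e1, e2]
  exact h1

end PolarizedHalfForms

/-! ### Smoothness of the fundamental field; scalar test functions -/

section FundamentalField

variable {k : ℕ} {E : Type*} [NormedAddCommGroup E] [NormedSpace ℝ E] [FiniteDimensional ℝ E]
  {M : Type*} [TopologicalSpace M] [ChartedSpace E M] [IsManifold 𝓘(ℝ, E) ∞ M]
  [MulAction (Fin k → Circle) M] {η : Fin k → ℝ}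

theorem smoothFieldOn_fundField (hT : SmoothTorusAction k E M)
    (hη : ∀ q : M, fundField (E := E) η q = (0 : E) → η = 0) (W : Set M) :
    SmoothFieldOn (E := E) (fundField (M := M) η) W := by
  intro x _
  obtain ⟨b, hx, -⟩ := exists_flowBox hT η x (hη x) isOpen_univ (mem_univ x)
  exact ((b.smoothFieldOn_fundField hT x hx).contMDiffAt
    (b.chart.open_source.mem_nhds hx)).contMDiffWithinAt

/-- Compactly supported smooth functions with support in `O`. -/
structure IsTestFun (E : Type*) [NormedAddCommGroup E] [NormedSpace ℝ E] {M : Type*}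
    [TopologicalSpace M] [ChartedSpace E M] (f : M → ℂ) (O : Set M) : Prop where
  smooth : ContMDiff 𝓘(ℝ, E) 𝓘(ℝ, ℂ) ∞ f
  compact : HasCompactSupport f
  subset : tsupport f ⊆ O

theorem IsTestFun.mono {f : M → ℂ} {O O' : Set M} (hf : IsTestFun E f O) (h : O ⊆ O') :
    IsTestFun E f O' := ⟨hf.smooth, hf.compact, hf.subset.trans h⟩

theorem mvfderiv_eq_zero_of_notMem_tsupport {f : M → ℂ} {x : M} (hx : x ∉ tsupport f) :
    mvfderiv 𝓘(ℝ, E) f x = 0 := by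
  have h1 : f =ᶠ[𝓝 x] fun _ => 0 := notMem_tsupport_iff_eventuallyEq.1 hx
  have h2 : mvfderiv 𝓘(ℝ, E) (fun _ : M => (0 : ℂ)) x = 0 := mvfderiv_const _
  rw [mvfderiv, h1.mfderiv_eq]
  exact h2

theorem IsTestFun.mvfderiv_fundField (hT : SmoothTorusAction k E M) {b : FlowBox E M η} {f : M → ℂ}
    {O : Set M} (hf : IsTestFun E f O) (hO : O ⊆ b.chart.source) :
    IsTestFun E (fun x => mvfderiv 𝓘(ℝ, E) f x (fundField η x)) O := by
  have h0 : ∀ x ∉ tsupport f, mvfderiv 𝓘(ℝ, E) f x (fundField η x) = 0 := by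
    intro x hx
    rw [mvfderiv_eq_zero_of_notMem_tsupport hx]
    rfl
  have hs : tsupport (fun x => mvfderiv 𝓘(ℝ, E) f x (fundField η x)) ⊆ tsupport f := by
    refine closure_minimal (fun x hx => ?_) (isClosed_tsupport f)
    by_contra hxt
    exact hx (h0 x hxt)
  refine ⟨contMDiff_of_tsupport fun x hx => ?_,
    hf.compact.of_isClosed_subset (isClosed_tsupport _) hs, hs.trans hf.subset⟩
  have hxO := hO (hf.subset (hs hx))
  exact (FlowBox.contMDiffOn_mvfderiv_fundField hT b.chart.open_source subset_rfl
    hf.smooth.contMDiffOn).contMDiffAt (b.chart.open_source.mem_nhds hxO)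

end FundamentalField

/-! ### Test sections in an adapted box are functions -/

section TestSections

variable {m k : ℕ} {E : Type*} [NormedAddCommGroup E] [NormedSpace ℝ E] [FiniteDimensional ℝ E]
  {M : Type*} [TopologicalSpace M] [T2Space M] [ChartedSpace E M] [IsManifold 𝓘(ℝ, E) ∞ M]
  [MulAction (Fin k → Circle) M]
  {omega : ∀ x : M, FormAt (E := E) (Fin 2) ℝ x} {n : ℕ} {P : Polarization omega n}
  {L : M → Type*} [TopologicalSpace (TotalSpace ℂ L)]
  [∀ x, AddCommGroup (L x)] [∀ x, Module ℂ (L x)] [∀ x, TopologicalSpace (L x)]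
  [∀ x, IsTopologicalAddGroup (L x)] [∀ x, ContinuousSMul ℝ (L x)]
  [FiberBundle ℂ L] [VectorBundle ℂ ℂ L] [VectorBundle ℝ ℂ L]
  [ContMDiffVectorBundle ∞ ℂ L 𝓘(ℝ, E)]
  {κ : M → Type*} [TopologicalSpace (TotalSpace ℂ κ)]
  [∀ x, AddCommGroup (κ x)] [∀ x, Module ℂ (κ x)] [∀ x, TopologicalSpace (κ x)]
  [FiberBundle ℂ κ] [VectorBundle ℂ ℂ κ] [VectorBundle ℝ ℂ κ]
  [ContMDiffVectorBundle ∞ ℂ κ 𝓘(ℝ, E)]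
  {nabla : CovariantDerivative 𝓘(ℝ, E) ℂ L} {η : Fin k → ℝ}
  {N : ℕ} (bE : Module.Basis (Fin N) ℝ E)

open Classical in
/-- The pairing of a distributional section with a section, which is zero if the latter is not a
test section. -/
def pair {V : Set M} (s : ProdDist E L κ N V)
    (Φ : ∀ x, L x ⊗[ℂ] κ x →ₗ[ℂ] FormAt (E := E) (Fin N) ℂ x) : ℂ :=
  if hΦ : Φ ∈ ProdTest E L κ N V then s.toFun ⟨Φ, hΦ⟩ else 0

theorem pair_of_mem {V : Set M} (s : ProdDist E L κ N V)
    {Φ : ∀ x, L x ⊗[ℂ] κ x →ₗ[ℂ] FormAt (E := E) (Fin N) ℂ x} (hΦ : Φ ∈ ProdTest E L κ N V) :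
    pair s Φ = s.toFun ⟨Φ, hΦ⟩ := dif_pos hΦ

/-- The volume form of a flow box. -/
def FlowBox.vol (b : FlowBox E M η) (x : M) : FormAt (E := E) (Fin N) ℂ x :=
  Complex.ofRealCLM.toLinearMap.compAlternatingMap
    (bE.det.compLinearMap (b.coord x).toLinearMap)

theorem FlowBox.vol_apply (b : FlowBox E M η) (x : M) (w : Fin N → TangentSpace 𝓘(ℝ, E) x) :
    b.vol bE x w = ((bE.det fun i => (b.coord x (w i) : E) : ℝ) : ℂ) := rfl

theorem FlowBox.contMDiffOn_vol (b : FlowBox E M η) {W : Set M} (hW : IsOpen W)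
    {Y : Fin N → ∀ x : M, TangentSpace 𝓘(ℝ, E) x} (hY : ∀ i, SmoothFieldOn (Y i) W) :
    ContMDiffOn 𝓘(ℝ, E) 𝓘(ℝ, ℂ) ∞ (fun x => b.vol bE x (fun i => Y i x)) (b.chart.source ∩ W) := by
  have h1 : ContMDiffOn 𝓘(ℝ, E) 𝓘(ℝ, Fin N → E) ∞
      (fun x => fun i => (b.coord x (Y i x) : E)) (b.chart.source ∩ W) :=
    contMDiffOn_pi_space.2 fun i => contMDiffOn_coord hW (hY i)
  exact (contDiff_det bE).contMDiff.comp_contMDiffOn h1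

section General

variable {ι : Type*} [dι : DecidableEq ι] [Fintype ι] {h : HalfForm κ P ι}

/-- The test section with coefficient `f` in the frame of an adapted box. -/
def AdaptedBox.test (a : AdaptedBox nabla h η) (f : M → ℂ) (x : M) :
    L x ⊗[ℂ] κ x →ₗ[ℂ] FormAt (E := E) (Fin N) ℂ x :=
  (f x • a.coef x).smulRight (a.box.vol bE x)

variable {a : AdaptedBox nabla h η}

theorem AdaptedBox.test_apply (f : M → ℂ) (x : M) (z : L x ⊗[ℂ] κ x)
    (w : Fin N → TangentSpace 𝓘(ℝ, E) x) :
    a.test bE f x z w = f x * a.coef x z * a.box.vol bE x w := rfl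

theorem AdaptedBox.test_mem {f : M → ℂ} (hf : IsTestFun E f a.box.chart.source) {V : Set M}
    (hV : tsupport f ⊆ V) : a.test bE f ∈ ProdTest E L κ N V := by
  refine ⟨?_, tsupport f, hf.compact, hV, fun x hx => ?_⟩
  · rintro W hW e ⟨l, c, hl, hc, he⟩ W' hW' hWW' Y hY x hx
    refine ContMDiffAt.contMDiffWithinAt ?_
    by_cases hxs : x ∈ tsupport f
    · have hxa := hf.subset hxs
      have hn : a.box.chart.source ∩ W' ∈ 𝓝 x :=
        (a.box.chart.open_source.inter hW').mem_nhds ⟨hxa, hx⟩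
      have h1 := (a.frL.smooth_coef W' hW' l (ContMDiffOn.mono hl hWW')).contMDiffAt hn
      have h2 := (a.frK.smooth_coef W' hW' c (ContMDiffOn.mono hc hWW')).contMDiffAt hn
      have h3 := (a.box.contMDiffOn_vol bE hW' hY).contMDiffAt hn
      refine (((hf.smooth.contMDiffAt (x := x)).cmul (h1.cmul h2)).cmul h3).congr_of_eventuallyEq
        (Eventually.of_forall fun y => ?_)
      simp only [a.test_apply, he, a.coef_tmul]
    · refine (contMDiffAt_const (c := (0 : ℂ))).congr_of_eventuallyEq ?_
      filter_upwards [(isClosed_tsupport f).isOpen_compl.mem_nhds hxs] with y hy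
      rw [a.test_apply, image_eq_zero_of_notMem_tsupport hy, zero_mul, zero_mul]
  · refine LinearMap.ext fun z => AlternatingMap.ext fun w => ?_
    rw [a.test_apply, image_eq_zero_of_notMem_tsupport hx, zero_mul, zero_mul]
    rfl

/-- Test sections take values in a line bundle, trivialized over the box by the dual frame and the
volume form. The function is the value on the frame and on the coordinate fields. -/
theorem AdaptedBox.exists_eq_test {V : Set M} {Φ : ∀ x, L x ⊗[ℂ] κ x →ₗ[ℂ] FormAt (E := E) (Fin N) ℂ x}
    (hΦ : Φ ∈ ProdTest E L κ N V) {K : Set M} (hK : IsCompact K) (hKa : K ⊆ a.box.chart.source)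
    (hK0 : ∀ x ∉ K, Φ x = 0) :
    ∃ f : M → ℂ, ContMDiff 𝓘(ℝ, E) 𝓘(ℝ, ℂ) ∞ f ∧ (∀ x ∉ K, f x = 0) ∧ Φ = a.test bE f := by
  have hcs : CompleteSpace E := FiniteDimensional.complete ℝ E
  have h0 : ∀ x ∉ K, Φ x (a.sec x) (fun i => a.box.field (bE i) x) = 0 := by
    intro x hx
    rw [hK0 x hx]
    rfl
  refine ⟨fun x => Φ x (a.sec x) (fun i => a.box.field (bE i) x), fun x => ?_, h0, ?_⟩
  · by_cases hx : x ∈ a.box.chart.source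
    · exact (hΦ.1 _ a.box.chart.open_source a.sec ⟨_, _, a.frL.smooth_sec, a.frK.smooth_sec,
        fun _ => rfl⟩ _ a.box.chart.open_source subset_rfl _
        fun i => a.box.smoothFieldOn_field (bE i)).contMDiffAt
        (a.box.chart.open_source.mem_nhds hx)
    · refine (contMDiffAt_const (c := (0 : ℂ))).congr_of_eventuallyEq ?_
      filter_upwards [hK.isClosed.isOpen_compl.mem_nhds fun h => hx (hKa h)] with y hy
      exact h0 y hy
  · funext x
    by_cases hx : x ∈ K
    · have hxa := hKa hx
      refine LinearMap.ext fun z => AlternatingMap.ext fun w => ?_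
      rw [a.test_apply]
      conv_lhs => rw [← a.coef_smul_sec hxa z, map_smul]
      have h1 := eq_smul_det bE ((Φ x (a.sec x)).compLinearMap (FlowBox.fieldMap hxa))
        (fun i => a.box.coord x (w i))
      have h2 : (fun i => FlowBox.fieldMap hxa (a.box.coord x (w i))) = w :=
        funext fun i => FlowBox.field_coord hxa (w i)
      rw [AlternatingMap.compLinearMap_apply] at h1
      have h3 : Φ x (a.sec x) w
          = Φ x (a.sec x) (fun i => a.box.field (bE i) x) * a.box.vol bE x w := by
        refine Eq.trans ?_ h1
        rw [h2]
      rw [AlternatingMap.smul_apply, h3, smul_eq_mul]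
      ring
    · rw [hK0 x hx]
      refine LinearMap.ext fun z => AlternatingMap.ext fun w => ?_
      rw [a.test_apply]
      simp only [h0 x hx, zero_mul]
      rfl

end General

end TestSections

/-! ### Polarized distributions annihilate derivatives along the orbits -/

section PolarizedDistributions

variable {m k : ℕ} {E : Type*} [NormedAddCommGroup E] [NormedSpace ℝ E] [FiniteDimensional ℝ E]
  {M : Type*} [TopologicalSpace M] [T2Space M] [ChartedSpace E M] [IsManifold 𝓘(ℝ, E) ∞ M]
  [MulAction (Fin k → Circle) M]
  {omega : ∀ x : M, FormAt (E := E) (Fin 2) ℝ x} {n : ℕ} {P : Polarization omega n}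
  {μ : M → Fin k → ℝ}
  {EB : Type*} [NormedAddCommGroup EB] [NormedSpace ℝ EB]
  {B : Type*} [TopologicalSpace B] [ChartedSpace EB B] [IsManifold 𝓘(ℝ, EB) ∞ B]
  {pr : M → B} {φ : B → Fin k → ℝ}
  {L : M → Type*} [TopologicalSpace (TotalSpace ℂ L)]
  [∀ x, AddCommGroup (L x)] [∀ x, Module ℂ (L x)] [∀ x, TopologicalSpace (L x)]
  [∀ x, IsTopologicalAddGroup (L x)] [∀ x, ContinuousSMul ℝ (L x)]
  [FiberBundle ℂ L] [VectorBundle ℂ ℂ L] [VectorBundle ℝ ℂ L]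
  [ContMDiffVectorBundle ∞ ℂ L 𝓘(ℝ, E)]
  {κ : M → Type*} [TopologicalSpace (TotalSpace ℂ κ)]
  [∀ x, AddCommGroup (κ x)] [∀ x, Module ℂ (κ x)] [∀ x, TopologicalSpace (κ x)]
  [FiberBundle ℂ κ] [VectorBundle ℂ ℂ κ] [VectorBundle ℝ ℂ κ]
  [ContMDiffVectorBundle ∞ ℂ κ 𝓘(ℝ, E)]
  {nabla : CovariantDerivative 𝓘(ℝ, E) ℂ L} {η : Fin k → ℝ}
  {N : ℕ} (bE : Module.Basis (Fin N) ℝ E)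

theorem lieDerivForm_zero {ι : Type*} [Fintype ι] [DecidableEq ι]
    (α : ∀ x : M, FormAt (E := E) ι ℂ x)
    (Y : ι → ∀ x : M, TangentSpace 𝓘(ℝ, E) x) (x : M) :
    lieDerivForm (fun x : M => (0 : TangentSpace 𝓘(ℝ, E) x)) α Y x = 0 := by
  rw [lieDerivForm, map_zero, zero_sub, neg_eq_zero]
  refine Finset.sum_eq_zero fun i _ => ?_
  rw [mlieBracket_zero_left']
  exact (α x).map_update_zero _ _

theorem covLieDeriv_zero (Φ : ∀ x, L x →ₗ[ℂ] FormAt (E := E) (Fin N) ℂ x) (l : ∀ x, L x)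
    (Y : Fin N → ∀ x : M, TangentSpace 𝓘(ℝ, E) x) (x : M) :
    covLieDeriv nabla (fun x : M => (0 : TangentSpace 𝓘(ℝ, E) x)) Φ l Y x = 0 := by
  rw [covLieDeriv, lieDerivForm_zero, map_zero, map_zero, zero_sub, neg_eq_zero]
  rfl

/-- The covariant Lie derivative along the flow of a section given in an adapted box. -/
theorem AdaptedBox.covLieDeriv_eq {ι : Type*} [dι : DecidableEq ι] [Fintype ι]
    {h : HalfForm κ P ι} (a : AdaptedBox nabla h η)
    (hT : SmoothTorusAction k E M) (hL : IsPrequantum omega nabla)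
    {Φ : ∀ x, L x →ₗ[ℂ] FormAt (E := E) (Fin N) ℂ x} {f g : M → ℂ}
    {x : M} (hx : x ∈ a.box.chart.source)
    (hΦ : ∀ᶠ y in 𝓝 x, ∀ l w, Φ y l w = f y * (a.frL.coef y l * g y) * a.box.vol bE y w)
    (hf : ContMDiffAt 𝓘(ℝ, E) 𝓘(ℝ, ℂ) ∞ f x) (hg : ContMDiffAt 𝓘(ℝ, E) 𝓘(ℝ, ℂ) ∞ g x)
    (hg0 : HasDerivAt (fun t => g (flow η t x)) 0 0)
    {W : Set M} (hW : IsOpen W) (hxW : x ∈ W) {l : ∀ x, L x}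
    (hl : SmoothSectionOn (E := E) l W) {Y : Fin N → ∀ x : M, TangentSpace 𝓘(ℝ, E) x}
    (hY : ∀ i, SmoothFieldOn (Y i) W) :
    covLieDeriv nabla (fundField η) Φ l Y x
      = mvfderiv 𝓘(ℝ, E) f x (fundField η x) * (a.frL.coef x (l x) * g x)
        * a.box.vol bE x (fun i => Y i x) := by
  have hn : a.box.chart.source ∩ W ∈ 𝓝 x := (a.box.chart.open_source.inter hW).mem_nhds ⟨hx, hxW⟩
  have hls := (a.frL.smooth_coef W hW l hl).contMDiffAt hn
  have hvs := (a.box.contMDiffOn_vol bE hW hY).contMDiffAt hn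
  have hF : ContMDiffAt 𝓘(ℝ, E) 𝓘(ℝ, ℂ) ∞ (fun y => Φ y (l y) (fun i => Y i y)) x := by
    refine ((hf.cmul (hls.cmul hg)).cmul hvs).congr_of_eventuallyEq ?_
    filter_upwards [hΦ] with y hy
    exact hy _ _
  have d0 := hasDerivAt_flow_zero (η := η) hT (hF.mdifferentiableAt (by simp))
  have d1 := hasDerivAt_flow_zero (η := η) hT (hf.mdifferentiableAt (by simp))
  have d2 := hasDerivAt_flow_zero (η := η) hT (hls.mdifferentiableAt (by simp))
  rw [← coef_nabla_fundField hL hW hl hx hxW] at d2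
  have d3 : ∀ i, HasDerivAt (fun t => (a.box.coord (flow η t x) (Y i (flow η t x)) : E))
      (a.box.coord x (VectorField.mlieBracket 𝓘(ℝ, E) (fundField η) (Y i) x)) 0 := by
    intro i
    rw [FlowBox.coord_mlieBracket hT hW (hY i) hx hxW]
    exact hasDerivAt_flow_zero (η := η) hT
      (((FlowBox.contMDiffOn_coord hW (hY i)).contMDiffAt hn).mdifferentiableAt (by simp))
  have e0 : (fun j => (a.box.coord (flow η 0 x) (Y j (flow η 0 x)) : E))
      = fun j => (a.box.coord x (Y j x) : E) :=
    congrArg (fun y => fun j => (a.box.coord y (Y j y) : E)) (flow_zero η x)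
  have d4 := hasDerivAt_det bE d3
  simp only [e0] at d4
  -- The derivative of the frame coefficient of `l` is cancelled by the term with `nabla l`, that of
  -- the volume by the bracket terms, and `g` is constant along the orbit. What remains is the
  -- derivative of `f`.
  have d5 := (d1.mul (d2.mul hg0)).mul d4
  have hΦ0 : ∀ᶠ t in 𝓝 (0 : ℝ), Φ (flow η t x) (l (flow η t x)) (fun i => Y i (flow η t x))
      = f (flow η t x) * (a.frL.coef (flow η t x) (l (flow η t x)) * g (flow η t x))
        * a.box.vol bE (flow η t x) (fun i => Y i (flow η t x)) := by
    have := eventually_flow_mem (η := η) hT hΦ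
    filter_upwards [this] with t ht
    exact ht _ _
  simp only [e0] at d5
  have d6 := d0.unique (d5.congr_of_eventuallyEq hΦ0)
  have hv : ∀ i, a.box.vol bE x (Function.update (fun j => Y j x) i
        (VectorField.mlieBracket 𝓘(ℝ, E) (fundField η) (Y i) x))
      = ((bE.det (Function.update (fun j => (a.box.coord x (Y j x) : E)) i
        (a.box.coord x (VectorField.mlieBracket 𝓘(ℝ, E) (fundField η) (Y i) x))) : ℝ) : ℂ) := by
    intro i
    rw [FlowBox.vol_apply]
    congr 2
    funext j
    rcases eq_or_ne j i with rfl | hj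
    · simp
    · simp [hj]
  have hΦx := hΦ.self_of_nhds
  rw [covLieDeriv, lieDerivForm, d6, hΦx]
  have e1 : a.frL.coef (flow η 0 x) (l (flow η 0 x)) = a.frL.coef x (l x) :=
    congrArg (fun y => a.frL.coef y (l y)) (flow_zero η x)
  simp only [hΦx, hv, ← Finset.mul_sum, Pi.mul_apply, e1, flow_zero, FlowBox.vol_apply]
  ring

variable {h : HalfForm κ P (Fin m ⊕ Fin k)}

theorem contract_test_apply {ι : Type*} [dι : DecidableEq ι] [Fintype ι]
    {h : HalfForm κ P ι} (a : AdaptedBox nabla h η) {W : Set M}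
    (hW : IsOpen W) {τ : ∀ x, κ x} (hτ : SmoothSectionOn (E := E) τ W) {f : M → ℂ}
    (hf : a.test bE f ∈ ProdTest E L κ N W) (x : M) (l : L x)
    (w : Fin N → TangentSpace 𝓘(ℝ, E) x) :
    (contract hW τ hτ ⟨a.test bE f, hf⟩).1 x l w
      = f x * (a.frL.coef x l * a.frK.coef x (τ x)) * a.box.vol bE x w := by
  change a.test bE f x (l ⊗ₜ τ x) w = _
  rw [a.test_apply, a.coef_tmul]

/-- Polarized distributions vanish on derivatives along the torus action, locally. -/
theorem IsPolarizedDist.exists_nhds {V : Set M} {s : ProdDist E L κ N V}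
    (hs : IsPolarizedDist (EB := EB) nabla h μ pr φ s)
    (hP : IsFibering (EB := EB) P μ pr φ) (hL : IsPrequantum omega nabla)
    (hμ : IsHamiltonianTorusAction omega μ) (η : Fin k → ℝ) {q : M} (hq : q ∈ V) :
    ∃ W : Set M, IsOpen W ∧ q ∈ W ∧ W ⊆ V ∧ ∀ a : AdaptedBox nabla h η,
      a.box.chart.source ⊆ W → ∀ f : M → ℂ, IsTestFun E f a.box.chart.source →
        pair s (a.test bE fun x => mvfderiv 𝓘(ℝ, E) f x (fundField η x)) = 0 := by
  have hT : SmoothTorusAction k E M := hμ.smooth_action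
  obtain ⟨W, hW, hWV, hqW, r, σ, τ, hτ, hσ, hsum⟩ := hs q hq
  refine ⟨W, hW, hqW, hWV, fun a haW f hf => ?_⟩
  have hXf := hf.mvfderiv_fundField hT (b := a.box) subset_rfl
  have hm := a.test_mem bE hXf (hXf.subset.trans haW)
  have hm' := a.test_mem bE hf (hf.subset.trans haW)
  have h1 : pair s (a.test bE fun x => mvfderiv 𝓘(ℝ, E) f x (fundField η x))
      = s.toFun (extendTest _ N hWV ⟨_, hm⟩) :=
    pair_of_mem s (testSpace_mono _ N hWV hm)
  rw [h1, hsum]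
  refine Finset.sum_eq_zero fun j _ => ?_
  -- Polarization of `σ j` is used for the field Z = X + i·0 in the conjugate of P and for the test
  -- section of L obtained by contracting with `τ j`.
  refine hσ j (fundField η) (fun x => 0) (smoothFieldOn_fundField hT
    (hμ.eq_zero_of_fundField_eq_zero hP.submersion_moment η) W) (smoothFieldOn_zero W)
    (fun x _ => (hP.fundField_mem hT η x).2) (contract hW (τ j) (hτ j).1 ⟨_, hm'⟩) _ ?_
  intro W' hW' hW'W l hl Y hY x hx
  rw [covLieDeriv_zero, mul_zero, add_zero, contract_test_apply]
  -- The frame calculation is valid only inside the box. Off the support of `f` both sides vanish.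
  by_cases hxs : x ∈ tsupport f
  · have hxa := hf.subset hxs
    refine (a.covLieDeriv_eq bE hT hL hxa (Eventually.of_forall fun y l w =>
      contract_test_apply bE a hW (hτ j).1 hm' y l w) hf.smooth.contMDiffAt ?_
      (a.hasDerivAt_polarized hP hT (fun t y => hμ.invariant _ _) hμ.smooth_moment hW (hτ j) hxa
        (hW'W hx)) hW' hx hl hY).symm
    exact (a.frK.smooth_coef W hW _ (hτ j).1).contMDiffAt
      ((a.box.chart.open_source.inter hW).mem_nhds ⟨hxa, hW'W hx⟩)
  · rw [mvfderiv_eq_zero_of_notMem_tsupport hxs]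
    have h0 : ∀ᶠ y in 𝓝 x, f y = 0 := notMem_tsupport_iff_eventuallyEq.1 hxs
    have h2 : ∀ᶠ y in 𝓝 x, ∀ l w, (contract hW (τ j) (hτ j).1 ⟨_, hm'⟩).1 y l w = 0 := by
      filter_upwards [h0] with y hy l w
      rw [contract_test_apply, hy, zero_mul, zero_mul]
    have h3 := h2.self_of_nhds
    rw [covLieDeriv, lieDerivForm, h3]
    simp only [h3, Finset.sum_const_zero, sub_zero]
    have h4 : (fun y => (contract hW (τ j) (hτ j).1 ⟨_, hm'⟩).1 y (l y) (fun i => Y i y))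
        =ᶠ[𝓝 x] fun _ => (0 : ℂ) := by
      filter_upwards [h2] with y hy
      exact hy _ _
    have h5 : mvfderiv 𝓘(ℝ, E) (fun _ : M => (0 : ℂ)) x = 0 := mvfderiv_const _
    rw [mvfderiv, h4.mfderiv_eq]
    refine Eq.trans ?_ (DFunLike.congr_fun h5 _).symm
    change (0 : ℂ) * _ * _ = 0
    rw [zero_mul, zero_mul]

end PolarizedDistributions

/-! ### Locally constant functions -/

section LocallyConstant

theorem eventually_eq_of_hasDerivAt_zero {F : Type*} [NormedAddCommGroup F] [NormedSpace ℝ F]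
    {f : ℝ → F} {t₀ : ℝ} (hf : ∀ᶠ t in 𝓝 t₀, HasDerivAt f 0 t) :
    ∀ᶠ t in 𝓝 t₀, f t = f t₀ := by
  obtain ⟨r, hr, h⟩ := Metric.eventually_nhds_iff_ball.1 hf
  filter_upwards [Metric.ball_mem_nhds t₀ hr] with t ht
  exact Metric.isOpen_ball.is_const_of_deriv_eq_zero (convex_ball t₀ r).isPreconnected
    (fun s hs => (h s hs).differentiableAt.differentiableWithinAt) (fun s hs => (h s hs).deriv)
    ht (Metric.mem_ball_self hr)

/-- The common engine of the continuation arguments: existence of transports, continuation of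
invariance along an orbit, constancy of the holonomy on a leaf. There `f` is a predicate and
equality of values means equivalence. -/
theorem _root_.IsPreconnected.eq_of_eventually_eq {X Y : Type*} [TopologicalSpace X] {S : Set X}
    (hS : IsPreconnected S) {f : X → Y} (h : ∀ x ∈ S, ∀ᶠ y in 𝓝[S] x, f y = f x) {x y : X}
    (hx : x ∈ S) (hy : y ∈ S) : f x = f y := by
  have : PreconnectedSpace S := isPreconnected_iff_preconnectedSpace.1 hS
  have h1 : IsLocallyConstant (fun z : S => f z) := by
    rw [IsLocallyConstant.iff_eventually_eq]
    rintro ⟨z, hz⟩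
    exact (eventually_nhds_subtype_iff S ⟨z, hz⟩ fun y => f y = f z).2 (h z hz)
  exact h1.apply_eq_of_preconnectedSpace ⟨x, hx⟩ ⟨y, hy⟩

end LocallyConstant

/-! ### Transport along orbits in L ⊗ κ and the Bohr–Sommerfeld lifts -/

section Transports

variable {k : ℕ} {E : Type*} [NormedAddCommGroup E] [NormedSpace ℝ E] [FiniteDimensional ℝ E]
  {M : Type*} [TopologicalSpace M] [T2Space M] [ChartedSpace E M] [IsManifold 𝓘(ℝ, E) ∞ M]
  [MulAction (Fin k → Circle) M]
  {omega : ∀ x : M, FormAt (E := E) (Fin 2) ℝ x} {n : ℕ} {P : Polarization omega n}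
  {ι : Type*} [dι : DecidableEq ι] [Fintype ι]
  {L : M → Type*} [TopologicalSpace (TotalSpace ℂ L)]
  [∀ x, AddCommGroup (L x)] [∀ x, Module ℂ (L x)] [∀ x, TopologicalSpace (L x)]
  [∀ x, IsTopologicalAddGroup (L x)] [∀ x, ContinuousSMul ℝ (L x)]
  [FiberBundle ℂ L] [VectorBundle ℂ ℂ L] [VectorBundle ℝ ℂ L]
  [ContMDiffVectorBundle ∞ ℂ L 𝓘(ℝ, E)]
  {κ : M → Type*} [TopologicalSpace (TotalSpace ℂ κ)]
  [∀ x, AddCommGroup (κ x)] [∀ x, Module ℂ (κ x)] [∀ x, TopologicalSpace (κ x)]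
  [FiberBundle ℂ κ] [VectorBundle ℂ ℂ κ] [VectorBundle ℝ ℂ κ]
  [ContMDiffVectorBundle ∞ ℂ κ 𝓘(ℝ, E)]
  {nabla : CovariantDerivative 𝓘(ℝ, E) ℂ L} {h : HalfForm κ P ι} {η : Fin k → ℝ}

theorem flow_sub_flow (η : Fin k → ℝ) (s t : ℝ) (x : M) :
    flow η (s - t) (flow η t x) = flow η s x := by
  rw [← flow_add, sub_add_cancel]

namespace AdaptedBox

theorem coef_sec_mul (a a' : AdaptedBox nabla h η) (x : M) :
    a'.coef x (a.sec x) = a'.frL.coef x (a.frL.sec x) * a'.frK.coef x (a.frK.sec x) :=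
  coef_tmul _ _

/-- Transition functions between adapted boxes are constant along the orbits. -/
theorem hasDerivAt_transition (hT : SmoothTorusAction k E M) (hL : IsPrequantum omega nabla)
    (a a' : AdaptedBox nabla h η) {x : M} (hx : x ∈ a.box.chart.source)
    (hx' : x ∈ a'.box.chart.source) :
    HasDerivAt (fun t => a'.coef (flow η t x) (a.sec (flow η t x))) 0 0 := by
  have hO := a.box.chart.open_source
  have hls := (a'.frL.smooth_coef _ hO _ a.frL.smooth_sec).contMDiffAt
    ((a'.box.chart.open_source.inter hO).mem_nhds ⟨hx', hx⟩)
  have d1 := hasDerivAt_flow_zero (η := η) hT (hls.mdifferentiableAt (by simp))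
  rw [← coef_nabla_fundField hL hO a.frL.smooth_sec hx' hx, a.parallel x hx, map_zero] at d1
  have d2 := a'.hasDerivAt_coefK hT hO a.frK.smooth_sec hx' hx fun v => by
    filter_upwards [FlowBox.eventually_add_mem hx, FlowBox.eventually_add_mem hx'] with t ht ht'
    have h1 := a.sq_flow hT hx ht (fun i => a'.box.field (v i) x)
    simp only [FlowBox.mfderiv_flow_field hT hx' ht'] at h1
    exact h1
  have d3 := d1.mul d2
  simp only [zero_mul, mul_zero, add_zero] at d3
  refine d3.congr_of_eventuallyEq (Eventually.of_forall fun t => ?_)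
  exact coef_sec_mul _ _ _

/-- By the group law the vanishing derivative at time 0 holds at all times near `t`, so the
transition function is locally constant along the orbit. -/
theorem eventually_transition (hT : SmoothTorusAction k E M) (hL : IsPrequantum omega nabla)
    (a a' : AdaptedBox nabla h η) {x : M} {t : ℝ} (hx : flow η t x ∈ a.box.chart.source)
    (hx' : flow η t x ∈ a'.box.chart.source) :
    ∀ᶠ r in 𝓝 t, a'.coef (flow η r x) (a.sec (flow η r x))
      = a'.coef (flow η t x) (a.sec (flow η t x)) := by
  have hc : Continuous fun r => flow η r x := (contMDiff_orbit hT η x).continuous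
  have hO : ∀ᶠ r in 𝓝 t, flow η r x ∈ a.box.chart.source ∩ a'.box.chart.source :=
    hc.continuousAt.preimage_mem_nhds
      ((a.box.chart.open_source.inter a'.box.chart.open_source).mem_nhds ⟨hx, hx'⟩)
  refine eventually_eq_of_hasDerivAt_zero ?_
  filter_upwards [hO] with r hr
  have h1 := hasDerivAt_transition hT hL a a' hr.1 hr.2
  have h2 : (fun s => a'.coef (flow η s x) (a.sec (flow η s x)))
      = fun s => (fun t => a'.coef (flow η t (flow η r x)) (a.sec (flow η t (flow η r x))))
        (s - r) := by
    funext s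
    exact congrArg (fun y => a'.coef y (a.sec y)) (flow_sub_flow η s r x).symm
  rw [h2]
  refine HasDerivAt.comp_sub_const
    (f := fun t => a'.coef (flow η t (flow η r x)) (a.sec (flow η t (flow η r x)))) r r ?_
  rwa [sub_self]

end AdaptedBox

/-- `l` is locally on `[0, T]` a constant multiple of the frames of adapted boxes. -/
def IsTransport (nabla : CovariantDerivative 𝓘(ℝ, E) ℂ L) (h : HalfForm κ P ι) (η : Fin k → ℝ)
    (x : M) (T : ℝ) (l : ∀ t : ℝ, L (flow η t x) ⊗[ℂ] κ (flow η t x)) : Prop :=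
  ∀ t ∈ Icc 0 T, ∀ a : AdaptedBox nabla h η, flow η t x ∈ a.box.chart.source →
    ∀ᶠ r in 𝓝[Icc 0 T] t, a.coef (flow η r x) (l r) = a.coef (flow η t x) (l t)

theorem IsTransport.mono {x : M} {T T' : ℝ} {l : ∀ t : ℝ, L (flow η t x) ⊗[ℂ] κ (flow η t x)}
    (hl : IsTransport nabla h η x T l) (hT : T' ≤ T) : IsTransport nabla h η x T' l :=
  fun t ht a hta => (hl t ⟨ht.1, ht.2.trans hT⟩ a hta).filter_mono
    (nhdsWithin_mono t (Icc_subset_Icc_right hT))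

theorem IsTransport.coef_eq {x : M} {T : ℝ} {l : ∀ t : ℝ, L (flow η t x) ⊗[ℂ] κ (flow η t x)}
    (hl : IsTransport nabla h η x T l) (a : AdaptedBox nabla h η) {s t : ℝ}
    (hs : s ∈ Icc 0 T) (ht : t ∈ Icc 0 T)
    (hst : ∀ r ∈ uIcc s t, flow η r x ∈ a.box.chart.source) :
    a.coef (flow η s x) (l s) = a.coef (flow η t x) (l t) := by
  have hsub : uIcc s t ⊆ Icc 0 T := ordConnected_Icc.uIcc_subset hs ht
  refine isPreconnected_uIcc.eq_of_eventually_eq (f := fun r => a.coef (flow η r x) (l r))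
    (fun r hr => ?_) left_mem_uIcc right_mem_uIcc
  exact (hl r (hsub hr) a (hst r hr)).filter_mono (nhdsWithin_mono r hsub)

-- The transport is kept up to `T` and continued beyond by a constant multiple of the frame of `a`.
-- Since transition functions are locally constant along orbits, constancy in one box is constancy
-- in every box.
open Classical in
theorem IsTransport.exists_extend (hT : SmoothTorusAction k E M) (hL : IsPrequantum omega nabla)
    {x : M} {T T' : ℝ} (h0 : 0 ≤ T) (hTT : T ≤ T')
    {l : ∀ t : ℝ, L (flow η t x) ⊗[ℂ] κ (flow η t x)} (hl : IsTransport nabla h η x T l)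
    (a : AdaptedBox nabla h η) (ha : ∀ r ∈ Icc T T', flow η r x ∈ a.box.chart.source) :
    ∃ l' : ∀ t : ℝ, L (flow η t x) ⊗[ℂ] κ (flow η t x),
      IsTransport nabla h η x T' l' ∧ l' 0 = l 0 := by
  -- Matches the two pieces at time `T`.
  set z := a.coef (flow η T x) (l T) with hz
  let l' : ∀ t : ℝ, L (flow η t x) ⊗[ℂ] κ (flow η t x) := fun t =>
    if t ≤ T then l t else z • a.sec (flow η t x)
  have hle : ∀ t, t ≤ T → l' t = l t := fun t ht => if_pos ht
  have hgt : ∀ t, T < t → l' t = z • a.sec (flow η t x) := fun t ht => if_neg (not_le.2 ht)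
  refine ⟨l', fun t ht a' ha' => ?_, hle 0 h0⟩
  rcases lt_trichotomy t T with htT | rfl | htT
  · have h1 := hl t ⟨ht.1, htT.le⟩ a' ha'
    rw [eventually_nhdsWithin_iff] at h1 ⊢
    filter_upwards [h1, Iio_mem_nhds htT] with r hr hrT hr0
    rw [hle r (le_of_lt hrT), hle t htT.le]
    exact hr ⟨hr0.1, le_of_lt hrT⟩
  · have h1 := hl t ⟨ht.1, le_rfl⟩ a' ha'
    have hta := ha t ⟨le_rfl, hTT⟩
    rw [eventually_nhdsWithin_iff] at h1 ⊢
    filter_upwards [h1, a.eventually_transition hT hL a' hta ha'] with r hr hr2 hr0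
    rcases le_or_gt r t with hrt | hrt
    · rw [hle r hrt, hle t le_rfl]
      exact hr ⟨hr0.1, hrt⟩
    · rw [hgt r hrt, hle t le_rfl, map_smul, hr2, ← map_smul, a.coef_smul_sec hta]
  · have hta := ha t ⟨htT.le, ht.2⟩
    refine Eventually.filter_mono nhdsWithin_le_nhds ?_
    filter_upwards [a.eventually_transition hT hL a' hta ha', Ioi_mem_nhds htT] with r hr hrT
    rw [hgt r hrT, hgt t htT, map_smul, map_smul, hr]

/-- Along every orbit there are non-zero transports over the unit interval. -/
theorem exists_isTransport (hT : SmoothTorusAction k E M) (hL : IsPrequantum omega nabla)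
    (hX : ∀ y, cvec (fundField η y) 0 ∈ P.space y)
    (hη : ∀ q : M, fundField (E := E) η q = (0 : E) → η = 0) (h : HalfForm κ P ι) (x : M) :
    ∃ l : ∀ t : ℝ, L (flow η t x) ⊗[ℂ] κ (flow η t x),
      IsTransport nabla h η x 1 l ∧ l 0 ≠ 0 := by
  let p : ℝ → Prop := fun T => ∃ l : ∀ t : ℝ, L (flow η t x) ⊗[ℂ] κ (flow η t x),
      IsTransport nabla h η x T l ∧ l 0 ≠ 0
  -- The set of times that a nonzero transport reaches is open and closed: within one box a
  -- transport can be lengthened by extension and shortened by restriction.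
  have hp : p 0 = p 1 := by
    refine isPreconnected_Icc.eq_of_eventually_eq (S := Icc (0 : ℝ) 1) (f := p) (fun T₀ hT₀ => ?_)
      (by simp) (by simp)
    obtain ⟨a, ha, -⟩ := exists_adaptedBox (nabla := nabla) hT hL hX h (hη (flow η T₀ x))
      isOpen_univ (mem_univ (flow η T₀ x))
    have hO : {t | flow η t x ∈ a.box.chart.source} ∈ 𝓝 T₀ :=
      (contMDiff_orbit hT η x).continuous.continuousAt.preimage_mem_nhds
        (a.box.chart.open_source.mem_nhds ha)
    obtain ⟨r, hr, hrO⟩ := Metric.mem_nhds_iff.1 hO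
    have key : ∀ T ∈ Icc (0 : ℝ) 1, ∀ T', T ∈ Metric.ball T₀ r → T' ∈ Metric.ball T₀ r →
        p T → p T' := by
      rintro T hT1 T' hTr hTr' ⟨l, hl, hl0⟩
      rcases le_total T T' with hTT | hTT
      · obtain ⟨l', hl', h0'⟩ := hl.exists_extend hT hL hT1.1 hTT a fun s hs =>
          hrO ((convex_ball T₀ r).ordConnected.out hTr hTr' hs)
        exact ⟨l', hl', by rwa [h0']⟩
      · exact ⟨l, hl.mono hTT, hl0⟩
    rw [eventually_nhdsWithin_iff]
    filter_upwards [Metric.ball_mem_nhds T₀ hr] with T hTr hT1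
    exact propext ⟨key T hT1 T₀ hTr (Metric.mem_ball_self hr),
      key T₀ hT₀ T (Metric.mem_ball_self hr) hTr⟩
  have h0 : p 0 := by
    obtain ⟨a, ha, -⟩ := exists_adaptedBox (nabla := nabla) hT hL hX h (hη (flow η 0 x))
      isOpen_univ (mem_univ (flow η 0 x))
    refine ⟨fun t => a.sec (flow η t x), fun t ht a' ha' => ?_, fun h0 => ?_⟩
    · have ht0 : t = 0 := le_antisymm ht.2 ht.1
      subst ht0
      exact (a.eventually_transition hT hL a' ha ha').filter_mono nhdsWithin_le_nhds
    · have h1 := congrArg (a.coef _) h0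
      rw [a.coef_sec_mul, a.frL.coef_sec _ ha, a.frK.coef_sec _ ha, map_zero] at h1
      simp at h1
  exact cast hp h0

/-- In a parallel frame the lifting equation reduces to `f' = 0`. -/
theorem IsParallelLift.eventually_coef {x : M} {l : ∀ t : ℝ, L (orbitCurve η x t)}
    (hT : SmoothTorusAction k E M) (hl : IsParallelLift nabla η x l) (a : AdaptedBox nabla h η)
    {t : ℝ} (ht : flow η t x ∈ a.box.chart.source) :
    ∀ᶠ r in 𝓝 t, a.frL.coef (flow η r x) (l r) = a.frL.coef (flow η t x) (l t) := by
  have hO : ∀ᶠ r in 𝓝 t, flow η r x ∈ a.box.chart.source :=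
    (contMDiff_orbit hT η x).continuous.continuousAt.preimage_mem_nhds
      (a.box.chart.open_source.mem_nhds ht)
  refine eventually_eq_of_hasDerivAt_zero (f := fun r => a.frL.coef (flow η r x) (l r)) ?_
  filter_upwards [hO.eventually_nhds] with r hr
  have hr0 := hr.self_of_nhds
  obtain ⟨f', hf', h0⟩ := hl _ a.box.chart.open_source a.frL.sec a.frL.smooth_sec
    (fun y hy => a.frL.sec_ne_zero hy) r (fun r => a.frL.coef (flow η r x) (l r)) hr0 (by
      filter_upwards [hr] with s hs
      exact (a.frL.coef_smul _ hs _).symm)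
  have h1 : nabla a.frL.sec (orbitCurve η x r) (fundField η (orbitCurve η x r)) = 0 :=
    a.parallel _ hr0
  rw [h1, smul_zero, add_zero] at h0
  have h2 : f' = 0 := (smul_eq_zero.1 h0).resolve_right (a.frL.sec_ne_zero hr0)
  rwa [h2] at hf'

/-- A continuous square root of a constant cannot jump between its two signs. -/
theorem eventually_eq_of_mul_self {f : ℝ → ℂ} {t : ℝ} (hf : ContinuousAt f t)
    (h : ∀ᶠ r in 𝓝 t, f r * f r = f t * f t) : ∀ᶠ r in 𝓝 t, f r = f t := by
  by_cases h0 : f t = 0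
  · filter_upwards [h] with r hr
    rw [h0, mul_zero] at hr
    rw [h0, mul_self_eq_zero.1 hr]
  · have h1 : ∀ᶠ r in 𝓝 t, f r ≠ -f t := by
      refine hf.eventually_ne ?_
      intro h2
      exact h0 (self_eq_neg.1 h2)
    filter_upwards [h, h1] with r hr hr1
    exact (mul_self_eq_mul_self_iff.1 hr).resolve_right hr1

/-- Only the square of the lift is prescribed. In an invariant frame this makes the square of the
coefficient locally constant, and continuity of the lift fixes the sign. -/
theorem IsHalfFormLift.eventually_coef {x : M} {c : ∀ t : ℝ, κ (orbitCurve η x t)}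
    (hT : SmoothTorusAction k E M) (hc : IsHalfFormLift (E := E) h η x c)
    (a : AdaptedBox nabla h η) {t : ℝ} (ht : flow η t x ∈ a.box.chart.source) :
    ∀ᶠ r in 𝓝 t, a.frK.coef (flow η r x) (c r) = a.frK.coef (flow η t x) (c t) := by
  have hO : ∀ᶠ r in 𝓝 t, flow η r x ∈ a.box.chart.source :=
    (contMDiff_orbit hT η x).continuous.continuousAt.preimage_mem_nhds
      (a.box.chart.open_source.mem_nhds ht)
  set f : ℝ → ℂ := fun r => a.frK.coef (flow η r x) (c r) with hf
  have hcont : ContinuousAt f t := by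
    have h1 : ContinuousAt (fun p : TotalSpace ℂ κ => a.frK.coef p.1 p.2)
        (TotalSpace.mk' ℂ (orbitCurve η x t) (c t)) :=
      a.frK.continuous_coef.continuousAt
        ((a.box.chart.open_source.preimage (FiberBundle.continuous_proj ℂ κ)).mem_nhds ht)
    exact ContinuousAt.comp (g := fun p : TotalSpace ℂ κ => a.frK.coef p.1 p.2)
      (f := fun t => TotalSpace.mk' ℂ (orbitCurve η x t) (c t)) h1 hc.1.continuousAt
  refine eventually_eq_of_mul_self hcont ?_
  obtain ⟨v, hv⟩ := a.exists_component_ne_zero ht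
  set C : M → ℂ := a.box.component (fun y => h.sq (a.frK.sec y)) v with hC
  have key : ∀ r, flow η r x ∈ a.box.chart.source →
      h.sq (c r) (fun i => a.box.field (v i) (flow η r x)) = f r * f r * C (flow η r x) := by
    intro r hr
    have h1 : h.sq (c r) = (f r * f r) • h.sq (a.frK.sec (flow η r x)) := by
      rw [← h.sq_smul]
      exact congrArg h.sq (a.frK.coef_smul _ hr (c r)).symm
    rw [h1]
    rfl
  have hmove : ∀ᶠ r in 𝓝 t, a.box.chart (flow η t x) + (r - t) • a.box.dir
      ∈ a.box.chart.target := by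
    have h1 : Continuous fun r : ℝ => a.box.chart (flow η t x) + (r - t) • a.box.dir := by fun_prop
    refine h1.continuousAt.preimage_mem_nhds (a.box.chart.open_target.mem_nhds ?_)
    simpa using a.box.chart.map_source ht
  filter_upwards [hmove] with r hr
  have hfl : flow η (r - t) (flow η t x) = flow η r x := flow_sub_flow η r t x
  have hrs : flow η r x ∈ a.box.chart.source := hfl ▸ (FlowBox.flow_mem ht hr).1
  have hCr : C (flow η r x) = C (flow η t x) := by
    rw [← hfl]
    exact a.component_flow hT ht hr v
  have h1 : h.sq (c r) (fun i => a.box.field (v i) (flow η r x))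
      = h.sq (c t) (fun i => a.box.field (v i) (flow η t x)) := by
    have hd : ∀ (r : ℝ) (u : E),
        (mfderiv 𝓘(ℝ, E) 𝓘(ℝ, E) (flow η r) (flow η 0 x) u : E)
          = mfderiv 𝓘(ℝ, E) 𝓘(ℝ, E) (flow η r) x u := by
      intro r u
      exact congrArg (fun y => (mfderiv 𝓘(ℝ, E) 𝓘(ℝ, E) (flow η r) y u : E)) (flow_zero η x)
    -- A half-form lift compares times `r` and `t` only through time 0, so the box fields at time
    -- `t` must be written as push-forwards of vectors at time 0. The inverse flow provides these
    -- vectors.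
    have hsurj : ∀ v : E, ∃ u : E, (mfderiv 𝓘(ℝ, E) 𝓘(ℝ, E) (flow η t) x u : E)
        = a.box.field v (flow η t x) := by
      intro v
      refine ⟨mfderiv 𝓘(ℝ, E) 𝓘(ℝ, E) (flow η (-t)) (flow η t x)
        (a.box.field v (flow η t x)), ?_⟩
      have h2 := mfderiv_flow_add (η := η) hT t (-t) (flow η t x) (a.box.field v (flow η t x))
      have h3 : (flow η (t + -t) : M → M) = id := by
        funext y
        rw [add_neg_cancel, flow_zero]
        rfl
      rw [h3] at h2
      have h4 : (mfderiv 𝓘(ℝ, E) 𝓘(ℝ, E) (id : M → M) (flow η t x)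
          (a.box.field v (flow η t x)) : E) = a.box.field v (flow η t x) := by
        rw [mfderiv_id]
        rfl
      refine Eq.trans ?_ (h2.symm.trans h4)
      exact congrArg (fun y => (mfderiv 𝓘(ℝ, E) 𝓘(ℝ, E) (flow η t) y
        (mfderiv 𝓘(ℝ, E) 𝓘(ℝ, E) (flow η (-t)) (flow η t x)
          (a.box.field v (flow η t x)) : E) : E)) (flow_neg_flow η t x).symm
    choose u hu using hsurj
    -- The same vectors pushed to time `r` give the box fields there, because the flow from `t` to
    -- `r` preserves coordinates.
    have hr' : ∀ v : E, (mfderiv 𝓘(ℝ, E) 𝓘(ℝ, E) (flow η r) x (u v) : E)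
        = a.box.field v (flow η r x) := by
      intro v
      have h2 := mfderiv_flow_add (η := η) hT (r - t) t x (u v)
      rw [sub_add_cancel] at h2
      refine h2.trans ?_
      have h3 := FlowBox.mfderiv_flow_field hT ht hr v
      refine Eq.trans ?_ (h3.trans (congrArg (fun y => (a.box.field v y : E)) hfl))
      exact congrArg (fun w : E => (mfderiv 𝓘(ℝ, E) 𝓘(ℝ, E) (flow η (r - t)) (flow η t x) w : E))
        (hu v)
    have h2 := (hc.2 r fun i => u (v i)).trans (hc.2 t fun i => u (v i)).symm
    have h3 : ∀ s, (∀ v : E, (mfderiv 𝓘(ℝ, E) 𝓘(ℝ, E) (flow η s) x (u v) : E)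
        = a.box.field v (flow η s x)) →
        h.sq (c s) (fun i => mfderiv 𝓘(ℝ, E) 𝓘(ℝ, E) (fun y : M => expT (s • η) • y)
          (orbitCurve η x 0) (u (v i))) = h.sq (c s) (fun i => a.box.field (v i) (flow η s x)) := by
      intro s hs
      refine congrArg (h.sq (c s)) (funext fun i => ?_)
      exact (hd s _).trans (hs (v i))
    rw [h3 r hr', h3 t hu] at h2
    exact h2
  rw [key r hrs, key t ht, hCr] at h1
  exact mul_right_cancel₀ hv h1

/-- The lifts that define the Bohr–Sommerfeld condition are transports. -/
theorem isTransport_of_lifts {x : M} {l : ∀ t : ℝ, L (orbitCurve η x t)}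
    {c : ∀ t : ℝ, κ (orbitCurve η x t)} (hT : SmoothTorusAction k E M)
    (hl : IsParallelLift nabla η x l) (hc : IsHalfFormLift (E := E) h η x c) (T : ℝ) :
    IsTransport nabla h η x T (fun t => l t ⊗ₜ c t) := by
  intro t _ a ha
  refine Eventually.filter_mono nhdsWithin_le_nhds ?_
  filter_upwards [hl.eventually_coef hT a ha, hc.eventually_coef hT a ha] with r hr hr'
  refine (a.coef_tmul (l r) (c r)).trans (Eq.trans ?_ (a.coef_tmul (l t) (c t)).symm)
  exact congrArg₂ (· * ·) hr hr'

end Transports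

/-! ### Primitives of differences along the flow -/

section TestFunctions

variable {k : ℕ} {E : Type*} [NormedAddCommGroup E] [NormedSpace ℝ E] [FiniteDimensional ℝ E]
  {M : Type*} [TopologicalSpace M] [T2Space M] [ChartedSpace E M] [IsManifold 𝓘(ℝ, E) ∞ M]
  [MulAction (Fin k → Circle) M] {η : Fin k → ℝ} {O O' : Set M} {f g w : M → ℂ}

theorem IsTestFun.sub (hf : IsTestFun E f O) (hg : IsTestFun E g O) :
    IsTestFun E (fun x => f x - g x) O := by
  have hs : tsupport (fun x => f x - g x) ⊆ tsupport f ∪ tsupport g := by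
    refine closure_minimal (fun x hx => ?_)
      ((isClosed_tsupport f).union (isClosed_tsupport g))
    by_contra! hc
    rw [mem_union, not_or] at hc
    refine hx ?_
    simp only [image_eq_zero_of_notMem_tsupport hc.1, image_eq_zero_of_notMem_tsupport hc.2,
      sub_zero]
  exact ⟨hf.smooth.sub hg.smooth, (hf.compact.isCompact.union hg.compact.isCompact).of_isClosed_subset
    (isClosed_tsupport _) hs, hs.trans (union_subset hf.subset hg.subset)⟩

theorem IsTestFun.mul_right (hO : IsOpen O) (hf : IsTestFun E f O)
    (hw : ContMDiffOn 𝓘(ℝ, E) 𝓘(ℝ, ℂ) ∞ w O) : IsTestFun E (fun x => f x * w x) O := by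
  have hs : tsupport (fun x => f x * w x) ⊆ tsupport f := tsupport_mul_subset_left
  refine ⟨contMDiff_of_tsupport fun x hx => ?_,
    hf.compact.of_isClosed_subset (isClosed_tsupport _) hs, hs.trans hf.subset⟩
  exact hf.smooth.contMDiffAt.cmul (hw.contMDiffAt (hO.mem_nhds (hf.subset (hs hx))))

theorem tsupport_comp_flow_subset (hT : SmoothTorusAction k E M) (η : Fin k → ℝ) (T : ℝ)
    (f : M → ℂ) : tsupport (fun y => f (flow η (-T) y)) ⊆ flow η (-T) ⁻¹' tsupport f :=
  closure_minimal (fun _ hy => subset_tsupport f hy)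
    ((isClosed_tsupport f).preimage (contMDiff_flow hT η (-T)).continuous)

theorem IsTestFun.comp_flow (hT : SmoothTorusAction k E M) (hf : IsTestFun E f O) {T : ℝ}
    (h : ∀ z ∈ O, flow η T z ∈ O') : IsTestFun E (fun y => f (flow η (-T) y)) O' := by
  have hs := tsupport_comp_flow_subset hT η T f
  refine ⟨hf.smooth.comp (contMDiff_flow hT η (-T)), ?_, fun y hy => ?_⟩
  · refine (hf.compact.isCompact.image (contMDiff_flow hT η T).continuous).of_isClosed_subset
      (isClosed_tsupport _) fun y hy => ⟨_, hs hy, flow_flow_neg η T y⟩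
  · rw [← flow_flow_neg η T y]
    exact h _ (hf.subset (hs hy))

/-- The difference of a test function in a flow box and its translate along the flow is a derivative
along the flow. -/
theorem FlowBox.exists_primitive_sub (hT : SmoothTorusAction k E M) (b : FlowBox E M η)
    (hf : IsTestFun E f b.chart.source) {δ : ℝ}
    (hδ : ∀ x ∈ tsupport f, b.chart x + δ • b.dir ∈ b.chart.target) :
    ∃ F : M → ℂ, IsTestFun E F b.chart.source ∧
      ∀ x, mvfderiv 𝓘(ℝ, E) F x (fundField η x) = f x - f (flow η (-δ) x) := by
  classical
  set K : Set E := b.chart '' tsupport f with hK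
  have hKc : IsCompact K :=
    hf.compact.isCompact.image_of_continuousOn (b.smooth.continuousOn.mono hf.subset)
  have hKt : K ⊆ b.chart.target := by
    rintro _ ⟨x, hx, rfl⟩
    exact b.chart.map_source (hf.subset hx)
  -- The coordinate expression of `f`, extended by zero; it is smooth because its support is compact
  -- in the target.
  let g : E → ℂ := fun y => if y ∈ b.chart.target then f (b.chart.symm y) else 0
  have hgK : ∀ y, g y ≠ 0 → y ∈ K := by
    intro y hy
    by_cases hyt : y ∈ b.chart.target
    · simp only [g, if_pos hyt] at hy
      exact ⟨b.chart.symm y, subset_tsupport f hy, b.chart.right_inv hyt⟩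
    · simp [g, hyt] at hy
  have hgs : ContDiff ℝ ∞ g := by
    refine ContMDiff.contDiff (contMDiff_of_tsupport fun y hy => ?_)
    have hyK : y ∈ K := closure_minimal (fun y hy => hgK y hy) hKc.isClosed hy
    have h1 : ContMDiffAt 𝓘(ℝ, E) 𝓘(ℝ, ℂ) ∞ (fun y => f (b.chart.symm y)) y :=
      hf.smooth.contMDiffAt.comp y
        (b.smooth_symm.contMDiffAt (b.chart.open_target.mem_nhds (hKt hyK)))
    refine h1.congr_of_eventuallyEq ?_
    filter_upwards [b.chart.open_target.mem_nhds (hKt hyK)] with z hz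
    exact if_pos hz
  have hgx : ∀ x ∈ b.chart.source, g (b.chart x) = f x := by
    intro x hx
    simp only [g, if_pos (b.chart.map_source hx), b.chart.left_inv hx]
  set G := segmentIntegral g δ b.dir with hG
  have hGs : ContDiff ℝ ∞ G := contDiff_segmentIntegral hgs δ b.dir
  let F : M → ℂ := fun x => if x ∈ b.chart.source then G (b.chart x) else 0
  -- The support swept forward along the segments. Convexity of the target, together with `hδ` for
  -- the far ends, keeps the sweep inside, so `F` has compact support in the box.
  set K' : Set E := (fun p : E × ℝ => p.1 + (p.2 * δ) • b.dir) '' (K ×ˢ Icc (0 : ℝ) 1) with hK'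
  have hK'c : IsCompact K' := (hKc.prod isCompact_Icc).image (by fun_prop)
  have hK't : K' ⊆ b.chart.target := by
    rintro _ ⟨⟨_, u⟩, ⟨⟨x, hx, rfl⟩, hu⟩, rfl⟩
    have h0 : (0 : ℝ) ∈ {t : ℝ | b.chart x + t • b.dir ∈ b.chart.target} := by
      simpa using b.chart.map_source (hf.subset hx)
    have h1 := b.convex_times (b.chart x) h0 (hδ x hx) (sub_nonneg.2 hu.2) hu.1 (by ring)
    simpa using h1
  have hKM : IsCompact (b.chart.symm '' K') :=
    hK'c.image_of_continuousOn (b.smooth_symm.continuousOn.mono hK't)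
  have hFs : tsupport F ⊆ b.chart.symm '' K' := by
    refine closure_minimal (fun x hx => ?_) hKM.isClosed
    by_cases hxs : x ∈ b.chart.source
    · have hx' : G (b.chart x) ≠ 0 := by
        intro h0
        exact hx (by simp only [F, if_pos hxs, h0])
      obtain ⟨u, hu, hgu⟩ := exists_of_segmentIntegral_ne_zero hx'
      exact ⟨b.chart x, ⟨⟨_, u⟩, ⟨hgK _ hgu, hu⟩, by simp⟩, b.chart.left_inv hxs⟩
    · exact absurd (by simp only [F, if_neg hxs]) hx
  have hFsrc : tsupport F ⊆ b.chart.source := by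
    rintro _ hx
    obtain ⟨y, hy, rfl⟩ := hFs hx
    exact b.chart.map_target (hK't hy)
  have hFev : ∀ x ∈ b.chart.source, F =ᶠ[𝓝 x] fun y => G (b.chart y) := by
    intro x hx
    filter_upwards [source_mem_nhds hx] with y hy
    exact if_pos hy
  refine ⟨F, ⟨contMDiff_of_tsupport fun x hx => ?_, hKM.of_isClosed_subset (isClosed_tsupport _) hFs,
    hFsrc⟩, fun x => ?_⟩
  · exact (hGs.contMDiff.contMDiffAt.comp x (contMDiffAt_chart (hFsrc hx))).congr_of_eventuallyEq
      (hFev x (hFsrc hx))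
  · have hback : f (flow η (-δ) x) ≠ 0 → x ∈ b.chart.source ∧
        b.chart x - δ • b.dir ∈ b.chart.target := by
      intro h0
      have hy := subset_tsupport f h0
      have h1 := flow_mem (hf.subset hy) (hδ _ hy)
      rw [flow_flow_neg] at h1
      refine ⟨h1.1, ?_⟩
      rw [h1.2, add_sub_cancel_right]
      exact b.chart.map_source (hf.subset hy)
    by_cases hx : x ∈ b.chart.source
    · have h1 := mvfderiv_comp_chart hx (hGs.differentiable (by simp) (b.chart x)) (fundField η x)
      have h2 : (b.coord x (fundField η x) : E) = b.dir := by
        rw [fundField_eq hT hx, coord_field hx]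
      have h3 : mvfderiv 𝓘(ℝ, E) F x = mvfderiv 𝓘(ℝ, E) (fun y => G (b.chart y)) x := by
        rw [mvfderiv, mvfderiv, (hFev x hx).mfderiv_eq, (hFev x hx).self_of_nhds]
      rw [h3, h1]
      refine (congrArg (fun e => fderiv ℝ G (b.chart x) e) h2).trans ?_
      rw [fderiv_segmentIntegral hgs, hgx x hx]
      congr 1
      by_cases ht : b.chart x - δ • b.dir ∈ b.chart.target
      · have h4 : b.chart x + (-δ) • b.dir = b.chart x - δ • b.dir := by module
        have h5 := flow_mem hx (t := -δ) (by rwa [h4])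
        rw [← h4, ← h5.2, hgx _ h5.1]
      · have h6 : f (flow η (-δ) x) = 0 := by
          by_contra h0
          exact ht (hback h0).2
        simp only [g, if_neg ht, h6]
    · have h6 : f (flow η (-δ) x) = 0 := by
        by_contra h0
        exact hx (hback h0).1
      rw [mvfderiv_eq_zero_of_notMem_tsupport (fun h => hx (hFsrc h)), h6,
        image_eq_zero_of_notMem_tsupport fun h => hx (hf.subset h), sub_zero]
      rfl

end TestFunctions

/-! ### Invariance of the distribution for short times -/

section Shift

variable {m k : ℕ} {E : Type*} [NormedAddCommGroup E] [NormedSpace ℝ E] [FiniteDimensional ℝ E]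
  {M : Type*} [TopologicalSpace M] [T2Space M] [ChartedSpace E M] [IsManifold 𝓘(ℝ, E) ∞ M]
  [MulAction (Fin k → Circle) M]
  {omega : ∀ x : M, FormAt (E := E) (Fin 2) ℝ x} {n : ℕ} {P : Polarization omega n}
  {ι : Type*} [dι : DecidableEq ι] [Fintype ι]
  {L : M → Type*} [TopologicalSpace (TotalSpace ℂ L)]
  [∀ x, AddCommGroup (L x)] [∀ x, Module ℂ (L x)] [∀ x, TopologicalSpace (L x)]
  [∀ x, IsTopologicalAddGroup (L x)] [∀ x, ContinuousSMul ℝ (L x)]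
  [FiberBundle ℂ L] [VectorBundle ℂ ℂ L] [VectorBundle ℝ ℂ L]
  [ContMDiffVectorBundle ∞ ℂ L 𝓘(ℝ, E)]
  {κ : M → Type*} [TopologicalSpace (TotalSpace ℂ κ)]
  [∀ x, AddCommGroup (κ x)] [∀ x, Module ℂ (κ x)] [∀ x, TopologicalSpace (κ x)]
  [FiberBundle ℂ κ] [VectorBundle ℂ ℂ κ] [VectorBundle ℝ ℂ κ]
  [ContMDiffVectorBundle ∞ ℂ κ 𝓘(ℝ, E)]
  {nabla : CovariantDerivative 𝓘(ℝ, E) ℂ L} {h : HalfForm κ P ι} {η : Fin k → ℝ}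
  {N : ℕ} (bE : Module.Basis (Fin N) ℝ E) {V : Set M}

/-- The distributional section `s` vanishes on the derivatives along the flow of the test sections in
the adapted box `a`. -/
structure AdaptedBox.IsInvariantOn (s : ProdDist E L κ N V) (a : AdaptedBox nabla h η) : Prop where
  subset : a.box.chart.source ⊆ V
  pair_eq_zero : ∀ f : M → ℂ, IsTestFun E f a.box.chart.source →
    pair s (a.test bE fun x => mvfderiv 𝓘(ℝ, E) f x (fundField η x)) = 0

variable {bE} {a : AdaptedBox nabla h η} {s : ProdDist E L κ N V} {f g : M → ℂ}

theorem AdaptedBox.pair_test_sub (hV : a.box.chart.source ⊆ V)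
    (hf : IsTestFun E f a.box.chart.source) (hg : IsTestFun E g a.box.chart.source) :
    pair s (a.test bE fun x => f x - g x) = pair s (a.test bE f) - pair s (a.test bE g) := by
  rw [pair_of_mem s (a.test_mem bE (hf.sub hg) ((hf.sub hg).subset.trans hV)),
    pair_of_mem s (a.test_mem bE hf (hf.subset.trans hV)),
    pair_of_mem s (a.test_mem bE hg (hg.subset.trans hV)), ← map_sub]
  congr 1
  refine Subtype.ext (funext fun x => LinearMap.ext fun z => AlternatingMap.ext fun w => ?_)
  change (f x - g x) * a.coef x z * a.box.vol bE x w
    = f x * a.coef x z * a.box.vol bE x w - g x * a.coef x z * a.box.vol bE x w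
  ring

/-- Invariance of a polarized distribution under the flow, inside an adapted box. -/
theorem AdaptedBox.IsInvariantOn.pair_flow (hT : SmoothTorusAction k E M)
    (ha : a.IsInvariantOn bE s) {O : Set M} (hO : O ⊆ a.box.chart.source)
    (hf : IsTestFun E f O) {δ : ℝ}
    (hδ : ∀ x ∈ O, a.box.chart x + δ • a.box.dir ∈ a.box.chart.target) :
    pair s (a.test bE f) = pair s (a.test bE fun x => f (flow η (-δ) x)) := by
  obtain ⟨F, hF, hFf⟩ := a.box.exists_primitive_sub hT (hf.mono hO) fun x hx => hδ x (hf.subset hx)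
  have h0 := ha.pair_eq_zero F hF
  simp only [hFf] at h0
  rw [AdaptedBox.pair_test_sub ha.subset (hf.mono hO)
    (hf.comp_flow hT fun z hz => (FlowBox.flow_mem (hO hz) (hδ z hz)).1)] at h0
  exact sub_eq_zero.1 h0

end Shift

/-! ### Product and chain rules along the flow -/

section FlowDerivative

variable {k : ℕ} {E : Type*} [NormedAddCommGroup E] [NormedSpace ℝ E] [FiniteDimensional ℝ E]
  {M : Type*} [TopologicalSpace M] [ChartedSpace E M] [IsManifold 𝓘(ℝ, E) ∞ M]
  [MulAction (Fin k → Circle) M] {η : Fin k → ℝ}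
  {F : Type*} [NormedAddCommGroup F] [NormedSpace ℝ F]

theorem mvfderiv_cmul {f g : M → ℂ} {x : M} (hf : MDifferentiableAt 𝓘(ℝ, E) 𝓘(ℝ, ℂ) f x)
    (hg : MDifferentiableAt 𝓘(ℝ, E) 𝓘(ℝ, ℂ) g x) (v : TangentSpace 𝓘(ℝ, E) x) :
    mvfderiv 𝓘(ℝ, E) (fun y => f y * g y) x v
      = f x * mvfderiv 𝓘(ℝ, E) g x v + g x * mvfderiv 𝓘(ℝ, E) f x v :=
  DFunLike.congr_fun (hf.hasMFDerivAt.mul hg.hasMFDerivAt).mfderiv v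

theorem mvfderiv_comp_flow (hT : SmoothTorusAction k E M) {f : M → F} {t : ℝ} {x : M}
    (hf : MDifferentiableAt 𝓘(ℝ, E) 𝓘(ℝ, F) f (flow η t x)) (v : TangentSpace 𝓘(ℝ, E) x) :
    mvfderiv 𝓘(ℝ, E) (fun y => f (flow η t y)) x v
      = mvfderiv 𝓘(ℝ, E) f (flow η t x) (mfderiv 𝓘(ℝ, E) 𝓘(ℝ, E) (flow η t) x v) :=
  DFunLike.congr_fun (HasMFDerivAt.comp (g := f) x hf.hasMFDerivAt
    (FlowBox.mdifferentiableAt_flow hT t x).hasMFDerivAt).mfderiv v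

theorem mvfderiv_flow_of_invariant (hT : SmoothTorusAction k E M) {f : M → F}
    (hf : ContMDiff 𝓘(ℝ, E) 𝓘(ℝ, F) ∞ f) (hinv : ∀ t y, f (flow η t y) = f y) (t : ℝ) (x : M)
    (v : TangentSpace 𝓘(ℝ, E) x) :
    mvfderiv 𝓘(ℝ, E) f (flow η t x) (mfderiv 𝓘(ℝ, E) 𝓘(ℝ, E) (flow η t) x v)
      = mvfderiv 𝓘(ℝ, E) f x v := by
  rw [← mvfderiv_comp_flow hT (hf.mdifferentiableAt (by simp))]
  have h : (fun y => f (flow η t y)) = f := funext fun y => hinv t y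
  have h' : ∀ g : M → F, g = f → mvfderiv 𝓘(ℝ, E) g x v = mvfderiv 𝓘(ℝ, E) f x v := by
    rintro _ rfl
    rfl
  exact h' _ h

end FlowDerivative

/-! ### Change of adapted box; the connection form along the flow -/

section Transition

variable {k : ℕ} {E : Type*} [NormedAddCommGroup E] [NormedSpace ℝ E] [FiniteDimensional ℝ E]
  {M : Type*} [TopologicalSpace M] [T2Space M] [ChartedSpace E M] [IsManifold 𝓘(ℝ, E) ∞ M]
  [MulAction (Fin k → Circle) M]
  {omega : ∀ x : M, FormAt (E := E) (Fin 2) ℝ x} {n : ℕ} {P : Polarization omega n}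
  {μ : M → Fin k → ℝ}
  {ι : Type*} [dι : DecidableEq ι] [Fintype ι]
  {L : M → Type*} [TopologicalSpace (TotalSpace ℂ L)]
  [∀ x, AddCommGroup (L x)] [∀ x, Module ℂ (L x)] [∀ x, TopologicalSpace (L x)]
  [∀ x, IsTopologicalAddGroup (L x)] [∀ x, ContinuousSMul ℝ (L x)]
  [FiberBundle ℂ L] [VectorBundle ℂ ℂ L] [VectorBundle ℝ ℂ L]
  [ContMDiffVectorBundle ∞ ℂ L 𝓘(ℝ, E)]
  {κ : M → Type*} [TopologicalSpace (TotalSpace ℂ κ)]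
  [∀ x, AddCommGroup (κ x)] [∀ x, Module ℂ (κ x)] [∀ x, TopologicalSpace (κ x)]
  [FiberBundle ℂ κ] [VectorBundle ℂ ℂ κ] [VectorBundle ℝ ℂ κ]
  [ContMDiffVectorBundle ∞ ℂ κ 𝓘(ℝ, E)]
  {nabla : CovariantDerivative 𝓘(ℝ, E) ℂ L} {h : HalfForm κ P ι} {η : Fin k → ℝ}
  {N : ℕ} (bE : Module.Basis (Fin N) ℝ E)

namespace AdaptedBox

variable {a a' : AdaptedBox nabla h η} {x : M}

variable (a a') in
/-- The transition function between the frames of `L`. -/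
def transL (x : M) : ℂ := a'.frL.coef x (a.frL.sec x)

variable (a a') in
/-- The transition function between the frames of `κ`. -/
def transK (x : M) : ℂ := a'.frK.coef x (a.frK.sec x)

variable (a a') in
/-- The transition function between the volume forms. -/
def transV (x : M) : ℂ := a'.box.vol bE x fun i => a.box.field (bE i) x

theorem contMDiffOn_transL : ContMDiffOn 𝓘(ℝ, E) 𝓘(ℝ, ℂ) ∞ (a.transL a')
    (a'.box.chart.source ∩ a.box.chart.source) :=
  a'.frL.smooth_coef _ a.box.chart.open_source _ a.frL.smooth_sec

theorem contMDiffOn_transK : ContMDiffOn 𝓘(ℝ, E) 𝓘(ℝ, ℂ) ∞ (a.transK a')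
    (a'.box.chart.source ∩ a.box.chart.source) :=
  a'.frK.smooth_coef _ a.box.chart.open_source _ a.frK.smooth_sec

theorem contMDiffOn_transV : ContMDiffOn 𝓘(ℝ, E) 𝓘(ℝ, ℂ) ∞ (a.transV bE a')
    (a'.box.chart.source ∩ a.box.chart.source) := by
  have hcs : CompleteSpace E := FiniteDimensional.complete ℝ E
  exact a'.box.contMDiffOn_vol bE a.box.chart.open_source fun i => a.box.smoothFieldOn_field (bE i)

theorem coef_trans (hx : x ∈ a.box.chart.source) (z : L x ⊗[ℂ] κ x) :
    a'.coef x z = a.transL a' x * a.transK a' x * a.coef x z := by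
  conv_lhs => rw [← a.coef_smul_sec hx z, map_smul, coef_sec_mul]
  rw [smul_eq_mul, mul_comm]
  rfl

theorem sq_trans (hx : x ∈ a'.box.chart.source) (w : ι → TangentSpace 𝓘(ℝ, E) x) :
    h.sq (a.frK.sec x) w
      = a.transK a' x * a.transK a' x * h.sq (a'.frK.sec x) w := by
  rw [← smul_eq_mul, ← AlternatingMap.smul_apply, ← h.sq_smul]
  congr 2
  exact (a'.frK.coef_smul x hx _).symm

theorem vol_trans (hx : x ∈ a.box.chart.source) (w : Fin N → TangentSpace 𝓘(ℝ, E) x) :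
    a'.box.vol bE x w = a.transV bE a' x * a.box.vol bE x w := by
  have h1 := eq_smul_det bE ((a'.box.vol bE x).compLinearMap (FlowBox.fieldMap hx))
    (fun i => a.box.coord x (w i))
  have h2 : (fun i => FlowBox.fieldMap hx (a.box.coord x (w i))) = w :=
    funext fun i => FlowBox.field_coord hx (w i)
  rw [AlternatingMap.compLinearMap_apply] at h1
  refine Eq.trans ?_ h1
  rw [h2]

/-- The gauge transformation rule for connection forms, in a multiplicative shape that needs no
division by the transition function. -/
theorem theta_trans (hL : IsPrequantum omega nabla) (hx : x ∈ a.box.chart.source)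
    (hx' : x ∈ a'.box.chart.source) (v : TangentSpace 𝓘(ℝ, E) x) :
    a.theta x v * a.transL a' x
      = mvfderiv 𝓘(ℝ, E) (a.transL a') x v + a.transL a' x * a'.theta x v := by
  refine Eq.trans ?_ (a'.coef_nabla hL a.box.chart.open_source a.frL.smooth_sec hx' hx v)
  conv_rhs => rw [← a.frL.coef_smul x hx (nabla a.frL.sec x v), map_smul]
  rfl

/-- A test section is a function times the coordinate on L ⊗ κ times the volume form, so changing
box costs one factor for each of L, κ and the volume. -/
theorem test_trans {g : M → ℂ} (hg : ∀ x, g x ≠ 0 → x ∈ a.box.chart.source) :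
    (a.test bE fun x => g x * (a.transL a' x * a.transK a' x * a.transV bE a' x))
      = a'.test bE g := by
  refine funext fun x => LinearMap.ext fun z => AlternatingMap.ext fun w => ?_
  rw [test_apply, test_apply]
  by_cases hx : g x = 0
  · simp only [hx, zero_mul]
  · rw [coef_trans (a' := a') (hg x hx) z, vol_trans bE (a' := a') (hg x hx) w]
    ring

theorem vol_flow (hT : SmoothTorusAction k E M) (hx : x ∈ a.box.chart.source) {t : ℝ}
    (ht : a.box.chart x + t • a.box.dir ∈ a.box.chart.target)
    (w : Fin N → TangentSpace 𝓘(ℝ, E) x) :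
    a.box.vol bE (flow η t x) (fun i => mfderiv 𝓘(ℝ, E) 𝓘(ℝ, E) (flow η t) x (w i))
      = a.box.vol bE x w := by
  rw [FlowBox.vol_apply, FlowBox.vol_apply]
  simp only [FlowBox.coord_mfderiv_flow hT hx ht]

/-- The connection form along the flow. -/
theorem theta_flow (hμ : IsHamiltonianTorusAction omega μ) (hL : IsPrequantum omega nabla)
    (hx : x ∈ a.box.chart.source) {t : ℝ}
    (ht : a.box.chart x + t • a.box.dir ∈ a.box.chart.target) (u : TangentSpace 𝓘(ℝ, E) x) :
    a.theta (flow η t x) (mfderiv 𝓘(ℝ, E) 𝓘(ℝ, E) (flow η t) x u)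
      = a.theta x u - t * (Complex.I * (mvfderiv 𝓘(ℝ, E) (momentComp μ η) x u : ℝ)) := by
  have hT : SmoothTorusAction k E M := hμ.smooth_action
  set v : E := a.box.coord x u with hv
  set c : ℝ := mvfderiv 𝓘(ℝ, E) (momentComp μ η) x u with hc
  have hu : a.box.field v x = u := FlowBox.field_coord hx u
  set S := {t : ℝ | a.box.chart x + t • a.box.dir ∈ a.box.chart.target} with hS
  have hfl : ∀ r ∈ S, a.box.field v (flow η r x)
      = mfderiv 𝓘(ℝ, E) 𝓘(ℝ, E) (flow η r) x u := by
    intro r hr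
    rw [← FlowBox.mfderiv_flow_field hT hx hr v]
    exact congrArg (fun w : E => (mfderiv 𝓘(ℝ, E) 𝓘(ℝ, E) (flow η r) x w : E)) hu
  -- The connection form changes along the flow at the rate -iω(X, ·) = -i dμ_η by curvature and the
  -- moment map equation. As dμ_η is flow invariant, the rate is the constant -ic, and adding `r`
  -- times ic gives a constant.
  have h1 : ∀ r ∈ S, HasDerivAt (fun r : ℝ => a.theta (flow η r x) (a.box.field v (flow η r x))
      + r * (Complex.I * (c : ℂ))) 0 r := by
    intro r hr
    have hm := (FlowBox.flow_mem hx hr).1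
    have d1 := hasDerivAt_flow (η := η) hT (f := fun y => a.theta y (a.box.field v y))
      (((a.contMDiffOn_theta hL v).contMDiffAt (FlowBox.source_mem_nhds hm)).mdifferentiableAt
        (by simp))
    rw [a.mvfderiv_theta hT hL hm v, hμ.moment] at d1
    have e1 : (mvfderiv 𝓘(ℝ, E) (fun y => ∑ i, μ y i * η i) (flow η r x)
        (a.box.field v (flow η r x)) : ℝ) = c := by
      rw [hfl r hr]
      exact mvfderiv_flow_of_invariant hT (hμ.contMDiff_momentComp η)
        (fun t y => hμ.momentComp_flow η η t y) r x u
    rw [e1] at d1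
    have d2 : HasDerivAt (fun r : ℝ => (r : ℂ) * (Complex.I * (c : ℂ)))
        (Complex.I * (c : ℂ)) r := by
      simpa using (Complex.ofRealCLM.hasDerivAt (x := r)).mul_const (Complex.I * (c : ℂ))
    have d3 := d1.add d2
    rw [neg_add_cancel] at d3
    exact d3
  have h0 : (0 : ℝ) ∈ S := by
    simpa [hS] using a.box.chart.map_source hx
  have h2 := (a.box.isOpen_times (a.box.chart x)).is_const_of_deriv_eq_zero
    (a.box.convex_times (a.box.chart x)).isPreconnected
    (fun s hs => (h1 s hs).differentiableAt.differentiableWithinAt)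
    (fun s hs => (h1 s hs).deriv) ht h0
  simp only [Complex.ofReal_zero, zero_mul, add_zero] at h2
  have h3 : a.theta (flow η 0 x) (a.box.field v (flow η 0 x)) = a.theta x u := by
    refine Eq.trans (congrArg (fun y => a.theta y (a.box.field v y)) (flow_zero η x)) ?_
    rw [hu]
  rw [hfl t ht, h3] at h2
  rw [← h2]
  ring

end AdaptedBox

end Transition

/-! ### Continuation of the invariance along an orbit -/

section Continuation

variable {k : ℕ} {E : Type*} [NormedAddCommGroup E] [NormedSpace ℝ E] [FiniteDimensional ℝ E]
  {M : Type*} [TopologicalSpace M] [T2Space M] [ChartedSpace E M] [IsManifold 𝓘(ℝ, E) ∞ M]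
  [MulAction (Fin k → Circle) M]
  {omega : ∀ x : M, FormAt (E := E) (Fin 2) ℝ x} {n : ℕ} {P : Polarization omega n}
  {ι : Type*} [dι : DecidableEq ι] [Fintype ι]
  {L : M → Type*} [TopologicalSpace (TotalSpace ℂ L)]
  [∀ x, AddCommGroup (L x)] [∀ x, Module ℂ (L x)] [∀ x, TopologicalSpace (L x)]
  [∀ x, IsTopologicalAddGroup (L x)] [∀ x, ContinuousSMul ℝ (L x)]
  [FiberBundle ℂ L] [VectorBundle ℂ ℂ L] [VectorBundle ℝ ℂ L]
  [ContMDiffVectorBundle ∞ ℂ L 𝓘(ℝ, E)]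
  {κ : M → Type*} [TopologicalSpace (TotalSpace ℂ κ)]
  [∀ x, AddCommGroup (κ x)] [∀ x, Module ℂ (κ x)] [∀ x, TopologicalSpace (κ x)]
  [FiberBundle ℂ κ] [VectorBundle ℂ ℂ κ] [VectorBundle ℝ ℂ κ]
  [ContMDiffVectorBundle ∞ ℂ κ 𝓘(ℝ, E)]
  {nabla : CovariantDerivative 𝓘(ℝ, E) ℂ L} {h : HalfForm κ P ι} {η : Fin k → ℝ}
  {N : ℕ} (bE : Module.Basis (Fin N) ℝ E) {V : Set M}

/-- The transport by the flow of `η` up to time `T`, near the point `q`: an adapted box at the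
transported point, and the coefficients `gL`, `gK` and `gV` by which the frames of `L` and `κ` and
the volume form of the box `a₀` are multiplied. -/
structure Continuation (s : ProdDist E L κ N V) (μ : M → Fin k → ℝ) (a₀ : AdaptedBox nabla h η)
    (q : M) (T : ℝ) where
  /-- the adapted box at the transported point -/
  a : AdaptedBox nabla h η
  invariant : a.IsInvariantOn bE s
  /-- the neighbourhood on which the transport is described -/
  nhd : Set M
  isOpen : IsOpen nhd
  mem : q ∈ nhd
  subset : nhd ⊆ a₀.box.chart.source
  maps : ∀ z ∈ nhd, flow η T z ∈ a.box.chart.source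
  /-- the coefficient for `L` -/
  gL : M → ℂ
  /-- the coefficient for `κ` -/
  gK : M → ℂ
  /-- the coefficient for the volume form -/
  gV : M → ℂ
  smooth_gL : ContMDiffOn 𝓘(ℝ, E) 𝓘(ℝ, ℂ) ∞ gL nhd
  smooth_gK : ContMDiffOn 𝓘(ℝ, E) 𝓘(ℝ, ℂ) ∞ gK nhd
  smooth_gV : ContMDiffOn 𝓘(ℝ, E) 𝓘(ℝ, ℂ) ∞ gV nhd
  -- Flow invariance of `s` from time 0 to `T`, with both ends expressed in their own boxes; the
  -- three coefficients account for the changes of box in between.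
  pairing : ∀ g : M → ℂ, IsTestFun E g nhd →
    pair s (a₀.test bE fun z => g z * (gL z * gK z * gV z))
      = pair s (a.test bE fun y => g (flow η (-T) y))
  transport : ∀ z ∈ nhd, ∀ l : ∀ t : ℝ, L (flow η t z) ⊗[ℂ] κ (flow η t z),
    IsTransport nabla h η z 1 l →
      a.coef (flow η T z) (l T) = gL z * gK z * a₀.coef (flow η 0 z) (l 0)
  -- Only the square of `gK` is constrained here, which leaves the sign seen in the holonomy.
  sq : ∀ z ∈ nhd, ∀ w : ι → TangentSpace 𝓘(ℝ, E) z,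
    gK z * gK z * h.sq (a.frK.sec (flow η T z))
      (fun i => mfderiv 𝓘(ℝ, E) 𝓘(ℝ, E) (flow η T) z (w i)) = h.sq (a₀.frK.sec z) w
  vol : ∀ z ∈ nhd, ∀ w : Fin N → TangentSpace 𝓘(ℝ, E) z,
    a.box.vol bE (flow η T z) (fun i => mfderiv 𝓘(ℝ, E) 𝓘(ℝ, E) (flow η T) z (w i))
      = gV z * a₀.box.vol bE z w
  -- Where `gL` is nonzero: the pulled back connection form plus d log `gL` is the initial
  -- connection form minus iT dμ_η. At time 1 this yields the differential equation of the holonomy.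
  theta : ∀ z ∈ nhd, ∀ v : TangentSpace 𝓘(ℝ, E) z,
    a.theta (flow η T z) (mfderiv 𝓘(ℝ, E) 𝓘(ℝ, E) (flow η T) z v) * gL z
        + mvfderiv 𝓘(ℝ, E) gL z v
      = (a₀.theta z v - T * (Complex.I * (mvfderiv 𝓘(ℝ, E) (momentComp μ η) z v : ℝ))) * gL z

variable {bE} {s : ProdDist E L κ N V} {μ : M → Fin k → ℝ} {a₀ : AdaptedBox nabla h η}
  {q : M} {T T' : ℝ}

namespace Continuation

theorem mfderiv_flow_zero (x : M) (v : TangentSpace 𝓘(ℝ, E) x) :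
    (mfderiv 𝓘(ℝ, E) 𝓘(ℝ, E) (flow η 0) x v : E) = v := by
  have h : (flow η 0 : M → M) = id := funext fun y => flow_zero η y
  rw [h, mfderiv_id]
  rfl

/-- The continuation up to time `0`. -/
theorem nonempty_zero (h₀ : a₀.IsInvariantOn bE s) (hq : q ∈ a₀.box.chart.source) :
    Nonempty (Continuation bE s μ a₀ q 0) := by
  refine ⟨⟨a₀, h₀, _, a₀.box.chart.open_source, hq, subset_rfl, fun z hz => ?_, fun _ => 1,
    fun _ => 1, fun _ => 1, contMDiffOn_const, contMDiffOn_const, contMDiffOn_const, fun g _ => ?_,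
    fun z _ l _ => ?_, fun z _ w => ?_, fun z _ w => ?_, fun z _ v => ?_⟩⟩
  · rwa [flow_zero]
  · simp only [mul_one, neg_zero, flow_zero]
  · ring
  · rw [one_mul, one_mul]
    have h1 : ∀ (y : M) (hy : y = z) (w' : ι → E), w' = w →
        h.sq (a₀.frK.sec y) w' = h.sq (a₀.frK.sec z) w := by
      rintro _ rfl _ rfl
      rfl
    exact h1 _ (flow_zero η z) _ (funext fun i => mfderiv_flow_zero z (w i))
  · rw [one_mul]
    have h1 : ∀ (y : M) (hy : y = z) (w' : Fin N → E), w' = w →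
        a₀.box.vol bE y w' = a₀.box.vol bE z w := by
      rintro _ rfl _ rfl
      rfl
    exact h1 _ (flow_zero η z) _ (funext fun i => mfderiv_flow_zero z (w i))
  · have h1 : ∀ (y : M) (hy : y = z) (v' : E), v' = v → a₀.theta y v' = a₀.theta z v := by
      rintro _ rfl _ rfl
      rfl
    have h2 : mvfderiv 𝓘(ℝ, E) (fun _ : M => (1 : ℂ)) z = 0 := mvfderiv_const _
    have h3 := h1 _ (flow_zero η z) _ (mfderiv_flow_zero (η := η) z v)
    have h4 : mvfderiv 𝓘(ℝ, E) (fun _ : M => (1 : ℂ)) z v = 0 := DFunLike.congr_fun h2 v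
    rw [h4, Complex.ofReal_zero, zero_mul, sub_zero, add_zero]
    exact congrArg (· * (1 : ℂ)) h3

/-- Continuation inside the box. -/
theorem extend (hμ : IsHamiltonianTorusAction omega μ) (hL : IsPrequantum omega nabla)
    (c : Continuation bE s μ a₀ q T) (hTI : T ∈ Icc (0 : ℝ) 1) (hTI' : T' ∈ Icc (0 : ℝ) 1)
    (hq : c.a.box.chart (flow η T q) + (T' - T) • c.a.box.dir ∈ c.a.box.chart.target) :
    Nonempty (Continuation bE s μ a₀ q T') := by
  have hT : SmoothTorusAction k E M := hμ.smooth_action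
  -- Points of the box whose translates for time `T' - T` are still in it. On the part of `nhd`
  -- mapped there the coefficients need no change.
  set O' : Set M := c.a.box.chart.source ∩
    (fun y => c.a.box.chart y + (T' - T) • c.a.box.dir) ⁻¹' c.a.box.chart.target with hO'
  have hO'o : IsOpen O' :=
    (c.a.box.smooth.continuousOn.add continuousOn_const).isOpen_inter_preimage
      c.a.box.chart.open_source c.a.box.chart.open_target
  set O : Set M := c.nhd ∩ flow η T ⁻¹' O' with hO
  have hOo : IsOpen O := c.isOpen.inter (hO'o.preimage (contMDiff_flow hT η T).continuous)
  have hTT : T' - T + T = T' := by ring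
  have hd : ∀ (z : M) (v : TangentSpace 𝓘(ℝ, E) z),
      (mfderiv 𝓘(ℝ, E) 𝓘(ℝ, E) (flow η T') z v : E)
        = mfderiv 𝓘(ℝ, E) 𝓘(ℝ, E) (flow η (T' - T)) (flow η T z)
            (mfderiv 𝓘(ℝ, E) 𝓘(ℝ, E) (flow η T) z v) := by
    intro z v
    rw [← mfderiv_flow_add hT, hTT]
  have hfl : ∀ z : M, flow η T' z = flow η (T' - T) (flow η T z) := fun z => by
    rw [← flow_add, hTT]
  refine ⟨⟨c.a, c.invariant, O, hOo, ⟨c.mem, c.maps q c.mem, hq⟩,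
    inter_subset_left.trans c.subset, fun z hz => ?_, c.gL, c.gK, c.gV,
    c.smooth_gL.mono inter_subset_left, c.smooth_gK.mono inter_subset_left,
    c.smooth_gV.mono inter_subset_left, fun g hg => ?_, fun z hz l hl => ?_, fun z hz w => ?_,
    fun z hz w => ?_, fun z hz v => ?_⟩⟩
  · rw [hfl]
    exact (FlowBox.flow_mem hz.2.1 hz.2.2).1
  · rw [c.pairing g (hg.mono inter_subset_left),
      c.invariant.pair_flow hT (O := O') inter_subset_left (hg.comp_flow hT fun z hz => hz.2)
        (δ := T' - T) fun y hy => hy.2]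
    congr 2
    funext y
    rw [← flow_add]
    congr 2
    ring
  · rw [← c.transport z hz.1 l hl]
    refine hl.coef_eq c.a hTI' hTI fun r hr => ?_
    rw [← flow_sub_flow η r T z]
    refine (FlowBox.flow_mem hz.2.1 ?_).1
    have h0 : (0 : ℝ) ∈ {t : ℝ | c.a.box.chart (flow η T z) + t • c.a.box.dir
        ∈ c.a.box.chart.target} := by
      simpa using c.a.box.chart.map_source hz.2.1
    refine (c.a.box.convex_times _).ordConnected.uIcc_subset hz.2.2 h0 ?_
    rcases le_total T T' with h1 | h1
    · rw [uIcc_of_ge h1] at hr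
      rw [uIcc_of_ge (sub_nonneg.2 h1)]
      exact ⟨sub_nonneg.2 hr.1, sub_le_sub_right hr.2 T⟩
    · rw [uIcc_of_le h1] at hr
      rw [uIcc_of_le (sub_nonpos.2 h1)]
      exact ⟨sub_le_sub_right hr.1 T, sub_nonpos.2 hr.2⟩
  · rw [← c.sq z hz.1 w, ← c.a.sq_flow hT hz.2.1 hz.2.2]
    have h1 : ∀ (y : M) (hy : flow η T' z = y) (w' : ι → E),
        (fun i => (mfderiv 𝓘(ℝ, E) 𝓘(ℝ, E) (flow η T') z (w i) : E)) = w' →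
        h.sq (c.a.frK.sec (flow η T' z))
          (fun i => mfderiv 𝓘(ℝ, E) 𝓘(ℝ, E) (flow η T') z (w i))
          = h.sq (c.a.frK.sec y) w' := by
      rintro _ rfl _ rfl
      rfl
    exact congrArg _ (h1 _ (hfl z) _ (funext fun i => hd z (w i)))
  · rw [← c.vol z hz.1 w, ← c.a.vol_flow bE hT hz.2.1 hz.2.2]
    have h1 : ∀ (y : M) (hy : flow η T' z = y) (w' : Fin N → E),
        (fun i => (mfderiv 𝓘(ℝ, E) 𝓘(ℝ, E) (flow η T') z (w i) : E)) = w' →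
        c.a.box.vol bE (flow η T' z)
          (fun i => mfderiv 𝓘(ℝ, E) 𝓘(ℝ, E) (flow η T') z (w i))
          = c.a.box.vol bE y w' := by
      rintro _ rfl _ rfl
      rfl
    exact h1 _ (hfl z) _ (funext fun i => hd z (w i))
  · have h1 : ∀ (y : M) (hy : flow η T' z = y) (v' : E),
        (mfderiv 𝓘(ℝ, E) 𝓘(ℝ, E) (flow η T') z v : E) = v' →
        c.a.theta (flow η T' z) (mfderiv 𝓘(ℝ, E) 𝓘(ℝ, E) (flow η T') z v)
          = c.a.theta y v' := by
      rintro _ rfl _ rfl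
      rfl
    -- The known relation carries the time factor `T`, and the flow inside the box adds `T' - T`;
    -- dμ_η is pulled back to `z` by invariance.
    have h2 := c.theta z hz.1 v
    have h3 := c.a.theta_flow hμ hL hz.2.1 hz.2.2 (mfderiv 𝓘(ℝ, E) 𝓘(ℝ, E) (flow η T) z v)
    rw [mvfderiv_flow_of_invariant hT (hμ.contMDiff_momentComp η)
        (fun t y => hμ.momentComp_flow η η t y) T z v] at h3
    rw [h1 _ (hfl z) _ (hd z v), h3]
    push_cast
    linear_combination h2

/-- Change of the box. -/
def change (hT : SmoothTorusAction k E M) (hL : IsPrequantum omega nabla)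
    (c : Continuation bE s μ a₀ q T) (a' : AdaptedBox nabla h η) (ha' : a'.IsInvariantOn bE s)
    (hq : flow η T q ∈ a'.box.chart.source) : Continuation bE s μ a₀ q T where
  a := a'
  invariant := ha'
  nhd := c.nhd ∩ flow η T ⁻¹' a'.box.chart.source
  isOpen := c.isOpen.inter
    (a'.box.chart.open_source.preimage (contMDiff_flow hT η T).continuous)
  mem := ⟨c.mem, hq⟩
  subset := inter_subset_left.trans c.subset
  maps z hz := hz.2
  gL z := c.gL z * c.a.transL a' (flow η T z)
  gK z := c.gK z * c.a.transK a' (flow η T z)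
  gV z := c.gV z * c.a.transV bE a' (flow η T z)
  smooth_gL := (c.smooth_gL.mono inter_subset_left).cmul
    (AdaptedBox.contMDiffOn_transL.comp (contMDiff_flow hT η T).contMDiffOn
      fun z hz => ⟨hz.2, c.maps z hz.1⟩)
  smooth_gK := (c.smooth_gK.mono inter_subset_left).cmul
    (AdaptedBox.contMDiffOn_transK.comp (contMDiff_flow hT η T).contMDiffOn
      fun z hz => ⟨hz.2, c.maps z hz.1⟩)
  smooth_gV := (c.smooth_gV.mono inter_subset_left).cmul
    ((AdaptedBox.contMDiffOn_transV bE).comp (contMDiff_flow hT η T).contMDiffOn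
      fun z hz => ⟨hz.2, c.maps z hz.1⟩)
  pairing g hg := by
    have hO : IsOpen (c.nhd ∩ flow η T ⁻¹' a'.box.chart.source) := c.isOpen.inter
      (a'.box.chart.open_source.preimage (contMDiff_flow hT η T).continuous)
    have hw : ContMDiffOn 𝓘(ℝ, E) 𝓘(ℝ, ℂ) ∞ (fun z => c.a.transL a' (flow η T z)
        * c.a.transK a' (flow η T z) * c.a.transV bE a' (flow η T z))
        (c.nhd ∩ flow η T ⁻¹' a'.box.chart.source) :=
      ((AdaptedBox.contMDiffOn_transL.cmul AdaptedBox.contMDiffOn_transK).cmul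
        (AdaptedBox.contMDiffOn_transV bE)).comp (contMDiff_flow hT η T).contMDiffOn
          fun z hz => ⟨hz.2, c.maps z hz.1⟩
    -- The old relation is used for `g` times the transition functions read at time `T`; on the
    -- other side these factors convert the test section of the old box into that of `a'`.
    have h1 := c.pairing _ ((hg.mul_right hO hw).mono inter_subset_left)
    simp only [flow_flow_neg] at h1
    rw [AdaptedBox.test_trans bE (a' := a') (g := fun y => g (flow η (-T) y))] at h1
    · rw [← h1]
      congr 2
      funext z
      ring
    · intro x hx
      have hm := c.maps _ (hg.subset (subset_tsupport g hx)).1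
      rwa [flow_flow_neg] at hm
  transport z hz l hl := by
    rw [AdaptedBox.coef_trans (c.maps z hz.1), c.transport z hz.1 l hl]
    ring
  sq z hz w := by
    rw [← c.sq z hz.1 w, AdaptedBox.sq_trans (a := c.a) hz.2]
    ring
  vol z hz w := by
    rw [AdaptedBox.vol_trans bE (c.maps z hz.1), c.vol z hz.1]
    ring
  theta z hz v := by
    have hm := c.maps z hz.1
    have h1 := c.theta z hz.1 v
    have h2 := AdaptedBox.theta_trans hL hm hz.2 (mfderiv 𝓘(ℝ, E) 𝓘(ℝ, E) (flow η T) z v)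
    have hu : MDifferentiableAt 𝓘(ℝ, E) 𝓘(ℝ, ℂ) (c.a.transL a') (flow η T z) :=
      (AdaptedBox.contMDiffOn_transL.contMDiffAt
        ((a'.box.chart.open_source.inter c.a.box.chart.open_source).mem_nhds
          ⟨hz.2, hm⟩)).mdifferentiableAt (by simp)
    have hG : MDifferentiableAt 𝓘(ℝ, E) 𝓘(ℝ, ℂ) c.gL z :=
      (c.smooth_gL.contMDiffAt (c.isOpen.mem_nhds hz.1)).mdifferentiableAt (by simp)
    rw [mvfderiv_cmul (g := fun z => c.a.transL a' (flow η T z)) hG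
        (hu.comp z (FlowBox.mdifferentiableAt_flow hT T z)),
      mvfderiv_comp_flow hT hu]
    linear_combination c.a.transL a' (flow η T z) * h1 - c.gL z * h2

/-- The times that a continuation reaches form an open and closed subset of [0, 1]: for nearby
times, one changes to an invariant box around the orbit point and then slides inside it, forwards or
backwards. -/
theorem nonempty_of_exists (hμ : IsHamiltonianTorusAction omega μ)
    (hL : IsPrequantum omega nabla) (h₀ : a₀.IsInvariantOn bE s) (hq : q ∈ a₀.box.chart.source)
    (hbox : ∀ t : ℝ, ∃ a : AdaptedBox nabla h η, flow η t q ∈ a.box.chart.source ∧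
      a.IsInvariantOn bE s) :
    Nonempty (Continuation bE s μ a₀ q 1) := by
  have hT : SmoothTorusAction k E M := hμ.smooth_action
  have h1 := (isPreconnected_Icc (a := (0 : ℝ)) (b := 1)).eq_of_eventually_eq
    (f := fun T => Nonempty (Continuation bE s μ a₀ q T)) (fun T hTI => ?_)
    (left_mem_Icc.2 zero_le_one) (right_mem_Icc.2 zero_le_one)
  · exact cast h1 (nonempty_zero h₀ hq)
  obtain ⟨a, haq, ha⟩ := hbox T
  have hev : ∀ᶠ r : ℝ in 𝓝 T, a.box.chart (flow η T q) + (r - T) • a.box.dir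
      ∈ a.box.chart.target := by
    have hc : Continuous fun r : ℝ => a.box.chart (flow η T q) + (r - T) • a.box.dir := by
      fun_prop
    refine hc.continuousAt.preimage_mem_nhds (a.box.chart.open_target.mem_nhds ?_)
    simpa using a.box.chart.map_source haq
  filter_upwards [nhdsWithin_le_nhds hev, self_mem_nhdsWithin] with T' hT' hTI'
  have hfl := FlowBox.flow_mem haq hT'
  rw [flow_sub_flow] at hfl
  refine propext ⟨fun ⟨c⟩ => ?_, fun ⟨c⟩ => ?_⟩
  -- Here the change of box happens at the nearby time `T'`, followed by a slide to `T`.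
  · refine (c.change hT hL a ha hfl.1).extend hμ hL hTI' hTI ?_
    change a.box.chart (flow η T' q) + (T - T') • a.box.dir ∈ a.box.chart.target
    rw [hfl.2, add_assoc, ← add_smul, sub_add_sub_cancel', sub_self, zero_smul, add_zero]
    exact a.box.chart.map_source haq
  · exact (c.change hT hL a ha haq).extend hμ hL hTI hTI' hT'

end Continuation

end Continuation

/-! ### The holonomy function and its dependence on the point -/

section Holonomy

variable {k : ℕ} {E : Type*} [NormedAddCommGroup E] [NormedSpace ℝ E] [FiniteDimensional ℝ E]
  {M : Type*} [TopologicalSpace M] [T2Space M] [ChartedSpace E M] [IsManifold 𝓘(ℝ, E) ∞ M]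
  [MulAction (Fin k → Circle) M]
  {omega : ∀ x : M, FormAt (E := E) (Fin 2) ℝ x} {n : ℕ} {P : Polarization omega n}
  {ι : Type*} [dι : DecidableEq ι] [Fintype ι]
  {L : M → Type*} [TopologicalSpace (TotalSpace ℂ L)]
  [∀ x, AddCommGroup (L x)] [∀ x, Module ℂ (L x)] [∀ x, TopologicalSpace (L x)]
  [∀ x, IsTopologicalAddGroup (L x)] [∀ x, ContinuousSMul ℝ (L x)]
  [FiberBundle ℂ L] [VectorBundle ℂ ℂ L] [VectorBundle ℝ ℂ L]
  [ContMDiffVectorBundle ∞ ℂ L 𝓘(ℝ, E)]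
  {κ : M → Type*} [TopologicalSpace (TotalSpace ℂ κ)]
  [∀ x, AddCommGroup (κ x)] [∀ x, Module ℂ (κ x)] [∀ x, TopologicalSpace (κ x)]
  [FiberBundle ℂ κ] [VectorBundle ℂ ℂ κ] [VectorBundle ℝ ℂ κ]
  [ContMDiffVectorBundle ∞ ℂ κ 𝓘(ℝ, E)]
  {nabla : CovariantDerivative 𝓘(ℝ, E) ℂ L} {h : HalfForm κ P ι} {η : Fin k → ℝ}
  {N : ℕ} {bE : Module.Basis (Fin N) ℝ E} {V : Set M} {s : ProdDist E L κ N V}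
  {μ : M → Fin k → ℝ} {a₀ : AdaptedBox nabla h η} {q : M}

/-- A function with vanishing derivative near a point of a flow box is locally constant there. -/
theorem FlowBox.eventually_eq_of_mvfderiv_eq_zero {b : FlowBox E M η} (hq : q ∈ b.chart.source)
    {O : Set M} (hO : IsOpen O) (hqO : q ∈ O) {f : M → ℂ}
    (hf : ContMDiffOn 𝓘(ℝ, E) 𝓘(ℝ, ℂ) ∞ f O) (h0 : ∀ z ∈ O, ∀ v, mvfderiv 𝓘(ℝ, E) f z v = 0) :
    ∀ᶠ z in 𝓝 q, f z = f q := by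
  obtain ⟨C, hC, hC', hqC, hCO⟩ := b.exists_restrict_subset hq (hO.mem_nhds hqO)
  set b' := b.restrict hC hC'
  filter_upwards [source_mem_nhds hqC] with z hz
  have hfa : ∀ y ∈ b'.chart.target, ContMDiffAt 𝓘(ℝ, E) 𝓘(ℝ, ℂ) ∞ f (b'.chart.symm y) :=
    fun y hy => hf.contMDiffAt (hO.mem_nhds (hCO (b'.chart.map_target hy)))
  have h1 : ∀ y ∈ b'.chart.target,
      DifferentiableAt ℝ (fun y => f (b'.chart.symm y)) y := by
    intro y hy
    have h2 := contDiffAt_rep (b'.chart.map_target hy) (hfa y hy)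
    rw [b'.chart.right_inv hy] at h2
    exact h2.differentiableAt (by simp)
  have h2 : ∀ y ∈ b'.chart.target, fderiv ℝ (fun y => f (b'.chart.symm y)) y = 0 := by
    intro y hy
    ext v
    have h3 := mvfderiv_eq_fderiv (b'.chart.map_target hy) (hfa y hy)
      (b'.field v (b'.chart.symm y))
    rw [h0 _ (hCO (b'.chart.map_target hy)), coord_field (b'.chart.map_target hy),
      b'.chart.right_inv hy] at h3
    exact h3.symm
  have h3 := b'.chart.open_target.is_const_of_fderiv_eq_zero (𝕜 := ℝ) b'.convex.isPreconnected
    (fun y hy => (h1 y hy).differentiableWithinAt) (fun y hy => h2 y hy)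
    (b'.chart.map_source hz) (b'.chart.map_source hqC)
  simpa only [b'.chart.left_inv hz, b'.chart.left_inv hqC] using h3

/-- The holonomy of the canonical lift of the flow to `L ⊗ κ`, for `η` in the kernel of the
exponential map. -/
theorem exists_holonomy (hμ : IsHamiltonianTorusAction omega μ) (hL : IsPrequantum omega nabla)
    (hη : expT η = 1) (h₀ : a₀.IsInvariantOn bE s) (hq : q ∈ a₀.box.chart.source)
    (hbox : ∀ t : ℝ, ∃ a : AdaptedBox nabla h η, flow η t q ∈ a.box.chart.source ∧
      a.IsInvariantOn bE s) :
    ∃ (O : Set M) (H : M → ℂ), IsOpen O ∧ q ∈ O ∧ O ⊆ a₀.box.chart.source ∧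
      ContMDiffOn 𝓘(ℝ, E) 𝓘(ℝ, ℂ) ∞ H O ∧
      (∀ g : M → ℂ, IsTestFun E g O →
        pair s (a₀.test bE fun z => g z * H z) = pair s (a₀.test bE g)) ∧
      (∀ z ∈ O, ∀ l : ∀ t : ℝ, L (flow η t z) ⊗[ℂ] κ (flow η t z), IsTransport nabla h η z 1 l →
        a₀.coef (flow η 1 z) (l 1) = H z * a₀.coef (flow η 0 z) (l 0)) ∧
      ∀ᶠ z in 𝓝 q, momentComp μ η z = momentComp μ η q → H z = H q := by
  have hT : SmoothTorusAction k E M := hμ.smooth_action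
  obtain ⟨c₁⟩ := Continuation.nonempty_of_exists (μ := μ) hμ hL h₀ hq hbox
  -- Returning to the initial box closes the loop, so the coefficients compare the frames of `a₀`
  -- with themselves.
  set c := c₁.change hT hL a₀ h₀ (by rwa [flow_one hη]) with hc
  have hid : (flow η 1 : M → M) = id := funext fun y => flow_one hη y
  have hd : ∀ (z : M) (v : TangentSpace 𝓘(ℝ, E) z),
      (mfderiv 𝓘(ℝ, E) 𝓘(ℝ, E) (flow η 1) z v : E) = v := by
    intro z v
    rw [hid, mfderiv_id]
    rfl
  -- The flow at time 1 is the identity, so it preserves the volume form.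
  have hV : ∀ z ∈ c.nhd, c.gV z = 1 := by
    intro z hz
    have hza := c.subset hz
    have h1 := c.vol z hz fun i => a₀.box.field (bE i) z
    have h2 : ∀ (y : M) (hy : y = z) (w w' : Fin N → E), w' = w →
        a₀.box.vol bE y w' = a₀.box.vol bE z w := by
      rintro _ rfl _ _ rfl
      rfl
    have h3 := h2 _ (flow_one hη z) _ _ (funext fun i => hd z (a₀.box.field (bE i) z))
    have h4 : a₀.box.vol bE z (fun i => a₀.box.field (bE i) z) = 1 := by
      rw [FlowBox.vol_apply]
      simp only [FlowBox.coord_field hza]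
      rw [bE.det_self]
      simp
    have h5 := h3.symm.trans h1
    rw [h4, mul_one] at h5
    exact h5.symm
  -- For the same reason the square of the frame of κ is unchanged, so `gK` is a sign.
  have hK : ∀ z ∈ c.nhd, c.gK z * c.gK z = 1 := by
    intro z hz
    have h1 : ∃ w, h.sq (a₀.frK.sec z) w ≠ 0 := by
      by_contra! hc
      exact h.sq_ne_zero a₀.frK (c.subset hz) (AlternatingMap.ext hc)
    obtain ⟨w, hw⟩ := h1
    have h2 := c.sq z hz w
    have h3 : ∀ (y : M) (hy : y = z) (w w' : ι → E), w' = w →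
        h.sq (a₀.frK.sec y) w' = h.sq (a₀.frK.sec z) w := by
      rintro _ rfl _ _ rfl
      rfl
    have h4 := h3 _ (flow_one hη z) _ _ (funext fun i => hd z (w i))
    have h5 : c.gK z * c.gK z * h.sq (a₀.frK.sec z) w = 1 * h.sq (a₀.frK.sec z) w := by
      rw [one_mul]
      exact (congrArg _ h4.symm).trans h2
    exact mul_right_cancel₀ hw h5
  -- The two connection forms are now equal and cancel, leaving only the moment map term.
  have hdL : ∀ z ∈ c.nhd, ∀ v, mvfderiv 𝓘(ℝ, E) c.gL z v
      = -(Complex.I * (mvfderiv 𝓘(ℝ, E) (momentComp μ η) z v : ℝ)) * c.gL z := by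
    intro z hz v
    have h1 := c.theta z hz v
    have h2 : ∀ (y : M) (hy : y = z) (v v' : E), v' = v → a₀.theta y v' = a₀.theta z v := by
      rintro _ rfl _ _ rfl
      rfl
    have h3 := h2 _ (flow_one hη z) _ _ (hd z v)
    have h4 : a₀.theta z v * c.gL z + mvfderiv 𝓘(ℝ, E) c.gL z v = _ :=
      (congrArg (fun r => r * c.gL z + mvfderiv 𝓘(ℝ, E) c.gL z v) h3.symm).trans h1
    rw [Complex.ofReal_one, one_mul] at h4
    linear_combination h4
  refine ⟨c.nhd, fun z => c.gL z * c.gK z, c.isOpen, c.mem, c.subset, c.smooth_gL.cmul c.smooth_gK,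
    fun g hg => ?_, c.transport, ?_⟩
  · have h1 := c.pairing g hg
    have h2 : (fun z => g z * (c.gL z * c.gK z * c.gV z)) = fun z => g z * (c.gL z * c.gK z) := by
      funext z
      by_cases hz : z ∈ c.nhd
      · rw [hV z hz, mul_one]
      · rw [image_eq_zero_of_notMem_tsupport fun hzt => hz (hg.subset hzt), zero_mul, zero_mul]
    have h3 : (fun y => g (flow η (-1) y)) = g := by
      funext y
      conv_lhs => rw [← flow_one hη y, flow_neg_flow]
    rw [h2, h3] at h1
    exact h1
  · set A : M → ℂ := fun z => -(Complex.I * (momentComp μ η z : ℝ)) with hA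
    have hms := hμ.contMDiff_momentComp (E := E) η
    have hAL : ∀ z v, HasMFDerivAt 𝓘(ℝ, E) 𝓘(ℝ, ℂ) A z
        (((-Complex.I) • Complex.ofRealCLM).comp (mvfderiv 𝓘(ℝ, E) (momentComp μ η) z)) ∧
        mvfderiv 𝓘(ℝ, E) A z v
          = -(Complex.I * (mvfderiv 𝓘(ℝ, E) (momentComp μ η) z v : ℝ)) := by
      intro z v
      have h1 : HasMFDerivAt 𝓘(ℝ, ℝ) 𝓘(ℝ, ℂ) ((-Complex.I) • Complex.ofRealCLM)
          (momentComp μ η z) ((-Complex.I) • Complex.ofRealCLM) :=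
        ((-Complex.I) • Complex.ofRealCLM).hasMFDerivAt
      have h2 := h1.comp z (hms.mdifferentiableAt (by simp)).hasMFDerivAt
      have h3 : (((-Complex.I) • Complex.ofRealCLM) ∘ momentComp μ η) = A := by
        funext y
        simp [hA]
      rw [h3] at h2
      refine ⟨h2, ?_⟩
      rw [mvfderiv, h2.mfderiv]
      change (-Complex.I) * ((mvfderiv 𝓘(ℝ, E) (momentComp μ η) z v : ℝ) : ℂ) = _
      ring
    have hAs : ContMDiff 𝓘(ℝ, E) 𝓘(ℝ, ℂ) ∞ A := by
      have h1 := ((-Complex.I) • Complex.ofRealCLM).contMDiff.comp hms (n := ∞)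
      have h3 : (((-Complex.I) • Complex.ofRealCLM) ∘ momentComp μ η) = A := by
        funext y
        simp [hA]
      rwa [h3] at h1
    have hE := contMDiffOn_cexp_neg (hAs.contMDiffOn (s := c.nhd))
    -- Since `A` is -iμ_η, the product `gL` exp(-A) has zero derivative and is locally constant. On
    -- a level set of μ_η the exponential is fixed, hence so is `gL`.
    have hev := FlowBox.eventually_eq_of_mvfderiv_eq_zero hq c.isOpen c.mem
      (c.smooth_gL.cmul hE) fun z hz v => by
        rw [mvfderiv_cmul ((c.smooth_gL.contMDiffAt (c.isOpen.mem_nhds hz)).mdifferentiableAt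
          (by simp)) ((hE.contMDiffAt (c.isOpen.mem_nhds hz)).mdifferentiableAt (by simp)),
          mvfderiv_cexp_neg (hAL z v).1.mdifferentiableAt, hdL z hz, (hAL z v).2]
        ring
    have hKc : ContinuousAt c.gK q := (c.smooth_gK.contMDiffAt
      (c.isOpen.mem_nhds c.mem)).continuousAt
    filter_upwards [hev, c.isOpen.mem_nhds c.mem,
      hKc.preimage_mem_nhds (Metric.ball_mem_nhds _ one_pos)] with z hz hzn hzK hm
    have hAz : A z = A q := by rw [hA]; simp only [hm]
    rw [hAz] at hz
    rw [mul_right_cancel₀ (Complex.exp_ne_zero _) hz]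
    congr 1
    -- Two opposite signs would be at distance 2, but continuity has placed the values within
    -- distance 1.
    have h1 : (c.gK z - c.gK q) * (c.gK z + c.gK q) = 0 := by
      linear_combination hK z hzn - hK q c.mem
    rcases mul_eq_zero.1 h1 with h2 | h2
    · exact sub_eq_zero.1 h2
    · exfalso
      have h3 : ‖c.gK q‖ * ‖c.gK q‖ = 1 := by rw [← norm_mul, hK q c.mem, norm_one]
      have h4 : ‖c.gK q‖ = 1 := by nlinarith [norm_nonneg (c.gK q)]
      have h5 : dist (c.gK z) (c.gK q) < 1 := hzK
      rw [eq_neg_of_add_eq_zero_left h2, dist_eq_norm, ← neg_add', norm_neg, ← two_mul, norm_mul,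
        h4] at h5
      norm_num at h5

/-- The canonical lift of the flow of `η` to `L ⊗ κ` up to time `1` does not fix the fibre
over `x`. -/
def HasHolonomy (nabla : CovariantDerivative 𝓘(ℝ, E) ℂ L) (h : HalfForm κ P ι) (η : Fin k → ℝ)
    (x : M) : Prop :=
  ∃ l : ∀ t : ℝ, L (flow η t x) ⊗[ℂ] κ (flow η t x), IsTransport nabla h η x 1 l ∧
    (⟨flow η 1 x, l 1⟩ : Σ y : M, L y ⊗[ℂ] κ y) ≠ ⟨flow η 0 x, l 0⟩

theorem AdaptedBox.sigma_ext {a : AdaptedBox nabla h η} {p p' : Σ y : M, L y ⊗[ℂ] κ y}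
    (hp : p.1 ∈ a.box.chart.source) (hpp : p.1 = p'.1) (hc : a.coef p.1 p.2 = a.coef p'.1 p'.2) :
    p = p' := by
  obtain ⟨y, z⟩ := p
  obtain ⟨y', z'⟩ := p'
  obtain rfl : y = y' := hpp
  have h1 : z = z' := by
    rw [← a.coef_smul_sec hp z, ← a.coef_smul_sec hp z']
    exact congrArg (· • a.sec y) hc
  rw [h1]

/-- All transports over `z` are multiplied by the same factor `c`, so one nonzero transport decides
the question; `exists_isTransport` provides it. -/
theorem hasHolonomy_iff (hT : SmoothTorusAction k E M) (hL : IsPrequantum omega nabla)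
    (hX : ∀ y, cvec (fundField η y) 0 ∈ P.space y)
    (hη' : ∀ q : M, fundField (E := E) η q = (0 : E) → η = 0) (hη : expT η = 1)
    {a : AdaptedBox nabla h η} {z : M} (hz : z ∈ a.box.chart.source) {c : ℂ}
    (hc : ∀ l : ∀ t : ℝ, L (flow η t z) ⊗[ℂ] κ (flow η t z), IsTransport nabla h η z 1 l →
      a.coef (flow η 1 z) (l 1) = c * a.coef (flow η 0 z) (l 0)) :
    HasHolonomy nabla h η z ↔ c ≠ 1 := by
  have h10 : flow η 1 z = flow η 0 z := by rw [flow_one hη, flow_zero]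
  constructor
  · rintro ⟨l, hl, hne⟩ rfl
    refine hne (AdaptedBox.sigma_ext (a := a) ?_ h10 ?_)
    · change flow η 1 z ∈ _
      rwa [flow_one hη]
    · exact (hc l hl).trans (one_mul _)
  · intro hc1
    obtain ⟨l, hl, hl0⟩ := exists_isTransport hT hL hX hη' h z
    refine ⟨l, hl, fun heq => hc1 ?_⟩
    have h1 := congrArg (fun p : Σ y : M, L y ⊗[ℂ] κ y => a.coef p.1 p.2) heq
    have h2 : a.coef (flow η 1 z) (l 1) = a.coef (flow η 0 z) (l 0) := h1
    rw [hc l hl] at h2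
    refine mul_right_cancel₀ (b := a.coef (flow η 0 z) (l 0)) (fun h0 => hl0 ?_)
      (h2.trans (one_mul _).symm)
    rw [← a.coef_smul_sec (by rwa [flow_zero]) (l 0), h0, zero_smul]

end Holonomy

/-! ### Vanishing where the holonomy is nontrivial -/

section Vanishing

variable {m k : ℕ} {E : Type*} [NormedAddCommGroup E] [NormedSpace ℝ E] [FiniteDimensional ℝ E]
  {M : Type*} [TopologicalSpace M] [T2Space M] [ChartedSpace E M] [IsManifold 𝓘(ℝ, E) ∞ M]
  [MulAction (Fin k → Circle) M]
  {omega : ∀ x : M, FormAt (E := E) (Fin 2) ℝ x} {n : ℕ} {P : Polarization omega n}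
  {μ : M → Fin k → ℝ}
  {EB : Type*} [NormedAddCommGroup EB] [NormedSpace ℝ EB]
  {B : Type*} [TopologicalSpace B] [ChartedSpace EB B] [IsManifold 𝓘(ℝ, EB) ∞ B]
  {pr : M → B} {φ : B → Fin k → ℝ}
  {L : M → Type*} [TopologicalSpace (TotalSpace ℂ L)]
  [∀ x, AddCommGroup (L x)] [∀ x, Module ℂ (L x)] [∀ x, TopologicalSpace (L x)]
  [∀ x, IsTopologicalAddGroup (L x)] [∀ x, ContinuousSMul ℝ (L x)]
  [FiberBundle ℂ L] [VectorBundle ℂ ℂ L] [VectorBundle ℝ ℂ L]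
  [ContMDiffVectorBundle ∞ ℂ L 𝓘(ℝ, E)]
  {κ : M → Type*} [TopologicalSpace (TotalSpace ℂ κ)]
  [∀ x, AddCommGroup (κ x)] [∀ x, Module ℂ (κ x)] [∀ x, TopologicalSpace (κ x)]
  [FiberBundle ℂ κ] [VectorBundle ℂ ℂ κ] [VectorBundle ℝ ℂ κ]
  [ContMDiffVectorBundle ∞ ℂ κ 𝓘(ℝ, E)]
  {nabla : CovariantDerivative 𝓘(ℝ, E) ℂ L} {N : ℕ} {V : Set M} {s : ProdDist E L κ N V}

/-- The invariance says that `s` kills every `g * (H - 1)`. Where `H ≠ 1`, each test function has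
this form after division by `H - 1`. -/
theorem exists_vanishing_nhds {ι : Type*} [dι : DecidableEq ι] [Fintype ι]
    {h : HalfForm κ P ι} {η : Fin k → ℝ} (bE : Module.Basis (Fin N) ℝ E)
    {a : AdaptedBox nabla h η}
    (hV : a.box.chart.source ⊆ V) {O : Set M} (hO : IsOpen O) (hOa : O ⊆ a.box.chart.source)
    {H : M → ℂ} (hH : ContMDiffOn 𝓘(ℝ, E) 𝓘(ℝ, ℂ) ∞ H O)
    (hs : ∀ g : M → ℂ, IsTestFun E g O →
        pair s (a.test bE fun z => g z * H z) = pair s (a.test bE g))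
    {q : M} (hq : q ∈ O) (hHq : H q ≠ 1) :
    ∃ (W : Set M) (hW : W ⊆ V), IsOpen W ∧ q ∈ W ∧
      ∀ Φ : ProdTest E L κ N W, s.toFun (extendTest _ _ hW Φ) = 0 := by
  have hWo : IsOpen (O ∩ H ⁻¹' {1}ᶜ) :=
    hH.continuousOn.isOpen_inter_preimage hO isOpen_compl_singleton
  have hWV : O ∩ H ⁻¹' {1}ᶜ ⊆ V := inter_subset_left.trans (hOa.trans hV)
  refine ⟨O ∩ H ⁻¹' {1}ᶜ, hWV, hWo, ⟨hq, hHq⟩, fun Φ => ?_⟩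
  have hp := pair_of_mem s (testSpace_mono _ N hWV Φ.2)
  refine hp.symm.trans ?_
  obtain ⟨Φ, hΦ⟩ := Φ
  obtain ⟨K, hK, hKW, hK0⟩ := hΦ.2
  obtain ⟨f, hf, hf0, rfl⟩ := AdaptedBox.exists_eq_test bE hΦ hK
    (hKW.trans (inter_subset_left.trans hOa)) hK0
  have hfs : tsupport f ⊆ K := by
    refine closure_minimal (fun x hx => ?_) hK.isClosed
    by_contra hxK
    exact hx (hf0 x hxK)
  have hft : IsTestFun E f (O ∩ H ⁻¹' {1}ᶜ) :=
    ⟨hf, hK.of_isClosed_subset (isClosed_tsupport f) hfs, hfs.trans hKW⟩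
  have hH1 : ContMDiffOn 𝓘(ℝ, E) 𝓘(ℝ, ℂ) ∞ (fun z => H z - 1) (O ∩ H ⁻¹' {1}ᶜ) :=
    (hH.mono inter_subset_left).sub contMDiffOn_const
  -- This is the quotient of `f` by `H - 1`, still smooth with compact support where `H ≠ 1`.
  have hg := hft.mul_right hWo (hH1.cinv fun x hx => sub_ne_zero.2 hx.2)
  have hgH := (hg.mono inter_subset_left).mul_right hO hH
  have h1 := AdaptedBox.pair_test_sub (bE := bE) (s := s) hV (hgH.mono hOa)
    (hg.mono (inter_subset_left.trans hOa))
  rw [hs _ (hg.mono inter_subset_left), sub_self] at h1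
  rw [← h1]
  refine congrArg (fun g => pair s (a.test bE g)) (funext fun x => ?_)
  by_cases hx : x ∈ tsupport f
  · have hx1 : H x - 1 ≠ 0 := sub_ne_zero.2 (hft.subset hx).2
    field_simp
  · rw [image_eq_zero_of_notMem_tsupport hx]
    ring

variable {h : HalfForm κ P (Fin m ⊕ Fin k)}

/-- Polarized sections vanish near the leaves that are not Bohr–Sommerfeld. -/
theorem IsPolarizedDist.exists_vanishing_nhds (bE : Module.Basis (Fin N) ℝ E)
    {U : Set (Fin k → ℝ)} {s : ProdDist E L κ N (μ ⁻¹' U)}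
    (hs : IsPolarizedDist (EB := EB) nabla h μ pr φ s)
    (hP : IsFibering (EB := EB) P μ pr φ) (hL : IsPrequantum omega nabla)
    (hμ : IsHamiltonianTorusAction omega μ) {p : M} (hp : p ∈ μ ⁻¹' U)
    (hBS : ¬ IsBohrSommerfeld μ nabla h (μ p)) :
    ∃ (W : Set M) (hW : W ⊆ μ ⁻¹' U), IsOpen W ∧ p ∈ W ∧
      ∀ Φ : ProdTest E L κ N W, s.toFun (extendTest _ _ hW Φ) = 0 := by
  have hT : SmoothTorusAction k E M := hμ.smooth_action
  simp only [IsBohrSommerfeld, mem_range_self, true_and] at hBS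
  push Not at hBS
  -- The condition may fail at another point `p₀` of the leaf of `p`, so the failure has to be
  -- carried along the leaf.
  obtain ⟨p₀, hp₀, η, hη, l, c, hl, hc, hne⟩ := hBS
  have hX : ∀ y, cvec (fundField η y) 0 ∈ P.space y := fun y => (hP.fundField_mem hT η y).1
  have hη' := hμ.eq_zero_of_fundField_eq_zero hP.submersion_moment η
  have hbox : ∀ y ∈ μ ⁻¹' U, ∃ a : AdaptedBox nabla h η, y ∈ a.box.chart.source ∧
      a.IsInvariantOn bE s := by
    intro y hy
    obtain ⟨W, hW, hyW, hWV, hWs⟩ := hs.exists_nhds bE hP hL hμ η hy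
    obtain ⟨a, hya, haW⟩ := exists_adaptedBox hT hL hX h (hη' y) hW hyW
    exact ⟨a, hya, haW.trans hWV, hWs a haW⟩
  have hfl : ∀ y ∈ μ ⁻¹' U, ∀ t : ℝ, flow η t y ∈ μ ⁻¹' U := by
    intro y hy t
    change μ (_ • y) ∈ U
    rwa [hμ.invariant]
  -- On the leaf all components of `μ` are constant, so the holonomy is locally constant there.
  -- Connectedness of the fibre joins `p₀` to `p`.
  have hcon : HasHolonomy nabla h η p₀ = HasHolonomy nabla h η p := by
    refine (hP.connected_fibers (μ p)).eq_of_eventually_eq (fun q hq => ?_) hp₀ rfl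
    have hqU : q ∈ μ ⁻¹' U := by
      change μ q ∈ U
      rwa [show μ q = μ p from hq]
    obtain ⟨a, hqa, ha⟩ := hbox q hqU
    obtain ⟨O, H, hO, hqO, hOa, -, -, htr, hev⟩ :=
      exists_holonomy hμ hL hη ha hqa fun t => hbox _ (hfl q hqU t)
    filter_upwards [nhdsWithin_le_nhds hev, nhdsWithin_le_nhds (hO.mem_nhds hqO),
      self_mem_nhdsWithin] with z hz hzO hzS
    have hzq : momentComp μ η z = momentComp μ η q := by
      simp only [momentComp, show μ z = μ p from hzS, show μ q = μ p from hq]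
    refine propext ?_
    rw [hasHolonomy_iff hT hL hX hη' hη (hOa hzO) (htr z hzO),
      hasHolonomy_iff hT hL hX hη' hη (hOa hqO) (htr q hqO), hz hzq]
  have hp₀h : HasHolonomy nabla h η p₀ :=
    ⟨fun t => l t ⊗ₜ c t, isTransport_of_lifts hT hl hc 1, hne⟩
  have hph : HasHolonomy nabla h η p := cast hcon hp₀h
  obtain ⟨a, hpa, ha⟩ := hbox p hp
  obtain ⟨O, H, hO, hpO, hOa, hH, hpair, htr, -⟩ :=
    exists_holonomy hμ hL hη ha hpa fun t => hbox _ (hfl p hp t)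
  exact GeomQuant.exists_vanishing_nhds bE ha.subset hO hOa hH hpair hpO
    ((hasHolonomy_iff hT hL hX hη' hη hpa (htr p hpO)).1 hph)

end Vanishing

/-! ### Distributions are determined locally -/

section Localization

variable {E : Type*} [NormedAddCommGroup E] [NormedSpace ℝ E] [FiniteDimensional ℝ E]
  {M : Type*} [TopologicalSpace M] [T2Space M] [SecondCountableTopology M]
  [ChartedSpace E M] [IsManifold 𝓘(ℝ, E) ∞ M]
  {F : M → Type*} [∀ x, AddCommGroup (F x)] [∀ x, Module ℂ (F x)]
  {S : (∀ x, F x) → Set M → Prop} {N : ℕ} {V : Set M}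

theorem testSpace_smul_mem {Φ : ∀ x, F x →ₗ[ℂ] FormAt (E := E) (Fin N) ℂ x}
    (hΦ : Φ ∈ testSpace (E := E) S N V) {ρ : M → ℝ} (hρ : ContMDiff 𝓘(ℝ, E) 𝓘(ℝ, ℝ) ∞ ρ)
    {W : Set M} (hW : tsupport ρ ⊆ W) :
    (fun x => (ρ x : ℂ) • Φ x) ∈ testSpace (E := E) S N W := by
  obtain ⟨hs, K, hK, hKV, hK0⟩ := hΦ
  refine ⟨fun W₁ hW₁ e he W₂ hW₂ h₂₁ Y hY => ?_, K ∩ tsupport ρ,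
    hK.inter_right (isClosed_tsupport ρ), inter_subset_right.trans hW, fun x hx => ?_⟩
  · exact (Complex.ofRealCLM.contMDiff.comp_contMDiffOn hρ.contMDiffOn).cmul
      (hs W₁ hW₁ e he W₂ hW₂ h₂₁ Y hY)
  · by_cases hxK : x ∈ K
    · have h0 : ρ x = 0 := image_eq_zero_of_notMem_tsupport fun hxρ => hx ⟨hxK, hxρ⟩
      simp [h0]
    · exact (congrArg (fun z => (ρ x : ℂ) • z) (hK0 x hxK)).trans (smul_zero _)

/-- A distributional section that vanishes locally is zero. -/
theorem DistSection.toFun_eq_zero_of_locally (s : DistSection (E := E) (F := F) S N V)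
    (hs : ∀ p ∈ V, ∃ (W : Set M) (hW : W ⊆ V), IsOpen W ∧ p ∈ W ∧
      ∀ Φ : testSpace (E := E) S N W, s.toFun (extendTest S N hW Φ) = 0) : s.toFun = 0 := by
  have hlc : LocallyCompactSpace M := Manifold.locallyCompact_of_finiteDimensional 𝓘(ℝ, E)
  refine LinearMap.ext fun Φ => ?_
  obtain ⟨K, hK, hKV, hK0⟩ := Φ.2.2
  choose W hWV hWo hpW hWs using hs
  -- A partition of unity on the compact support `K` cuts the test section into finitely many
  -- pieces, each supported where `s` vanishes.
  obtain ⟨ρ, hρ⟩ := SmoothPartitionOfUnity.exists_isSubordinate 𝓘(ℝ, E) hK.isClosed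
    (fun p : K => W p (hKV p.2)) (fun p => hWo p _)
    (fun x hx => mem_iUnion.2 ⟨⟨x, hx⟩, hpW x _⟩)
  have hfin : {i | (Function.support (ρ i) ∩ K).Nonempty}.Finite :=
    ρ.locallyFinite.finite_nonempty_inter_compact hK
  have hmem : ∀ i : K, (fun x => ((ρ i x : ℝ) : ℂ) • Φ.1 x)
      ∈ testSpace (E := E) S N (W i (hKV i.2)) := fun i =>
    testSpace_smul_mem Φ.2 (ρ i).contMDiff (hρ i)
  have hsum : Φ = ∑ i ∈ hfin.toFinset, extendTest S N (hWV i (hKV i.2)) ⟨_, hmem i⟩ := by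
    refine Subtype.ext (funext fun x => ?_)
    rw [AddSubmonoidClass.coe_finsetSum, Finset.sum_apply]
    change Φ.1 x = ∑ i ∈ hfin.toFinset, ((ρ i x : ℝ) : ℂ) • Φ.1 x
    by_cases hx : x ∈ K
    · have h1 := ρ.sum_eq_one hx
      rw [finsum_eq_sum_of_support_subset (s := hfin.toFinset) _ (fun i hi => by
        simp only [Finite.coe_toFinset, mem_ofPred_eq]
        exact ⟨x, hi, hx⟩)] at h1
      rw [← Finset.sum_smul, ← Complex.ofReal_sum, h1, Complex.ofReal_one, one_smul]
    · simp [hK0 x hx]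
  rw [hsum, map_sum]
  exact Finset.sum_eq_zero fun i _ => hWs i _ _

end Localization

end GeomQuant

end

/-! ### The vanishing theorem -/

open GeomQuant in
theorem mainTheorem2 {m k : ℕ}
    {E : Type*} [NormedAddCommGroup E] [NormedSpace ℝ E] [FiniteDimensional ℝ E]
    (hE : Module.finrank ℝ E = 2 * (m + k))
    {M : Type*} [TopologicalSpace M] [T2Space M] [SecondCountableTopology M]
    [ChartedSpace E M] [IsManifold 𝓘(ℝ, E) ∞ M]
    [MulAction (Fin k → Circle) M]
    (omega : ∀ x : M, FormAt (E := E) (Fin 2) ℝ x) (hom : IsSymplecticForm omega)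
    (μ : M → Fin k → ℝ) (hμ : IsHamiltonianTorusAction omega μ)
    {EB : Type*} [NormedAddCommGroup EB] [NormedSpace ℝ EB] [FiniteDimensional ℝ EB]
    {B : Type*} [TopologicalSpace B] [ChartedSpace EB B] [IsManifold 𝓘(ℝ, EB) ∞ B]
    (pr : M → B) (φ : B → Fin k → ℝ)
    (P : Polarization omega (m + k)) (hP : IsFibering (EB := EB) P μ pr φ)
    (L : M → Type*) [TopologicalSpace (TotalSpace ℂ L)]
    [∀ x, AddCommGroup (L x)] [∀ x, Module ℂ (L x)] [∀ x, TopologicalSpace (L x)]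
    [∀ x, IsTopologicalAddGroup (L x)] [∀ x, ContinuousSMul ℝ (L x)]
    [FiberBundle ℂ L] [VectorBundle ℂ ℂ L] [VectorBundle ℝ ℂ L]
    [ContMDiffVectorBundle ∞ ℂ L 𝓘(ℝ, E)]
    (nabla : CovariantDerivative 𝓘(ℝ, E) ℂ L)
    (hL : IsPrequantum omega nabla)
    (κ : M → Type*) [TopologicalSpace (TotalSpace ℂ κ)]
    [∀ x, AddCommGroup (κ x)] [∀ x, Module ℂ (κ x)] [∀ x, TopologicalSpace (κ x)]
    [FiberBundle ℂ κ] [VectorBundle ℂ ℂ κ] [VectorBundle ℝ ℂ κ]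
    [ContMDiffVectorBundle ∞ ℂ κ 𝓘(ℝ, E)]
    (h : HalfForm κ P (Fin m ⊕ Fin k)) :
    (∀ U : Set (Fin k → ℝ), IsOpen U → (∀ ξ ∈ U, ¬ IsBohrSommerfeld μ nabla h ξ) →
      ∀ s : ProdDist E L κ (2 * (m + k)) (μ ⁻¹' U),
        IsPolarizedDist (EB := EB) nabla h μ pr φ s → s.toFun = 0) ∧
    (∀ U : Set (Fin k → ℝ), IsOpen U →
      ∀ s : ProdDist E L κ (2 * (m + k)) (μ ⁻¹' U),
        IsPolarizedDist (EB := EB) nabla h μ pr φ s →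
        ∀ p ∈ μ ⁻¹' U, ¬ IsBohrSommerfeld μ nabla h (μ p) →
          ∃ (W : Set M) (hW : W ⊆ μ ⁻¹' U), IsOpen W ∧ p ∈ W ∧
            ∀ Φ : ProdTest E L κ (2 * (m + k)) W, s.toFun (extendTest _ _ hW Φ) = 0) := by
  have part : ∀ U : Set (Fin k → ℝ), IsOpen U →
      ∀ s : ProdDist E L κ (2 * (m + k)) (μ ⁻¹' U),
        IsPolarizedDist (EB := EB) nabla h μ pr φ s →
        ∀ p ∈ μ ⁻¹' U, ¬ IsBohrSommerfeld μ nabla h (μ p) →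
          ∃ (W : Set M) (hW : W ⊆ μ ⁻¹' U), IsOpen W ∧ p ∈ W ∧
            ∀ Φ : ProdTest E L κ (2 * (m + k)) W, s.toFun (extendTest _ _ hW Φ) = 0 :=
    fun U _ s hs p hp hBS => hs.exists_vanishing_nhds (Module.finBasisOfFinrankEq ℝ E hE) hP hL hμ
      hp hBS
  -- Over a set without Bohr–Sommerfeld points the local vanishing holds around every point, so the
  -- section is zero.
  exact ⟨fun U hU hBS s hs => s.toFun_eq_zero_of_locally fun p hp =>
    part U hU s hs p hp (hBS (μ p) hp), part⟩
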